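/- Let $N\ge 1$, $n=\lfloor N/2\rfloor$, and let $q\in\mathbb C$ be nonzero and not a root of unity. Let $E_{ij}$ be the matrix units of $\mathrm{End}\,\mathbb C^N$ and $$R(u,v)=(u-v)\sum_{i\ne j}E_{ii}\otimes E_{jj}+(q^{-1}u-qv)\sum_iE_{ii}\otimes E_{ii}+(q^{-1}-q)u\sum_{i>j}E_{ij}\otimes E_{ji}+(q^{-1}-q)v\sum_{i<j}E_{ij}\otimes E_{ji};$$ let $R^{t}(u,v)$ be obtained from it by transposing the first tensor factor. The algebra $\mathrm U_q(\widehat{\mathfrak{gl}}_N)$ is the associative unital $\mathbb C$-algebra with generators $t_{ij}^{(r)},\bar t_{ij}^{\,(r)}$ ($1\le i,j\le N$, $r\ge0$) and, with $T(u)=\big(\sum_{r\ge 0} t_{ij}^{(r)}u^{-r}\big)_{i,j}$ and $\overline T(u)=\big(\sum_{r\ge 0}\bar t_{ij}^{\,(r)}u^{r}\big)_{i,j}$, the defining relations $t_{ij}^{(0)}=\bar t_{ji}^{\,(0)}=0$ for $i<j$, $t_{ii}^{(0)}\bar t_{ii}^{\,(0)}=\bar t_{ii}^{\,(0)}t_{ii}^{(0)}=1$,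 and $$R(u,v)T_1(u)T_2(v)=T_2(v)T_1(u)R(u,v),\quad R(u,v)\overline T_1(u)\overline T_2(v)=\overline T_2(v)\overline T_1(u)R(u,v),\quad R(u,v)\overline T_1(u)T_2(v)=T_2(v)\overline T_1(u)R(u,v).$$ Here and below subscripts indicate the tensor factors in which an operator acts. Put $S(u)=(s_{ij}(u))=T(u)\,\overline T(u^{-1})^t$ and $\overline S(u)=(\bar s_{ij}(u))=\overline T(u)\,T(u^{-1})^t$, and let $\bar s^{\,t}_{ij}(u)=\bar s_{ji}(u)$ be the entries of $\overline S(u)^t$. Let $P^q=\sum_iE_{ii}\otimes E_{ii}+q\sum_{i>j}E_{ij}\otimes E_{ji}+q^{-1}\sum_{i<j}E_{ij}\otimes E_{ji}$, and let $A^q_N=\sum_{\sigma\in\mathfrak S_N}\mathrm{sgn}\,\sigma\cdot P^q_\sigma$ on $(\mathbb C^N)^{\otimes N}$, where $P^q_\sigma=P^q_{i_1,i_1+1}\cdots P^q_{i_l,i_l+1}$ for a reduced decomposition $\sigma=s_{i_1}\cdots s_{i_l}$ into adjacent transpositions. With $u_i=q^{-2i+2}u$ and $R^t_{ij}=R^t_{ij}(u_i^{-1},u_j)$,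 the Sklyanin determinant $\mathrm{sdet}\,S(u)$ is the Laurent series in $u^{-1}$ over $\mathrm U_q(\widehat{\mathfrak{gl}}_N)$ such that $$A^q_N\,S_1(u_1)R^t_{12}\cdots R^t_{1N}\,S_2(u_2)R^t_{23}\cdots R^t_{2N}\,S_3(u_3)\cdots R^t_{N-1,N}\,S_N(u_N)=\mathrm{sdet}\,S(u)\,A^q_N,$$ and $$c(u)=\gamma_N(u)^{-1}\,\mathrm{sdet}\,S(u),\qquad \gamma_N(u)=\prod_{1\le i<j\le N}\big(q^{2i-2}u^{-1}-q^{-2j+2}u\big),$$ where $\gamma_N(u)$ is inverted in the field $\mathbb C((u^{-1}))$. The map $\pi_N:p\mapsto p'$ on permutations $p=(p_1,\dots,p_N)$ of a set $\omega_1<\dots<\omega_N$ of positive integers is defined inductively. $\pi_1$ is the identity, and for $N=2$ always $p'=(\omega_1,\omega_2)$. For $N>2$ consider the map on ordered pairs of distinct elements $$(\omega_k,\omega_l)\mapsto(\omega_l,\omega_k)\ (k,l<N),\quad(\omega_k,\omega_N)\mapsto(\omega_{N-1},\omega_k),\ \ (\omega_N,\omega_k)\mapsto(\omega_k,\omega_{N-1})\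 (k<N-1),$$ $$(\omega_{N-1},\omega_N)\mapsto(\omega_{N-1},\omega_{N-2}),\quad(\omega_N,\omega_{N-1})\mapsto(\omega_{N-1},\omega_{N-2}).$$ Then $p'=(p'_1,\dots,p'_{N-1},\omega_N)$, where $(p'_1,p'_{N-1})$ is the image of $(p_1,p_N)$ under this map, and $(p'_2,\dots,p'_{N-2})$ is the image under $\pi_{N-2}$ of the permutation $(p_2,\dots,p_{N-1})$ of $\{\omega_1,\dots,\omega_N\}\setminus\{p_1,p_N\}$ with its last entry dropped. Let $l(p)$ be the number of inversions of $p$. Theorem. The Sklyanin determinant $\mathrm{sdet}\,S(u)$ exists and is unique, and $$c(u)=\sum_{p\in\mathfrak S_N}(-q)^{-l(p)+l(p')}\,\bar s^{\,t}_{p_1p'_1}(u^{-1})\cdots\bar s^{\,t}_{p_np'_n}(q^{2n-2}u^{-1})\; s_{p_{n+1}p'_{n+1}}(q^{-2n}u)\cdots s_{p_Np'_N}(q^{-2N+2}u),$$ where $\mathfrak S_N$ is the group of permutations of $\{1,\dots,N\}$, and in each product the factors are ordered by increasing $i$. -/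

import Mathlib

open scoped Kronecker

namespace TwistedQYangian

noncomputable section

/-! ### The trigonometric `R`-matrix and tensor leg notation -/

/-- Matrix unit `E_{ij}` with entries in `K`. -/
def E {N : ℕ} (K : Type*) [Ring K] (i j : Fin N) : Matrix (Fin N) (Fin N) K :=
  Matrix.single i j 1

/-- The trigonometric `R`-matrix `R(u,v)`, an element of `End ℂ^N ⊗ End ℂ^N` with coefficients
in a `ℂ`-algebra `K` containing the parameters `u`, `v`. -/
def trigR (N : ℕ) {K : Type*} [Ring K] [Algebra ℂ K] (q : ℂ) (u v : K) :
    Matrix (Fin N × Fin N) (Fin N × Fin N) K :=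
  (∑ i : Fin N, ∑ j : Fin N, if i ≠ j then (u - v) • (E K i i ⊗ₖ E K j j) else 0)
  + (∑ i : Fin N, (q⁻¹ • u - q • v) • (E K i i ⊗ₖ E K i i))
  + (∑ i : Fin N, ∑ j : Fin N,
      if j < i then ((q⁻¹ - q) • u) • (E K i j ⊗ₖ E K j i) else 0)
  + (∑ i : Fin N, ∑ j : Fin N,
      if i < j then ((q⁻¹ - q) • v) • (E K i j ⊗ₖ E K j i) else 0)

/-- Transposition in the first tensor factor. -/
def transpose₁ {N : ℕ} {K : Type*} (M : Matrix (Fin N × Fin N) (Fin N × Fin N) K) :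
    Matrix (Fin N × Fin N) (Fin N × Fin N) K :=
  Matrix.of fun x y => M (y.1, x.2) (x.1, y.2)

/-- `X_k`: the matrix `X` acting in the `k`-th factor of `(ℂ^N)^{⊗ r}`. -/
def oneSite {N r : ℕ} {K : Type*} [Zero K] (X : Matrix (Fin N) (Fin N) K) (k : Fin r) :
    Matrix (Fin r → Fin N) (Fin r → Fin N) K :=
  Matrix.of fun a b => if ∀ l, l ≠ k → a l = b l then X (a k) (b k) else 0

/-- `M_{kl}` for `k ≠ l`: the first tensor factor of `M` acts in the `k`-th factor of
`(ℂ^N)^{⊗ r}`, the second one in the `l`-th factor. -/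
def twoSite {N r : ℕ} {K : Type*} [Zero K] (M : Matrix (Fin N × Fin N) (Fin N × Fin N) K)
    (k l : Fin r) : Matrix (Fin r → Fin N) (Fin r → Fin N) K :=
  Matrix.of fun a b =>
    if ∀ m, m ≠ k → m ≠ l → a m = b m then M (a k, a l) (b k, b l) else 0

/-! ### The quantum affine algebra `U_q(ĝl_N)` -/

/-- The generators `t_{ij}^{(r)}` and `t̄_{ij}^{(r)}`. -/
inductive Gen (N : ℕ) : Type
  | t (i j : Fin N) (r : ℕ) : Gen N
  | tbar (i j : Fin N) (r : ℕ) : Gen N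

/-- The coefficient of `u^a` in `T(u) = ∑_{r ≥ 0} T^{(r)} u^{-r}`, over the free algebra. -/
def freeT (N : ℕ) (a : ℤ) : Matrix (Fin N) (Fin N) (FreeAlgebra ℂ (Gen N)) :=
  Matrix.of fun i j => if a ≤ 0 then FreeAlgebra.ι ℂ (Gen.t i j (-a).toNat) else 0

/-- The coefficient of `u^a` in `T̄(u) = ∑_{r ≥ 0} T̄^{(r)} u^{r}`, over the free algebra. -/
def freeTbar (N : ℕ) (a : ℤ) : Matrix (Fin N) (Fin N) (FreeAlgebra ℂ (Gen N)) :=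
  Matrix.of fun i j => if 0 ≤ a then FreeAlgebra.ι ℂ (Gen.tbar i j a.toNat) else 0

/-- The coefficient of `u^a v^b` in `R(u,v) X₁(u) Y₂(v)`. As `R(u,v)` is linear and homogeneous
in `(u,v)`, its coefficients at `u` and `v` are `R(1,0)` and `R(0,1)`. -/
def coeffRXY {N : ℕ} {K : Type*} [Ring K] [Algebra ℂ K] (q : ℂ)
    (X Y : ℤ → Matrix (Fin N) (Fin N) K) (a b : ℤ) :
    Matrix (Fin N × Fin N) (Fin N × Fin N) K :=
  trigR N q 1 0 * (X (a - 1) ⊗ₖ 1) * (1 ⊗ₖ Y b) + trigR N q 0 1 * (X a ⊗ₖ 1) * (1 ⊗ₖ Y (b - 1))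

/-- The coefficient of `u^a v^b` in `Y₂(v) X₁(u) R(u,v)`. -/
def coeffYXR {N : ℕ} {K : Type*} [Ring K] [Algebra ℂ K] (q : ℂ)
    (X Y : ℤ → Matrix (Fin N) (Fin N) K) (a b : ℤ) :
    Matrix (Fin N × Fin N) (Fin N × Fin N) K :=
  (1 ⊗ₖ Y b) * (X (a - 1) ⊗ₖ 1) * trigR N q 1 0 + (1 ⊗ₖ Y (b - 1)) * (X a ⊗ₖ 1) * trigR N q 0 1

/-- The defining relations of `U_q(ĝl_N)`. -/
inductive Rel (q : ℂ) (N : ℕ) : FreeAlgebra ℂ (Gen N) → FreeAlgebra ℂ (Gen N) → Prop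
  | t_zero (i j : Fin N) (h : i < j) : Rel q N (FreeAlgebra.ι ℂ (Gen.t i j 0)) 0
  | tbar_zero (i j : Fin N) (h : i < j) : Rel q N (FreeAlgebra.ι ℂ (Gen.tbar j i 0)) 0
  | t_tbar (i : Fin N) :
      Rel q N (FreeAlgebra.ι ℂ (Gen.t i i 0) * FreeAlgebra.ι ℂ (Gen.tbar i i 0)) 1
  | tbar_t (i : Fin N) :
      Rel q N (FreeAlgebra.ι ℂ (Gen.tbar i i 0) * FreeAlgebra.ι ℂ (Gen.t i i 0)) 1
  | rtt (a b : ℤ) (x y : Fin N × Fin N) :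
      Rel q N (coeffRXY q (freeT N) (freeT N) a b x y) (coeffYXR q (freeT N) (freeT N) a b x y)
  | rtbartbar (a b : ℤ) (x y : Fin N × Fin N) :
      Rel q N (coeffRXY q (freeTbar N) (freeTbar N) a b x y)
        (coeffYXR q (freeTbar N) (freeTbar N) a b x y)
  | rtbart (a b : ℤ) (x y : Fin N × Fin N) :
      Rel q N (coeffRXY q (freeTbar N) (freeT N) a b x y)
        (coeffYXR q (freeTbar N) (freeT N) a b x y)

/-- The quantum affine algebra `U_q(ĝl_N)` in its `R`-matrix presentation. -/
abbrev UqAff (q : ℂ) (N : ℕ) : Type := RingQuot (Rel q N)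

/-- The generator `t_{ij}^{(r)}` of `U_q(ĝl_N)`. -/
def t (q : ℂ) {N : ℕ} (i j : Fin N) (r : ℕ) : UqAff q N :=
  RingQuot.mkAlgHom ℂ (Rel q N) (FreeAlgebra.ι ℂ (Gen.t i j r))

/-- The generator `t̄_{ij}^{(r)}` of `U_q(ĝl_N)`. -/
def tbar (q : ℂ) {N : ℕ} (i j : Fin N) (r : ℕ) : UqAff q N :=
  RingQuot.mkAlgHom ℂ (Rel q N) (FreeAlgebra.ι ℂ (Gen.tbar i j r))

/-! ### Series in `u⁻¹`

`USeries q N` consists of the Laurent series in `u⁻¹` over `U_q(ĝl_N)`: the variable of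
`LaurentSeries` stands for `u⁻¹`, so that the coefficient with index `k` belongs to `u^{-k}`. -/

/-- Laurent series in `u⁻¹` with coefficients in `U_q(ĝl_N)`. -/
abbrev USeries (q : ℂ) (N : ℕ) : Type := LaurentSeries (UqAff q N)

/-- The monomial `c u`, as a Laurent series in `u⁻¹` over a `ℂ`-algebra `K`. -/
def cu (K : Type*) [Ring K] [Algebra ℂ K] (c : ℂ) : LaurentSeries K :=
  HahnSeries.single (-1) (algebraMap ℂ K c)

/-- The monomial `c u⁻¹`, as a Laurent series in `u⁻¹` over a `ℂ`-algebra `K`. -/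
def cuInv (K : Type*) [Ring K] [Algebra ℂ K] (c : ℂ) : LaurentSeries K :=
  HahnSeries.single 1 (algebraMap ℂ K c)

/-- The matrix `T(c u)`, with entries `∑_r t_{ij}^{(r)} (c u)^{-r}`. -/
def T (q : ℂ) (N : ℕ) (c : ℂ) : Matrix (Fin N) (Fin N) (USeries q N) :=
  Matrix.of fun i j => HahnSeries.ofPowerSeries ℤ (UqAff q N)
    (PowerSeries.mk fun r => (c⁻¹) ^ r • t q i j r)

/-- The matrix `T̄(c u⁻¹)`, with entries `∑_r t̄_{ij}^{(r)} (c u⁻¹)^{r}`. -/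
def Tbar (q : ℂ) (N : ℕ) (c : ℂ) : Matrix (Fin N) (Fin N) (USeries q N) :=
  Matrix.of fun i j => HahnSeries.ofPowerSeries ℤ (UqAff q N)
    (PowerSeries.mk fun r => c ^ r • tbar q i j r)

/-- The matrix `S(c u)`, where `S(u) = T(u) T̄(u⁻¹)ᵗ`. -/
def S (q : ℂ) (N : ℕ) (c : ℂ) : Matrix (Fin N) (Fin N) (USeries q N) :=
  T q N c * (Tbar q N c⁻¹).transpose

/-- The matrix `S̄(c u⁻¹)`, where `S̄(u) = T̄(u) T(u⁻¹)ᵗ`. -/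
def Sbar (q : ℂ) (N : ℕ) (c : ℂ) : Matrix (Fin N) (Fin N) (USeries q N) :=
  Tbar q N c * (T q N c⁻¹).transpose

/-! ### The `q`-antisymmetrizer -/

/-- The `q`-permutation operator `P^q` on `ℂ^N ⊗ ℂ^N`. -/
def Pq (N : ℕ) (q : ℂ) : Matrix (Fin N × Fin N) (Fin N × Fin N) ℂ :=
  (∑ i : Fin N, E ℂ i i ⊗ₖ E ℂ i i)
  + (∑ i : Fin N, ∑ j : Fin N, if j < i then q • (E ℂ i j ⊗ₖ E ℂ j i) else 0)
  + (∑ i : Fin N, ∑ j : Fin N, if i < j then q⁻¹ • (E ℂ i j ⊗ₖ E ℂ j i) else 0)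

/-- Indices `k` of the adjacent transpositions `(k, k+1)` of `Fin r`. -/
abbrev AdjIdx (r : ℕ) : Type := {k : ℕ // k + 1 < r}

/-- The left position moved by an adjacent transposition. -/
def AdjIdx.left {r : ℕ} (k : AdjIdx r) : Fin r := ⟨k.1, by have := k.2; omega⟩

/-- The right position moved by an adjacent transposition. -/
def AdjIdx.right {r : ℕ} (k : AdjIdx r) : Fin r := ⟨k.1 + 1, k.2⟩

/-- The product `s_{i_1} ⋯ s_{i_l}` of adjacent transpositions. -/
def wordPerm {r : ℕ} (w : List (AdjIdx r)) : Equiv.Perm (Fin r) :=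
  (w.map fun k => Equiv.swap k.left k.right).prod

/-- `w` is a reduced decomposition of `σ`. -/
def IsReducedWord {r : ℕ} (σ : Equiv.Perm (Fin r)) (w : List (AdjIdx r)) : Prop :=
  wordPerm w = σ ∧ ∀ w' : List (AdjIdx r), wordPerm w' = σ → w.length ≤ w'.length

theorem exists_wordPerm {r : ℕ} (σ : Equiv.Perm (Fin r)) : ∃ w, wordPerm w = σ := by
  cases r with
  | zero => exact ⟨[], Subsingleton.elim _ _⟩
  | succ n =>
    have h : σ ∈ Submonoid.closure
        (Set.range fun i : Fin n => Equiv.swap i.castSucc i.succ) := by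
      rw [Equiv.Perm.mclosure_swap_castSucc_succ]; trivial
    induction h using Submonoid.closure_induction with
    | mem x hx =>
      obtain ⟨i, rfl⟩ := hx
      refine ⟨[⟨i.1, by omega⟩], ?_⟩
      simp only [wordPerm, List.map_cons, List.map_nil, List.prod_cons, List.prod_nil, mul_one]
      rfl
    | one => exact ⟨[], rfl⟩
    | mul x y _ _ hx hy =>
      obtain ⟨v, rfl⟩ := hx
      obtain ⟨w, rfl⟩ := hy
      exact ⟨v ++ w, by simp [wordPerm]⟩

theorem exists_isReducedWord {r : ℕ} (σ : Equiv.Perm (Fin r)) : ∃ w, IsReducedWord σ w := by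
  classical
  have h : ∃ n, ∃ w : List (AdjIdx r), wordPerm w = σ ∧ w.length = n := by
    obtain ⟨w, hw⟩ := exists_wordPerm σ
    exact ⟨_, w, hw, rfl⟩
  obtain ⟨w, hw, hl⟩ := Nat.find_spec h
  exact ⟨w, hw, fun w' hw' => hl ▸ Nat.find_min' h ⟨w', hw', rfl⟩⟩

/-- The operator `P^q_σ = P^q_{s_{i_1}} ⋯ P^q_{s_{i_l}}` on `(ℂ^N)^{⊗ r}`, where
`σ = s_{i_1} ⋯ s_{i_l}` is a reduced decomposition. -/
def qPerm (N : ℕ) {r : ℕ} (q : ℂ) (σ : Equiv.Perm (Fin r)) :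
    Matrix (Fin r → Fin N) (Fin r → Fin N) ℂ :=
  ((exists_isReducedWord σ).choose.map fun k => twoSite (Pq N q) k.left k.right).prod

/-- The `q`-antisymmetrizer `A^q_r = ∑_σ sgn σ · P^q_σ`. -/
def qAntisym (N r : ℕ) (q : ℂ) : Matrix (Fin r → Fin N) (Fin r → Fin N) ℂ :=
  ∑ σ : Equiv.Perm (Fin r), ((Equiv.Perm.sign σ : ℤ) : ℂ) • qPerm N q σ

/-! ### The Sklyanin determinant and the series `c(u)`

The tensor factors `1, …, N` are numbered by `k = 0, …, N-1`, so that the spectral parameter of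
the factor `k` is `u_k = q^{-2k} u`. -/

/-- `R^t_{kl} = R^t_{kl}(u_k⁻¹, u_l)` with `u_k = q^{-2k} u`, acting on `(ℂ^N)^{⊗ N}`. -/
def Rt (q : ℂ) (N : ℕ) (k l : Fin N) :
    Matrix (Fin N → Fin N) (Fin N → Fin N) (USeries q N) :=
  twoSite (transpose₁ (trigR N q
    (cuInv (UqAff q N) (q ^ (2 * ((k : ℕ) : ℤ)))) (cu (UqAff q N) (q ^ (-2 * ((l : ℕ) : ℤ)))))) k l

/-- The ordered product
`S₁(u) R^t₁₂ ⋯ R^t₁_N S₂(q⁻²u) R^t₂₃ ⋯ R^t₂_N S₃(q⁻⁴u) ⋯ R^t_{N-1,N} S_N(q^{-2N+2}u)`. -/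
def sklyaninProduct (q : ℂ) (N : ℕ) :
    Matrix (Fin N → Fin N) (Fin N → Fin N) (USeries q N) :=
  ((List.finRange N).map fun k : Fin N =>
    oneSite (S q N (q ^ (-2 * ((k : ℕ) : ℤ)))) k *
      (((List.finRange N).filter fun l => k < l).map fun l => Rt q N k l).prod).prod

/-- `D` is the Sklyanin determinant `sdet S(u)`: the product of `A^q_N` with the ordered product
above equals `A^q_N` times the series `D`. -/
def IsSklyaninDet (q : ℂ) (N : ℕ) (D : USeries q N) : Prop :=
  (qAntisym N N q).map (algebraMap ℂ (USeries q N)) * sklyaninProduct q N =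
    D • (qAntisym N N q).map (algebraMap ℂ (USeries q N))

/-- The Sklyanin determinant `sdet S(u)`. -/
def sdet (q : ℂ) (N : ℕ) : USeries q N :=
  Classical.epsilon (IsSklyaninDet q N)

/-- `γ_N(u) = ∏_{1 ≤ i < j ≤ N} (q^{2i-2} u⁻¹ - q^{-2j+2} u)`, in the field of Laurent series in
`u⁻¹` over `ℂ`. -/
def gamma (q : ℂ) (N : ℕ) : LaurentSeries ℂ :=
  ∏ i : Fin N, ∏ j : Fin N,
    if i < j then cuInv ℂ (q ^ (2 * ((i : ℕ) : ℤ))) - cu ℂ (q ^ (-2 * ((j : ℕ) : ℤ))) else 1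

/-- The series `c(u) = γ_N(u)⁻¹ sdet S(u)`. -/
def c (q : ℂ) (N : ℕ) : USeries q N :=
  ((gamma q N)⁻¹).map (algebraMap ℂ (UqAff q N)) * sdet q N

end

/-! ### The map `π_N` on permutations -/

section PiMap

variable {α : Type*} [LinearOrder α]

/-- The map on ordered pairs, where `w₁ = ω_N`, `w₂ = ω_{N-1}`, `w₃ = ω_{N-2}` are the three
largest elements. -/
def pairMap (w₁ w₂ w₃ : α) (x : α × α) : α × α :=
  if x.2 = w₁ then
    if x.1 = w₂ then (w₂, w₃) else (w₂, x.1)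
  else if x.1 = w₁ then
    if x.2 = w₂ then (w₂, w₃) else (x.2, w₂)
  else (x.2, x.1)

/-- One step of the construction of `π_N`, on a permutation `(a, m₁, …, m_{N-2}, b)` written as a
list: `ω` are its entries in decreasing order and `m'` is the image of `(m₁, …, m_{N-2})`, whose
last entry is dropped. -/
def piStep (ω : List α) (a b : α) (m' : List α) : List α :=
  match ω with
  | w₁ :: w₂ :: w₃ :: _ =>
    (pairMap w₁ w₂ w₃ (a, b)).1 :: (m'.dropLast ++ [(pairMap w₁ w₂ w₃ (a, b)).2, w₁])
  | _ => []

/-- The map `π_N`, on permutations of an arbitrary set `ω_1 < ⋯ < ω_N` written in one-line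
notation. -/
def piList : List α → List α
  | [] => []
  | [a] => [a]
  | [a, b] => [min a b, max a b]
  | a :: b :: d :: l =>
    piStep ((a :: b :: d :: l).insertionSort (· ≥ ·)) a ((d :: l).getLast (by simp))
      (piList (b :: (d :: l).dropLast))
termination_by l => l.length
decreasing_by simp

theorem piStep_perm {ω m m' : List α} {a b M : α} (hω : ω.Pairwise (· ≥ ·))
    (hp : ω.Perm (a :: (m ++ [b]))) (hnd : (a :: (m ++ [b])).Nodup)
    (hm : (m'.dropLast ++ [M]).Perm m) (hM : ∀ x ∈ m, x ≤ M) :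
    (piStep ω a b m').Perm (a :: (m ++ [b])) ∧
      ∃ pre W, piStep ω a b m' = pre ++ [W] ∧ ∀ x ∈ a :: (m ++ [b]), x ≤ W := by
  have hlen := hp.length_eq
  have hmpos : 0 < m.length := by
    rw [← hm.length_eq]; simp
  have hnω : ω.Nodup := hp.nodup_iff.2 hnd
  match ω, hlen, hω, hp, hnω with
  | [], hlen, _, _, _ => simp at hlen
  | [_], hlen, _, _, _ => simp at hlen
  | [_, _], hlen, _, _, _ =>
    simp only [List.length_cons, List.length_append, List.length_nil] at hlen
    omega
  | w₁ :: w₂ :: w₃ :: ws, _, hω, hp, hnω =>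
    have hmem : ∀ x, x ∈ w₁ :: w₂ :: w₃ :: ws ↔ x ∈ a :: (m ++ [b]) := fun x => hp.mem_iff
    have hMm : M ∈ m := hm.mem_iff.1 (by simp)
    refine ⟨?_, (pairMap w₁ w₂ w₃ (a, b)).1 :: (m'.dropLast ++ [(pairMap w₁ w₂ w₃ (a, b)).2]),
      w₁, by simp [piStep], fun x hx => ?_⟩
    · have key : [(pairMap w₁ w₂ w₃ (a, b)).1, (pairMap w₁ w₂ w₃ (a, b)).2, w₁].Perm
          [a, b, M] := by
        have h1 := (hmem M).2 (by simp [hMm])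
        have h2 := (hmem a).2 (by simp)
        have h3 := (hmem b).2 (by simp)
        have e1 := (hmem w₁).1 (by simp)
        have e2 := (hmem w₂).1 (by simp)
        have e3 := (hmem w₃).1 (by simp)
        simp only [List.pairwise_cons, List.nodup_cons, List.mem_cons, List.mem_append,
          List.not_mem_nil, or_false] at hω hnω hnd h1 h2 h3 e1 e2 e3
        have hMa : M ≠ a := by rintro rfl; exact hnd.1 (Or.inl hMm)
        have hMb : M ≠ b := by
          rintro rfl
          have := (List.nodup_append.1 hnd.2).2.2 M hMm M (by simp)
          exact this rfl
        have hws : ∀ x ∈ ws, x ≤ w₃ := fun x hx => hω.2.2.1 x hx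
        have h12 : w₂ ≤ w₁ := hω.1 _ (Or.inl rfl)
        have h23 : w₃ ≤ w₂ := hω.2.1 _ (Or.inl rfl)
        have n12 : w₁ ≠ w₂ := fun h => hnω.1 (Or.inl h)
        have n13 : w₁ ≠ w₃ := fun h => hnω.1 (Or.inr (Or.inl h))
        have n23 : w₂ ≠ w₃ := fun h => hnω.2.1 (Or.inl h)
        have f1 : w₁ = a ∨ w₁ = b ∨ w₁ ≤ M := by
          rcases e1 with h | h | h
          exacts [Or.inl h, Or.inr (Or.inr (hM _ h)), Or.inr (Or.inl h)]
        have f2 : w₂ = a ∨ w₂ = b ∨ w₂ ≤ M := by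
          rcases e2 with h | h | h
          exacts [Or.inl h, Or.inr (Or.inr (hM _ h)), Or.inr (Or.inl h)]
        have f3 : w₃ = a ∨ w₃ = b ∨ w₃ ≤ M := by
          rcases e3 with h | h | h
          exacts [Or.inl h, Or.inr (Or.inr (hM _ h)), Or.inr (Or.inl h)]
        have g : M = w₁ ∨ M = w₂ ∨ M ≤ w₃ := by
          rcases h1 with h | h | h | h
          exacts [Or.inl h, Or.inr (Or.inl h), Or.inr (Or.inr h.le), Or.inr (Or.inr (hws _ h))]
        have hab : a ≠ b := fun h => hnd.1 (Or.inr h)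
        clear hω hnω hnd h1 h2 h3 e1 e2 e3 hmem hp hm hM hws hlen hmpos
        have hMv : M = if b = w₁ then (if a = w₂ then w₃ else w₂)
            else if a = w₁ then (if b = w₂ then w₃ else w₂) else w₁ := by
          grind
        rw [List.perm_iff_count]
        intro x
        simp only [hMv, pairMap, List.count_cons, List.count_nil]
        split_ifs <;> grind
      have e : piStep (w₁ :: w₂ :: w₃ :: ws) a b m' = (pairMap w₁ w₂ w₃ (a, b)).1 ::
        (m'.dropLast ++ [(pairMap w₁ w₂ w₃ (a, b)).2, w₁]) := rfl
      rw [e, List.perm_iff_count]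
      intro x
      have k1 := List.perm_iff_count.1 key x
      have k2 := List.perm_iff_count.1 hm x
      simp only [List.count_cons, List.count_append, List.count_nil] at k1 k2 ⊢
      omega
    · have hx' := (hmem x).2 hx
      simp only [List.pairwise_cons] at hω
      rcases List.mem_cons.1 hx' with rfl | h
      · exact le_rfl
      · exact hω.1 x h

theorem piList_perm : ∀ (n : ℕ) (l : List α), l.length = n → l.Nodup →
    (piList l).Perm l ∧ (l ≠ [] → ∃ pre W, piList l = pre ++ [W] ∧ ∀ x ∈ l, x ≤ W) := by
  intro n
  induction n using Nat.strong_induction_on with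
  | _ n ih =>
    intro l hl hnd
    match l, hl, hnd with
    | [], _, _ => simp [piList]
    | [a], _, _ => exact ⟨by simp [piList], fun _ => ⟨[], a, by simp [piList], by simp⟩⟩
    | [a, b], _, _ =>
      refine ⟨?_, fun _ => ⟨[min a b], max a b, by simp [piList], by simp⟩⟩
      rw [piList]
      rcases le_total a b with h | h
      · simp [h]
      · simpa [h] using List.Perm.swap a b []
    | a :: b :: d :: l, hl, hnd =>
      have e : a :: b :: d :: l =
          a :: ((b :: (d :: l).dropLast) ++ [(d :: l).getLast (by simp)]) := by
        rw [List.cons_append, List.dropLast_append_getLast]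
      have hnd' := hnd
      rw [e] at hnd'
      have hmd : (b :: (d :: l).dropLast).Nodup :=
        (List.nodup_append.1 (List.nodup_cons.1 hnd').2).1
      obtain ⟨h1, h2⟩ := ih _ (by simp [← hl]) (b :: (d :: l).dropLast) rfl hmd
      obtain ⟨pre, W, hW, hmax⟩ := h2 (by simp)
      have hs := piStep_perm (ω := (a :: b :: d :: l).insertionSort (· ≥ ·))
        (m' := piList (b :: (d :: l).dropLast)) (M := W)
        (List.pairwise_insertionSort _ _)
        ((List.perm_insertionSort _ _).trans (by rw [← e])) hnd'
        (by rw [hW] at h1 ⊢; simpa using h1) hmax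
      rw [← e] at hs
      rw [piList]
      exact ⟨hs.1, fun _ => hs.2⟩

theorem piList_ofFn_perm {N : ℕ} (p : Equiv.Perm (Fin N)) :
    (piList (List.ofFn p)).Perm (List.ofFn p) :=
  (piList_perm _ _ rfl (List.nodup_ofFn.2 p.injective)).1

theorem length_piList_ofFn {N : ℕ} (p : Equiv.Perm (Fin N)) :
    (piList (List.ofFn p)).length = N := by
  rw [(piList_ofFn_perm p).length_eq, List.length_ofFn]

/-- The map `π_N : 𝔖_N → 𝔖_N`, `p ↦ p'`, where `p` is identified with the sequence
`(p_1, …, p_N)` of its values. -/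
noncomputable def piMap {N : ℕ} (p : Equiv.Perm (Fin N)) : Equiv.Perm (Fin N) :=
  Equiv.ofBijective
    (fun i => (piList (List.ofFn p)).get (i.cast (length_piList_ofFn p).symm))
    (Finite.injective_iff_bijective.1 fun i j h => by
      have hn : (piList (List.ofFn p)).Nodup :=
        (piList_ofFn_perm p).nodup_iff.2 (List.nodup_ofFn.2 p.injective)
      simpa using List.nodup_iff_injective_get.1 hn h)

end PiMap

/-- The length `l(p)` of a permutation: its number of inversions. -/
def length {N : ℕ} (p : Equiv.Perm (Fin N)) : ℕ :=
  (Finset.univ.filter fun x : Fin N × Fin N => x.1 < x.2 ∧ p x.2 < p x.1).card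

end TwistedQYangian

/-!
By the `RTT` relations the Sklyanin product equals `∏ T · ∏ R^t · ∏ T̄ᵗ`. The factors `∏ T` and
`∏ T̄ᵗ` map `q`-antisymmetric row vectors to `q`-antisymmetric ones, and `∏ R^t` acts on them by a
scalar. As they form a free module of rank one, the product multiplies the rows of `A^q_N` by one
and the same series `sdet S(u)`, which can be read off from a single entry.

To evaluate that entry, peel off the outermost factors. The factor `S_1(u_1) R^t_{12} ⋯ R^t_{1N}`
acts on an antisymmetric vector through the entries of `S̄(u_1⁻¹)ᵗ`, up to the scalar
`∏ (x_1 - y_l)` with `x_i = u_i⁻¹` and `y_j = u_j`. Cancelling the last factor `S_N(u_N)` shows that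
the remaining partial product is antisymmetric in its first `N - 1` column indices, which may
therefore be reordered. For each pair `(p_1, p_N)` of outer row indices the largest index left is
dropped and the index needed for the evaluation is moved to the front: this choice is the map of
pairs defining `π`, and it leaves an antisymmetric vector of length `N - 2`. The scalars multiply up
to `γ_N(u)`.
-/

namespace TwistedQYangian

open Matrix Function

section Legs

variable {N r : ℕ} {A : Type*} [Semiring A]

theorem ext_of_vecMul_apply {ι κ : Type*} [Fintype ι] {M M' : Matrix ι κ A}
    (h : ∀ f b, (f ᵥ* M) b = (f ᵥ* M') b) : M = M' :=
  vecMul_injective (funext₂ h)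

theorem vecMul_oneSite (X : Matrix (Fin N) (Fin N) A) (k : Fin r) (f : (Fin r → Fin N) → A)
    (b : Fin r → Fin N) :
    (f ᵥ* oneSite X k) b = ∑ c, f (update b k c) * X c (b k) := by
  have update_apply {a : Fin r → Fin N} (ha : ∀ l, l ≠ k → a l = b l) : update b k (a k) = a :=
    update_eq_iff.2 ⟨rfl, fun l hl => (ha l hl).symm⟩
  simp only [vecMul, dotProduct, oneSite, of_apply, mul_ite, mul_zero]
  rw [← Finset.sum_filter]
  refine Finset.sum_nbij' (fun a => a k) (update b k) (by simp) ?_ ?_ (by simp) ?_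
  · simp +contextual
  · intro a ha
    exact update_apply (by simpa using ha)
  · intro a ha
    rw [update_apply (by simpa using ha)]

theorem vecMul_twoSite (M : Matrix (Fin N × Fin N) (Fin N × Fin N) A) {k l : Fin r} (hkl : k ≠ l)
    (f : (Fin r → Fin N) → A) (b : Fin r → Fin N) :
    (f ᵥ* twoSite M k l) b =
      ∑ c : Fin N × Fin N, f (update (update b k c.1) l c.2) * M c (b k, b l) := by
  have eq_update_update {a : Fin r → Fin N} (ha : ∀ m, m ≠ k → m ≠ l → a m = b m) :
      update (update b k (a k)) l (a l) = a :=
    update_eq_iff.2 ⟨rfl, fun m hml => by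
      rcases eq_or_ne m k with rfl | hmk
      · simp
      · simp [hmk, ha m hmk hml]⟩
  simp only [vecMul, dotProduct, twoSite, of_apply, mul_ite, mul_zero]
  rw [← Finset.sum_filter]
  refine Finset.sum_nbij' (fun a => (a k, a l)) (fun c => update (update b k c.1) l c.2)
    (by simp) ?_ ?_ (by simp [hkl]) ?_
  · simp +contextual
  · intro a ha
    exact eq_update_update (by simpa using ha)
  · intro a ha
    rw [eq_update_update (by simpa using ha)]

theorem oneSite_mul (X Y : Matrix (Fin N) (Fin N) A) (k : Fin r) :
    oneSite (X * Y) k = oneSite X k * oneSite Y k := by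
  refine ext_of_vecMul_apply fun f b => ?_
  rw [← vecMul_vecMul, vecMul_oneSite, vecMul_oneSite]
  simp only [vecMul_oneSite, Matrix.mul_apply, Finset.mul_sum, Finset.sum_mul]
  rw [Finset.sum_comm]
  simp [mul_assoc]

theorem twoSite_one {k l : Fin r} (hkl : k ≠ l) :
    twoSite (1 : Matrix (Fin N × Fin N) (Fin N × Fin N) A) k l = 1 := by
  refine ext_of_vecMul_apply fun f b => ?_
  rw [vecMul_twoSite _ hkl, vecMul_one, Finset.sum_eq_single (b k, b l)] <;>
    simp +contextual

theorem twoSite_mul (M M' : Matrix (Fin N × Fin N) (Fin N × Fin N) A) {k l : Fin r}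
    (hkl : k ≠ l) : twoSite (M * M') k l = twoSite M k l * twoSite M' k l := by
  refine ext_of_vecMul_apply fun f b => ?_
  rw [← vecMul_vecMul, vecMul_twoSite _ hkl, vecMul_twoSite _ hkl]
  simp only [vecMul_twoSite _ hkl, Matrix.mul_apply, Finset.mul_sum, Finset.sum_mul]
  rw [Finset.sum_comm]
  refine Finset.sum_congr rfl fun c _ => Finset.sum_congr rfl fun d _ => ?_
  have overwrite : update (update (update (update b k c.1) l c.2) k d.1) l d.2 =
      update (update b k d.1) l d.2 := by
    rw [update_comm hkl.symm, update_idem, update_idem]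
  simp [overwrite, hkl, mul_assoc]

theorem twoSite_kronecker_one (X : Matrix (Fin N) (Fin N) A) {k l : Fin r} (hkl : k ≠ l) :
    twoSite (X ⊗ₖ (1 : Matrix (Fin N) (Fin N) A)) k l = oneSite X k := by
  refine ext_of_vecMul_apply fun f b => ?_
  rw [vecMul_twoSite _ hkl, vecMul_oneSite, Fintype.sum_prod_type]
  refine Finset.sum_congr rfl fun c _ => ?_
  rw [Finset.sum_eq_single (b l)]
  · rw [update_comm hkl]
    simp [kroneckerMap_apply]
  · intro d _ hd
    simp [kroneckerMap_apply, hd]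
  · simp

theorem twoSite_one_kronecker (X : Matrix (Fin N) (Fin N) A) {k l : Fin r} (hkl : k ≠ l) :
    twoSite ((1 : Matrix (Fin N) (Fin N) A) ⊗ₖ X) k l = oneSite X l := by
  refine ext_of_vecMul_apply fun f b => ?_
  rw [vecMul_twoSite _ hkl, vecMul_oneSite, Fintype.sum_prod_type, Finset.sum_comm]
  refine Finset.sum_congr rfl fun c _ => ?_
  rw [Finset.sum_eq_single (b k)]
  · simp [kroneckerMap_apply]
  · intro d _ hd
    simp [kroneckerMap_apply, hd]
  · simp

theorem commute_oneSite_twoSite {X : Matrix (Fin N) (Fin N) A}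
    {M : Matrix (Fin N × Fin N) (Fin N × Fin N) A} {k i j : Fin r} (hij : i ≠ j)
    (hki : k ≠ i) (hkj : k ≠ j) (h : ∀ a b c d, Commute (X a b) (M c d)) :
    Commute (oneSite X k) (twoSite M i j) := by
  refine ext_of_vecMul_apply fun f b => ?_
  rw [← vecMul_vecMul, ← vecMul_vecMul, vecMul_twoSite _ hij, vecMul_oneSite]
  simp only [vecMul_oneSite, vecMul_twoSite _ hij, Finset.sum_mul]
  rw [Finset.sum_comm]
  refine Finset.sum_congr rfl fun c _ => Finset.sum_congr rfl fun d _ => ?_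
  rw [update_comm hkj.symm, update_comm hki.symm]
  simp [hki, hkj, hki.symm, hkj.symm, mul_assoc, (h _ _ _ _).eq]

theorem commute_twoSite_twoSite {M M' : Matrix (Fin N × Fin N) (Fin N × Fin N) A}
    {k l i j : Fin r} (hkl : k ≠ l) (hij : i ≠ j) (hki : k ≠ i) (hkj : k ≠ j) (hli : l ≠ i)
    (hlj : l ≠ j) (h : ∀ a b c d, Commute (M a b) (M' c d)) :
    Commute (twoSite M k l) (twoSite M' i j) := by
  refine ext_of_vecMul_apply fun f b => ?_
  rw [← vecMul_vecMul, ← vecMul_vecMul, vecMul_twoSite _ hij, vecMul_twoSite _ hkl]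
  simp only [vecMul_twoSite _ hkl, vecMul_twoSite _ hij, Finset.sum_mul]
  rw [Finset.sum_comm]
  refine Finset.sum_congr rfl fun c _ => Finset.sum_congr rfl fun d _ => ?_
  rw [update_comm hkj.symm, update_comm hki.symm, update_comm hlj.symm, update_comm hli.symm]
  simp [hki, hkj, hli, hlj, hki.symm, hkj.symm, hli.symm, hlj.symm, mul_assoc, (h _ _ _ _).eq]

/-- The operator `1 ⊗ M` on `ℂ^N ⊗ (ℂ^N)^{⊗ r}`. -/
def liftCons (M : Matrix (Fin r → Fin N) (Fin r → Fin N) A) :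
    Matrix (Fin (r + 1) → Fin N) (Fin (r + 1) → Fin N) A :=
  Matrix.of fun a b => if a 0 = b 0 then M (Fin.tail a) (Fin.tail b) else 0

/-- The operator `M ⊗ 1` on `(ℂ^N)^{⊗ r} ⊗ ℂ^N`. -/
def liftSnoc (M : Matrix (Fin r → Fin N) (Fin r → Fin N) A) :
    Matrix (Fin (r + 1) → Fin N) (Fin (r + 1) → Fin N) A :=
  Matrix.of fun a b => if a (Fin.last r) = b (Fin.last r) then M (Fin.init a) (Fin.init b) else 0

theorem vecMul_liftCons (M : Matrix (Fin r → Fin N) (Fin r → Fin N) A)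
    (f : (Fin (r + 1) → Fin N) → A) (c : Fin N) (b : Fin r → Fin N) :
    (f ᵥ* liftCons M) (Fin.cons c b) = ((fun a => f (Fin.cons c a)) ᵥ* M) b := by
  simp only [vecMul, dotProduct, liftCons, of_apply, mul_ite, mul_zero]
  rw [← (Fin.consEquiv fun _ => Fin N).sum_comp, Fintype.sum_prod_type, Finset.sum_eq_single c] <;>
    simp +contextual [Fin.consEquiv]

theorem vecMul_liftSnoc (M : Matrix (Fin r → Fin N) (Fin r → Fin N) A)
    (f : (Fin (r + 1) → Fin N) → A) (c : Fin N) (b : Fin r → Fin N) :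
    (f ᵥ* liftSnoc M) (Fin.snoc b c) = ((fun a => f (Fin.snoc a c)) ᵥ* M) b := by
  simp only [vecMul, dotProduct, liftSnoc, of_apply, mul_ite, mul_zero]
  rw [← (Fin.snocEquiv fun _ => Fin N).sum_comp, Fintype.sum_prod_type, Finset.sum_eq_single c] <;>
    simp +contextual [Fin.snocEquiv]

theorem liftCons_one : liftCons (1 : Matrix (Fin r → Fin N) (Fin r → Fin N) A) = 1 := by
  refine ext_of_vecMul_apply fun f b => ?_
  rw [← Fin.cons_self_tail b, vecMul_liftCons, vecMul_one, vecMul_one]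

theorem liftCons_mul (M M' : Matrix (Fin r → Fin N) (Fin r → Fin N) A) :
    liftCons (M * M') = liftCons M * liftCons M' := by
  refine ext_of_vecMul_apply fun f b => ?_
  rw [← Fin.cons_self_tail b, ← vecMul_vecMul, vecMul_liftCons, vecMul_liftCons]
  simp only [vecMul_liftCons]
  rw [← vecMul_vecMul]

theorem liftSnoc_one : liftSnoc (1 : Matrix (Fin r → Fin N) (Fin r → Fin N) A) = 1 := by
  refine ext_of_vecMul_apply fun f b => ?_
  rw [← Fin.snoc_init_self b, vecMul_liftSnoc, vecMul_one, vecMul_one]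

theorem liftSnoc_mul (M M' : Matrix (Fin r → Fin N) (Fin r → Fin N) A) :
    liftSnoc (M * M') = liftSnoc M * liftSnoc M' := by
  refine ext_of_vecMul_apply fun f b => ?_
  rw [← Fin.snoc_init_self b, ← vecMul_vecMul, vecMul_liftSnoc, vecMul_liftSnoc]
  simp only [vecMul_liftSnoc]
  rw [← vecMul_vecMul]

theorem liftCons_prod (L : List (Matrix (Fin r → Fin N) (Fin r → Fin N) A)) :
    liftCons L.prod = (L.map liftCons).prod := by
  induction L with
  | nil => simp [liftCons_one]
  | cons M L ih => simp [liftCons_mul, ih]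

theorem liftSnoc_prod (L : List (Matrix (Fin r → Fin N) (Fin r → Fin N) A)) :
    liftSnoc L.prod = (L.map liftSnoc).prod := by
  induction L with
  | nil => simp [liftSnoc_one]
  | cons M L ih => simp [liftSnoc_mul, ih]

theorem liftCons_oneSite (X : Matrix (Fin N) (Fin N) A) (k : Fin r) :
    liftCons (oneSite X k) = oneSite X k.succ := by
  ext a b
  have h0k : (0 : Fin (r + 1)) ≠ k.succ := (Fin.succ_ne_zero k).symm
  simp only [liftCons, oneSite, of_apply, Fin.forall_fin_succ, Fin.tail, ne_eq, h0k,
    not_false_eq_true, forall_const, Fin.succ_inj, ite_and]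
  congr!

theorem liftCons_twoSite (M : Matrix (Fin N × Fin N) (Fin N × Fin N) A) (k l : Fin r) :
    liftCons (twoSite M k l) = twoSite M k.succ l.succ := by
  ext a b
  have h0k : (0 : Fin (r + 1)) ≠ k.succ := (Fin.succ_ne_zero k).symm
  have h0l : (0 : Fin (r + 1)) ≠ l.succ := (Fin.succ_ne_zero l).symm
  simp only [liftCons, twoSite, of_apply, Fin.forall_fin_succ, Fin.tail, ne_eq, h0k, h0l,
    not_false_eq_true, forall_const, Fin.succ_inj, ite_and]
  congr!

theorem liftSnoc_oneSite (X : Matrix (Fin N) (Fin N) A) (k : Fin r) :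
    liftSnoc (oneSite X k) = oneSite X k.castSucc := by
  ext a b
  have hk : Fin.last r ≠ k.castSucc := (Fin.castSucc_lt_last k).ne'
  simp only [liftSnoc, oneSite, of_apply, Fin.forall_fin_succ', Fin.init, ne_eq, hk,
    not_false_eq_true, forall_const, Fin.castSucc_inj, and_comm, ite_and]
  congr!

theorem liftSnoc_twoSite (M : Matrix (Fin N × Fin N) (Fin N × Fin N) A) (k l : Fin r) :
    liftSnoc (twoSite M k l) = twoSite M k.castSucc l.castSucc := by
  ext a b
  have hk : Fin.last r ≠ k.castSucc := (Fin.castSucc_lt_last k).ne'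
  have hl : Fin.last r ≠ l.castSucc := (Fin.castSucc_lt_last l).ne'
  simp only [liftSnoc, twoSite, of_apply, Fin.forall_fin_succ', Fin.init, ne_eq, hk, hl,
    not_false_eq_true, forall_const, Fin.castSucc_inj, and_comm, ite_and]
  congr!

theorem vecMul_oneSite_zero (X : Matrix (Fin N) (Fin N) A) (f : (Fin (r + 1) → Fin N) → A)
    (c : Fin N) (b : Fin r → Fin N) :
    (f ᵥ* oneSite X 0) (Fin.cons c b) = ∑ e, f (Fin.cons e b) * X e c := by
  simp [vecMul_oneSite, Fin.update_cons_zero]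

theorem vecMul_oneSite_last (X : Matrix (Fin N) (Fin N) A) (f : (Fin (r + 1) → Fin N) → A)
    (c : Fin N) (b : Fin r → Fin N) :
    (f ᵥ* oneSite X (Fin.last r)) (Fin.snoc b c) = ∑ e, f (Fin.snoc b e) * X e c := by
  simp [vecMul_oneSite, Fin.update_snoc_last]

theorem commute_oneSite_liftCons {X : Matrix (Fin N) (Fin N) A}
    {M : Matrix (Fin r → Fin N) (Fin r → Fin N) A} (h : ∀ a b c d, Commute (X a b) (M c d)) :
    Commute (oneSite X 0) (liftCons M) := by
  refine ext_of_vecMul_apply fun f b => ?_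
  rw [← Fin.cons_self_tail b, ← vecMul_vecMul, ← vecMul_vecMul, vecMul_liftCons,
    vecMul_oneSite_zero]
  simp only [vecMul_liftCons, vecMul_oneSite_zero]
  simp only [vecMul, dotProduct, Finset.sum_mul]
  rw [Finset.sum_comm]
  simp only [mul_assoc, (h _ _ _ _).eq]

end Legs

section Inversions

variable {α : Type*} [LinearOrder α] {r : ℕ}

/-- The number of inversions of a finite sequence. -/
def invNum (b : Fin r → α) : ℕ :=
  ∑ i, ∑ j, if i < j ∧ b j < b i then 1 else 0

theorem length_eq_invNum {N : ℕ} (p : Equiv.Perm (Fin N)) : length p = invNum p := by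
  rw [length, invNum, Finset.card_filter, Fintype.sum_prod_type]

theorem AdjIdx.left_lt_right (k : AdjIdx r) : k.left < k.right :=
  Nat.lt_succ_self k.1

theorem AdjIdx.left_ne_right (k : AdjIdx r) : k.left ≠ k.right :=
  k.left_lt_right.ne

theorem AdjIdx.swap_lt_swap (k : AdjIdx r) {i j : Fin r} (h1 : ¬(i = k.left ∧ j = k.right))
    (h2 : ¬(i = k.right ∧ j = k.left)) :
    Equiv.swap k.left k.right i < Equiv.swap k.left k.right j ↔ i < j := by
  have hl : (k.left : ℕ) = k.1 := rfl
  have hr : (k.right : ℕ) = k.1 + 1 := rfl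
  simp only [Equiv.swap_apply_def]
  simp only [Fin.ext_iff, hl, hr] at h1 h2 ⊢
  split_ifs <;> simp only [Fin.lt_def, hl, hr] <;> omega

theorem invNum_comp_swap (b : Fin r → α) (k : AdjIdx r) (h : b k.left < b k.right) :
    invNum (b ∘ Equiv.swap k.left k.right) = invNum b + 1 := by
  set s := Equiv.swap k.left k.right with hs
  have reindexed : invNum (b ∘ s) = ∑ i, ∑ j, if s i < s j ∧ b j < b i then 1 else 0 := by
    rw [invNum, ← Equiv.sum_comp s]
    refine Finset.sum_congr rfl fun i _ => ?_
    rw [← Equiv.sum_comp s]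
    simp [hs]
  have one_new_inversion : ∀ i j, (if s i < s j ∧ b j < b i then 1 else 0) =
      (if i < j ∧ b j < b i then 1 else 0) + if i = k.right ∧ j = k.left then 1 else 0 := by
    intro i j
    by_cases c1 : i = k.left ∧ j = k.right
    · obtain ⟨rfl, rfl⟩ := c1
      simp [h.not_gt, k.left_ne_right]
    by_cases c2 : i = k.right ∧ j = k.left
    · obtain ⟨rfl, rfl⟩ := c2
      simp [hs, h, k.left_lt_right, k.left_lt_right.not_gt]
    simp only [hs, k.swap_lt_swap c1 c2, c2, if_false, add_zero]
  rw [reindexed]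
  simp only [one_new_inversion, Finset.sum_add_distrib, invNum]
  simp [ite_and]

theorem invNum_cons (e : α) (a : Fin r → α) :
    invNum (Fin.cons e a : Fin (r + 1) → α) = invNum a + ∑ j, if a j < e then 1 else 0 := by
  simp only [invNum, Fin.sum_univ_succ, Fin.cons_zero, Fin.cons_succ, false_and,
    if_false, zero_add, Fin.succ_pos, true_and, Fin.not_lt_zero, Fin.succ_lt_succ_iff]
  rw [add_comm]

theorem invNum_snoc (a : Fin r → α) (e : α) :
    invNum (Fin.snoc a e : Fin (r + 1) → α) = invNum a + ∑ j, if e < a j then 1 else 0 := by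
  have last_not_lt : ∀ i : Fin r, ¬ Fin.last r < i.castSucc :=
    fun i => (Fin.castSucc_lt_last i).not_gt
  simp only [invNum, Fin.sum_univ_castSucc, Fin.snoc_castSucc, Fin.snoc_last, lt_self_iff_false,
    last_not_lt, false_and, if_false, Finset.sum_const_zero, add_zero, Finset.sum_add_distrib,
    Fin.castSucc_lt_castSucc_iff, Fin.castSucc_lt_last, true_and]

end Inversions

/-! ### The operators `P^q` and `R^t` over an arbitrary field -/

section Operators

variable {N r : ℕ} {K A : Type*} [Field K] [Ring A] [Algebra K A]

/-- The nonzero entries of `P^q`. -/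
def pq (q : K) (i j : Fin N) : K := if j < i then q else if i < j then q⁻¹ else 1

theorem pq_self (q : K) (i : Fin N) : pq q i i = 1 := by simp [pq]

theorem pq_mul_pq {q : K} (hq : q ≠ 0) (i j : Fin N) : pq q i j * pq q j i = 1 := by
  rcases lt_trichotomy i j with h | h | h
  · simp [pq, h, h.not_gt, hq]
  · simp [pq, h]
  · simp [pq, h, h.not_gt, hq]

/-- The operator `P^q` over an arbitrary field. -/
def permMat (N : ℕ) (q : K) : Matrix (Fin N × Fin N) (Fin N × Fin N) K :=
  Matrix.of fun a b => if a.1 = b.2 ∧ a.2 = b.1 then pq q a.1 a.2 else 0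

/-- The coefficients of `R^t(x, y)` on the vectors `e_b ⊗ e_b`. -/
def rho (q x y : K) (c b : Fin N) : K :=
  if c < b then (q⁻¹ - q) * x else if b < c then (q⁻¹ - q) * y else q⁻¹ * x - q * y

/-- The operator `R^t(x, y)` over an arbitrary field. -/
def rtMat (N : ℕ) (q x y : K) : Matrix (Fin N × Fin N) (Fin N × Fin N) K :=
  Matrix.of fun a b =>
    if b.1 = b.2 then if a.1 = a.2 then rho q x y a.1 b.1 else 0 else if a = b then x - y else 0

/-- Extension of scalars for matrices. -/
abbrev base (A : Type*) [Ring A] [Algebra K A] {ι κ : Type*} (M : Matrix ι κ K) : Matrix ι κ A :=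
  M.map (algebraMap K A)

theorem base_commute {ι κ : Type*} (M : Matrix ι κ K) (a : A) (i : ι) (j : κ) :
    Commute a (base A M i j) := (Algebra.commutes _ _).symm

theorem base_mul {ι κ o : Type*} [Fintype κ] (M : Matrix ι κ K) (M' : Matrix κ o K) :
    base A (M * M') = base A M * base A M' := Matrix.map_mul

theorem base_one {ι : Type*} [DecidableEq ι] : base A (1 : Matrix ι ι K) = 1 :=
  Matrix.map_one _ (map_zero _) (map_one _)

theorem permMat_mul_self {q : K} (hq : q ≠ 0) : permMat N q * permMat N q = 1 := by
  ext ⟨a, b⟩ ⟨c, d⟩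
  rw [Matrix.mul_apply, Finset.sum_eq_single (b, a)]
  · by_cases h : a = c ∧ b = d
    · obtain ⟨rfl, rfl⟩ := h
      simp [permMat, pq_mul_pq hq]
    · simp [permMat, h, and_comm.not.1 h]
  · rintro ⟨x, y⟩ _ hxy
    have : ¬(a = y ∧ b = x) := by
      rintro ⟨rfl, rfl⟩
      exact hxy rfl
    simp [permMat, this]
  · simp

theorem vecMul_permMat (q : K) {k l : Fin r} (hkl : k ≠ l) (f : (Fin r → Fin N) → A)
    (b : Fin r → Fin N) :
    (f ᵥ* twoSite (base A (permMat N q)) k l) b =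
      pq q (b l) (b k) • f (b ∘ Equiv.swap k l) := by
  rw [vecMul_twoSite _ hkl, Finset.sum_eq_single (b l, b k)]
  · rw [Equiv.swap_comm, Equiv.comp_swap_eq_update]
    simp [permMat, Algebra.smul_def, Algebra.commutes]
  · rintro ⟨x, y⟩ _ hxy
    have : ¬(x = b l ∧ y = b k) := by
      rintro ⟨rfl, rfl⟩
      exact hxy rfl
    simp [permMat, this]
  · simp

theorem vecMul_rtMat (q x y : K) {k l : Fin r} (hkl : k ≠ l) (f : (Fin r → Fin N) → A)
    (b : Fin r → Fin N) :
    (f ᵥ* twoSite (base A (rtMat N q x y)) k l) b =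
      if b k = b l then ∑ c, rho q x y c (b k) • f (update (update b k c) l c)
      else (x - y) • f b := by
  rw [vecMul_twoSite _ hkl]
  split_ifs with h
  · rw [Fintype.sum_prod_type]
    refine Finset.sum_congr rfl fun c _ => ?_
    rw [Finset.sum_eq_single c]
    · simp [rtMat, h, Algebra.smul_def, Algebra.commutes]
    · intro d _ hd
      simp [rtMat, h, hd.symm]
    · simp
  · rw [Finset.sum_eq_single (b k, b l)]
    · simp [rtMat, h, Algebra.smul_def, Algebra.commutes, -map_sub]
    · intro d _ hd
      simp [rtMat, h, hd]
    · simp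

/-! ### `q`-antisymmetric row vectors -/

/-- A row vector is `q`-antisymmetric in the tensor factors `k` and `l` if `P^q_{kl}` acts on it
by `-1`. -/
def QAntisymmAt (q : K) (k l : Fin r) (f : (Fin r → Fin N) → A) : Prop :=
  ∀ b, f b = -(pq q (b l) (b k) • f (b ∘ Equiv.swap k l))

/-- A row vector is `q`-antisymmetric if it is so in any two adjacent tensor factors. -/
def QAntisymm (q : K) (f : (Fin r → Fin N) → A) : Prop :=
  ∀ k : AdjIdx r, QAntisymmAt q k.left k.right f

theorem qAntisymmAt_iff {q : K} {k l : Fin r} (hkl : k ≠ l) {f : (Fin r → Fin N) → A} :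
    QAntisymmAt q k l f ↔ f ᵥ* twoSite (base A (permMat N q)) k l = -f := by
  rw [funext_iff]
  simp only [vecMul_permMat q hkl, QAntisymmAt, Pi.neg_apply]
  exact forall_congr' fun b => by rw [eq_comm, neg_eq_iff_eq_neg]

theorem comp_swap_of_apply_eq {ι β : Type*} [DecidableEq ι] {b : ι → β} {i j : ι}
    (h : b i = b j) : b ∘ Equiv.swap i j = b := by
  rw [Equiv.comp_swap_eq_update, h, update_eq_self, ← h, update_eq_self]

variable {q : K}

theorem QAntisymm.weight_comp_swap {f : (Fin r → Fin N) → A} (hf : QAntisymm q f)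
    (k : AdjIdx r) (b : Fin r → Fin N) :
    (-q) ^ invNum (b ∘ Equiv.swap k.left k.right) • f (b ∘ Equiv.swap k.left k.right) =
      (-q) ^ invNum b • f b := by
  have of_lt : ∀ b : Fin r → Fin N, b k.left < b k.right →
      (-q) ^ invNum (b ∘ Equiv.swap k.left k.right) • f (b ∘ Equiv.swap k.left k.right) =
      (-q) ^ invNum b • f b := by
    intro b h
    rw [hf k b, invNum_comp_swap b k h, pow_succ, mul_smul]
    simp [pq, h]
  rcases lt_trichotomy (b k.left) (b k.right) with h | h | h
  · exact of_lt b h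
  · rw [comp_swap_of_apply_eq h]
  · have swap_swap : (b ∘ Equiv.swap k.left k.right) ∘ Equiv.swap k.left k.right = b := by
      ext m
      simp
    rw [← of_lt (b ∘ Equiv.swap k.left k.right) (by simpa using h), swap_swap]

theorem QAntisymm.weight_comp_perm {f : (Fin r → Fin N) → A} (hf : QAntisymm q f)
    (σ : Equiv.Perm (Fin r)) (b : Fin r → Fin N) :
    (-q) ^ invNum (b ∘ σ) • f (b ∘ σ) = (-q) ^ invNum b • f b := by
  obtain ⟨w, rfl⟩ := exists_wordPerm σ
  induction w generalizing b with
  | nil => simp [wordPerm]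
  | cons k w ih =>
    have : b ∘ wordPerm (k :: w) = (b ∘ Equiv.swap k.left k.right) ∘ wordPerm w := by
      ext m
      simp [wordPerm]
    rw [this, ih, hf.weight_comp_swap]

theorem exists_perm_comp_eq_of_range_eq {ι β : Type*} {b b' : ι → β} (hb : Injective b)
    (hb' : Injective b') (h : Set.range b' = Set.range b) :
    ∃ σ : Equiv.Perm ι, b' = b ∘ σ := by
  refine ⟨(Equiv.ofInjective b' hb').trans
    ((Equiv.setCongr h).trans (Equiv.ofInjective b hb).symm), ?_⟩
  ext m
  simp [Equiv.apply_ofInjective_symm hb]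

theorem QAntisymm.weight_eq {f : (Fin r → Fin N) → A} (hf : QAntisymm q f)
    {b b' : Fin r → Fin N} (hb : Injective b) (hb' : Injective b')
    (h : Set.range b' = Set.range b) : (-q) ^ invNum b • f b = (-q) ^ invNum b' • f b' := by
  obtain ⟨σ, rfl⟩ := exists_perm_comp_eq_of_range_eq hb hb' h
  exact (hf.weight_comp_perm σ b).symm

theorem exists_perm_apply_pair {ι : Type*} {i j k l : ι} (hij : i ≠ j) (hkl : k ≠ l) :
    ∃ σ : Equiv.Perm ι, σ k = i ∧ σ l = j := by
  classical
  have hk : k ≠ Equiv.swap k i j := by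
    rw [← (Equiv.swap k i).injective.ne_iff]
    simpa using hij
  exact ⟨Equiv.swap k i * Equiv.swap l (Equiv.swap k i j),
    by simp [Equiv.swap_apply_of_ne_of_ne hkl hk], by simp⟩

theorem QAntisymmAt.apply_eq_zero [NeZero (2 : K)] {f : (Fin r → Fin N) → A} {k l : Fin r}
    (hf : QAntisymmAt q k l f) {b : Fin r → Fin N} (h : b k = b l) : f b = 0 := by
  have eq_neg : f b = -f b := by
    simpa [comp_swap_of_apply_eq h, h, pq_self] using hf b
  have two_smul_eq_zero : (2 : K) • f b = 0 := by
    rw [two_smul]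
    exact add_eq_zero_iff_eq_neg.2 eq_neg
  exact (smul_eq_zero.1 two_smul_eq_zero).resolve_left two_ne_zero

theorem QAntisymm.apply_eq_zero [NeZero (2 : K)] (hq : q ≠ 0) {f : (Fin r → Fin N) → A}
    (hf : QAntisymm q f) {b : Fin r → Fin N} {i j : Fin r} (hij : i ≠ j) (h : b i = b j) :
    f b = 0 := by
  have hr : 0 + 1 < r := by
    have := Fin.val_injective.ne hij
    omega
  let k : AdjIdx r := ⟨0, hr⟩
  obtain ⟨σ, hi, hj⟩ := exists_perm_apply_pair hij k.left_ne_right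
  have at_left_right : f (b ∘ σ) = 0 := (hf k).apply_eq_zero (by simp [hi, hj, h])
  have weight := hf.weight_comp_perm σ b
  rw [at_left_right, smul_zero] at weight
  exact (smul_eq_zero.1 weight.symm).resolve_left (pow_ne_zero _ (neg_ne_zero.2 hq))

theorem QAntisymm.apply_eq_zero_of_not_injective [NeZero (2 : K)] (hq : q ≠ 0)
    {f : (Fin r → Fin N) → A} (hf : QAntisymm q f) {b : Fin r → Fin N} (h : ¬ Injective b) :
    f b = 0 := by
  obtain ⟨i, j, h, hij⟩ := not_injective_iff.1 h
  exact hf.apply_eq_zero hq hij h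

theorem QAntisymm.apply_eq_apply (hq : q ≠ 0) {f g : (Fin r → Fin N) → A} (hf : QAntisymm q f)
    (hg : QAntisymm q g) {b : Fin r → Fin N} (σ : Equiv.Perm (Fin r))
    (h : f (b ∘ σ) = g (b ∘ σ)) : f b = g b := by
  have weight := hf.weight_comp_perm σ b
  rw [h, hg.weight_comp_perm σ b] at weight
  exact (smul_right_injective A (pow_ne_zero _ (neg_ne_zero.2 hq)) weight).symm

theorem cons_comp_swap_succ {β : Type*} (c : β) (b : Fin r → β) (i j : Fin r) :
    (Fin.cons c b : Fin (r + 1) → β) ∘ Equiv.swap i.succ j.succ =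
      Fin.cons c (b ∘ Equiv.swap i j) := by
  simp only [Equiv.comp_swap_eq_update, Fin.cons_update, Fin.cons_succ]

theorem QAntisymmAt.cons_iff {f : (Fin (r + 1) → Fin N) → A} {i j : Fin r} :
    QAntisymmAt q i.succ j.succ f ↔ ∀ c, QAntisymmAt q i j fun a => f (Fin.cons c a) := by
  simp only [QAntisymmAt, Fin.forall_fin_succ_pi, cons_comp_swap_succ, Fin.cons_succ]

theorem QAntisymm.cons {f : (Fin (r + 1) → Fin N) → A} (hf : QAntisymm q f) (c : Fin N) :
    QAntisymm q fun a => f (Fin.cons c a) :=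
  fun k => QAntisymmAt.cons_iff.1 (hf ⟨k.1 + 1, Nat.succ_lt_succ k.2⟩) c

theorem QAntisymm.smul {f : (Fin r → Fin N) → A} (hf : QAntisymm q f) (c : K) :
    QAntisymm q (c • f) := by
  intro k b
  rw [Pi.smul_apply, Pi.smul_apply, hf k b, smul_neg, smul_comm]

theorem QAntisymm.snoc {f : (Fin (r + 1) → Fin N) → A} (hf : QAntisymm q f) (c : Fin N) :
    QAntisymm q fun a => f (Fin.snoc a c) := by
  intro k b
  let k' : AdjIdx (r + 1) := ⟨k.1, Nat.lt_succ_of_lt k.2⟩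
  have left_eq : k'.left = k.left.castSucc := rfl
  have right_eq : k'.right = k.right.castSucc := rfl
  have snoc_comp_swap : (Fin.snoc b c : Fin (r + 1) → Fin N) ∘ Equiv.swap k'.left k'.right =
      Fin.snoc (b ∘ Equiv.swap k.left k.right) c := by
    simp only [Equiv.comp_swap_eq_update, Fin.snoc_update, left_eq, right_eq, Fin.snoc_castSucc]
  have := hf k' (Fin.snoc b c)
  rwa [snoc_comp_swap, left_eq, right_eq, Fin.snoc_castSucc, Fin.snoc_castSucc] at this

theorem QAntisymm.vecMul_rtMat [NeZero (2 : K)] (hq : q ≠ 0) (x y : K) {k l : Fin r}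
    (hkl : k ≠ l) {f : (Fin r → Fin N) → A} (hf : QAntisymm q f) :
    f ᵥ* twoSite (base A (rtMat N q x y)) k l = (x - y) • f := by
  ext b
  rw [TwistedQYangian.vecMul_rtMat q x y hkl]
  split_ifs with h
  · rw [Pi.smul_apply, hf.apply_eq_zero hq hkl h, smul_zero]
    refine Finset.sum_eq_zero fun c _ => ?_
    rw [hf.apply_eq_zero hq hkl (by simp [hkl]), smul_zero]
  · rfl

theorem QAntisymmAt.vecMul_of_intertwine [NeZero (2 : K)] {k l : Fin r} (hkl : k ≠ l)
    (hq : q ≠ 0) {B C : Matrix (Fin r → Fin N) (Fin r → Fin N) A}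
    (h : (1 - twoSite (base A (permMat N q)) k l) * B =
      C * (1 - twoSite (base A (permMat N q)) k l))
    {f : (Fin r → Fin N) → A} (hf : QAntisymmAt q k l f) : QAntisymmAt q k l (f ᵥ* B) := by
  rw [qAntisymmAt_iff hkl] at hf ⊢
  set P := twoSite (base A (permMat N q)) k l with hP
  have P_mul_P : P * P = 1 := by
    rw [hP, ← twoSite_mul _ _ hkl, ← base_mul, permMat_mul_self hq, base_one, twoSite_one hkl]
  have two_smul_eq : (2 : K) • (f ᵥ* B) = f ᵥ* (C * (1 - P)) := by
    rw [← h, ← vecMul_vecMul, vecMul_sub, vecMul_one, hf, two_smul, sub_neg_eq_add, add_vecMul]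
  refine smul_right_injective _ (two_ne_zero' K) ?_
  dsimp only
  rw [← smul_vecMul, two_smul_eq, vecMul_vecMul, mul_assoc, sub_mul, one_mul, P_mul_P, smul_neg,
    two_smul_eq, ← vecMul_neg, ← mul_neg, neg_sub]

theorem QAntisymmAt.vecMul_of_commute {k l : Fin r} (hkl : k ≠ l)
    {B : Matrix (Fin r → Fin N) (Fin r → Fin N) A}
    (h : Commute B (twoSite (base A (permMat N q)) k l))
    {f : (Fin r → Fin N) → A} (hf : QAntisymmAt q k l f) : QAntisymmAt q k l (f ᵥ* B) := by
  rw [qAntisymmAt_iff hkl] at hf ⊢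
  rw [vecMul_vecMul, h.eq, ← vecMul_vecMul, hf, neg_vecMul]

end Operators

/-! ### The Yang–Baxter equation for `R^t` and `P^q` -/

section UpdateTriple

variable {ι β : Type*} [DecidableEq ι] (b : ι → β) {o i j : ι}

/-- The sequence `b` with its entries in the positions `o`, `i`, `j` replaced by `c`, `d`, `e`. -/
def updateTriple (b : ι → β) (o i j : ι) (c d e : β) : ι → β :=
  update (update (update b o c) i d) j e

theorem updateTriple_apply_fst (hoi : o ≠ i) (hoj : o ≠ j) (c d e : β) :
    updateTriple b o i j c d e o = c := by
  simp [updateTriple, hoi, hoj]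

theorem updateTriple_apply_snd (hij : i ≠ j) (c d e : β) : updateTriple b o i j c d e i = d := by
  simp [updateTriple, hij]

theorem updateTriple_apply_trd (c d e : β) : updateTriple b o i j c d e j = e := by
  simp [updateTriple]

theorem updateTriple_eq_self : updateTriple b o i j (b o) (b i) (b j) = b := by
  simp [updateTriple]

theorem updateTriple_comp_swap (hij : i ≠ j) (c d e : β) :
    updateTriple b o i j c d e ∘ Equiv.swap i j = updateTriple b o i j c e d := by
  ext m
  simp only [Function.comp_apply, Equiv.swap_apply_def, updateTriple, update_apply]
  grind

theorem update_update_updateTriple_fst_snd (hij : i ≠ j) (hoj : o ≠ j) (c d e t : β) :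
    update (update (updateTriple b o i j c d e) o t) i t = updateTriple b o i j t t e := by
  ext m
  simp only [updateTriple, update_apply]
  grind

theorem update_update_updateTriple_fst_trd (hoi : o ≠ i) (c d e t : β) :
    update (update (updateTriple b o i j c d e) o t) j t = updateTriple b o i j t d t := by
  ext m
  simp only [updateTriple, update_apply]
  grind

end UpdateTriple

section YangBaxter

variable {N r : ℕ} {K A : Type*} [Field K] [Ring A] [Algebra K A] {q : K}

theorem rho_relation (hq : q ≠ 0) (x y : K) {b c d : Fin N} (hbd : b ≠ d) (hcd : c ≠ d) :
    (x - q⁻¹ ^ 2 * y) * rho q x y c b =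
      -(pq q d b * (rho q x (q⁻¹ ^ 2 * y) d b * rho q x y c d -
        rho q x (q⁻¹ ^ 2 * y) c b * ((x - y) * pq q c d))) := by
  rcases hbd.lt_or_gt with h1 | h1 <;> rcases hcd.lt_or_gt with h2 | h2 <;>
  rcases lt_trichotomy c b with h3 | h3 | h3 <;>
  first
  | exfalso
    order
  | simp only [rho, pq, h1, h2, h3, h1.not_gt, h2.not_gt, h3.not_gt, if_true, if_false, lt_irrefl]
    field_simp
    ring

theorem rho_relation_self (hq : q ≠ 0) (x y : K) {b c : Fin N} (hcb : c ≠ b) :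
    rho q x (q⁻¹ ^ 2 * y) b b * rho q x y c b -
      rho q x (q⁻¹ ^ 2 * y) c b * ((x - y) * pq q c b) = 0 := by
  rcases hcb.lt_or_gt with h | h <;>
  · simp only [rho, pq, h, h.not_gt, if_true, if_false, lt_irrefl]
    field_simp
    ring

/-- The action of `R^t` in the first two of three tensor factors. -/
def act₁₂ (q x y : K) (V : Fin N → Fin N → Fin N → A) (a b c : Fin N) : A :=
  if a = b then ∑ e, rho q x y e a • V e e c else (x - y) • V a b c

/-- The action of `R^t` in the first and the third of three tensor factors. -/
def act₁₃ (q x y : K) (V : Fin N → Fin N → Fin N → A) (a b c : Fin N) : A :=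
  if a = c then ∑ e, rho q x y e a • V e b e else (x - y) • V a b c

section

variable {V : Fin N → Fin N → Fin N → A}

theorem act₁₃_act₁₂_apply_of_eq (x y : K) (hV : ∀ a b c, V a b c = -(pq q c b • V a c b))
    (h0 : ∀ a b, V a b b = 0) (b d : Fin N) :
    act₁₃ q x (q⁻¹ ^ 2 * y) (act₁₂ q x y V) b d b =
      ∑ c, (rho q x (q⁻¹ ^ 2 * y) d b * rho q x y c d -
        rho q x (q⁻¹ ^ 2 * y) c b * ((x - y) * pq q c d)) • V c c d := by
  have summand : ∀ c, rho q x (q⁻¹ ^ 2 * y) c b • act₁₂ q x y V c d c =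
      (if c = d then rho q x (q⁻¹ ^ 2 * y) d b • ∑ e, rho q x y e d • V e e d else 0) -
        (rho q x (q⁻¹ ^ 2 * y) c b * ((x - y) * pq q c d)) • V c c d := by
    intro c
    by_cases h : c = d
    · subst h
      simp [act₁₂, h0]
    · rw [act₁₂, if_neg h, if_neg h, hV c d c, zero_sub, smul_neg, smul_neg, smul_smul, smul_smul,
        mul_assoc]
  rw [act₁₃, if_pos rfl]
  simp only [summand, Finset.sum_sub_distrib, sub_smul, Finset.sum_ite_eq', Finset.mem_univ,
    if_true, Finset.smul_sum, smul_smul]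

theorem act₁₃_act₁₂_apply_self (hq : q ≠ 0) (x y : K)
    (hV : ∀ a b c, V a b c = -(pq q c b • V a c b)) (h0 : ∀ a b, V a b b = 0) (a : Fin N) :
    act₁₃ q x (q⁻¹ ^ 2 * y) (act₁₂ q x y V) a a a = 0 := by
  rw [act₁₃_act₁₂_apply_of_eq x y hV h0]
  refine Finset.sum_eq_zero fun e _ => ?_
  rcases eq_or_ne e a with rfl | h
  · rw [h0, smul_zero]
  · rw [rho_relation_self hq x y h, zero_smul]

theorem act₁₃_act₁₂_apply_of_ne (hq : q ≠ 0) (x y : K)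
    (hV : ∀ a b c, V a b c = -(pq q c b • V a c b)) (h0 : ∀ a b, V a b b = 0) {b d : Fin N}
    (hbd : b ≠ d) :
    act₁₃ q x (q⁻¹ ^ 2 * y) (act₁₂ q x y V) b b d =
      -(pq q d b • act₁₃ q x (q⁻¹ ^ 2 * y) (act₁₂ q x y V) b d b) := by
  rw [act₁₃_act₁₂_apply_of_eq x y hV h0, act₁₃, if_neg hbd, act₁₂, if_pos rfl, Finset.smul_sum,
    Finset.smul_sum, ← Finset.sum_neg_distrib]
  refine Finset.sum_congr rfl fun e _ => ?_
  rcases eq_or_ne e d with rfl | h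
  · simp [h0]
  · rw [smul_smul, smul_smul, ← neg_smul, rho_relation hq x y hbd h]

theorem act₁₃_act₁₂_swap (hq : q ≠ 0) (x y : K)
    (hV : ∀ a b c, V a b c = -(pq q c b • V a c b)) (h0 : ∀ a b, V a b b = 0) (a b c : Fin N) :
    act₁₃ q x (q⁻¹ ^ 2 * y) (act₁₂ q x y V) a b c =
      -(pq q c b • act₁₃ q x (q⁻¹ ^ 2 * y) (act₁₂ q x y V) a c b) := by
  rcases eq_or_ne a b with rfl | hab <;> rcases eq_or_ne a c with rfl | hac
  · rw [act₁₃_act₁₂_apply_self hq x y hV h0, smul_zero, neg_zero]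
  · exact act₁₃_act₁₂_apply_of_ne hq x y hV h0 hac
  · rw [act₁₃_act₁₂_apply_of_ne hq x y hV h0 hab, smul_neg, neg_neg, smul_smul, pq_mul_pq hq,
      one_smul]
  · simp only [act₁₃, act₁₂, if_neg hab, if_neg hac]
    rw [hV a b c, smul_neg, smul_neg, smul_comm (x - y) (pq q c b),
      smul_comm (x - q⁻¹ ^ 2 * y) (pq q c b)]

end

section

variable {o i j : Fin r}

theorem vecMul_rtMat_updateTriple_fst_snd (hoi : o ≠ i) (hoj : o ≠ j) (hij : i ≠ j) (x y : K)
    (g : (Fin r → Fin N) → A) (b : Fin r → Fin N) (c d e : Fin N) :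
    (g ᵥ* twoSite (base A (rtMat N q x y)) o i) (updateTriple b o i j c d e) =
      act₁₂ q x y (fun c d e => g (updateTriple b o i j c d e)) c d e := by
  simp only [vecMul_rtMat q x y hoi, updateTriple_apply_fst b hoi hoj,
    updateTriple_apply_snd b hij, update_update_updateTriple_fst_snd b hij hoj, act₁₂]

theorem vecMul_rtMat_updateTriple_fst_trd (hoi : o ≠ i) (hoj : o ≠ j) (x y : K)
    (g : (Fin r → Fin N) → A) (b : Fin r → Fin N) (c d e : Fin N) :
    (g ᵥ* twoSite (base A (rtMat N q x y)) o j) (updateTriple b o i j c d e) =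
      act₁₃ q x y (fun c d e => g (updateTriple b o i j c d e)) c d e := by
  simp only [vecMul_rtMat q x y hoj, updateTriple_apply_fst b hoi hoj, updateTriple_apply_trd,
    update_update_updateTriple_fst_trd b hoi, act₁₃]

theorem QAntisymmAt.vecMul_rtMat_mul_rtMat [NeZero (2 : K)] (hq : q ≠ 0) (x y : K) (hoi : o ≠ i)
    (hoj : o ≠ j) (hij : i ≠ j) {f : (Fin r → Fin N) → A} (hf : QAntisymmAt q i j f) :
    QAntisymmAt q i j (f ᵥ* (twoSite (base A (rtMat N q x y)) o i *
      twoSite (base A (rtMat N q x (q⁻¹ ^ 2 * y))) o j)) := by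
  intro b
  have apply_updateTriple : ∀ c d e, (f ᵥ* (twoSite (base A (rtMat N q x y)) o i *
      twoSite (base A (rtMat N q x (q⁻¹ ^ 2 * y))) o j)) (updateTriple b o i j c d e) =
      act₁₃ q x (q⁻¹ ^ 2 * y)
        (act₁₂ q x y fun c d e => f (updateTriple b o i j c d e)) c d e := by
    intro c d e
    rw [← vecMul_vecMul, vecMul_rtMat_updateTriple_fst_trd hoi hoj]
    simp only [vecMul_rtMat_updateTriple_fst_snd hoi hoj hij]
  have antisymm : ∀ c d e, f (updateTriple b o i j c d e) =
      -(pq q e d • f (updateTriple b o i j c e d)) := by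
    intro c d e
    have := hf (updateTriple b o i j c d e)
    rwa [updateTriple_comp_swap b hij, updateTriple_apply_snd b hij,
      updateTriple_apply_trd] at this
  have vanish : ∀ c d, f (updateTriple b o i j c d d) = 0 := fun c d =>
    hf.apply_eq_zero (by rw [updateTriple_apply_snd b hij, updateTriple_apply_trd])
  have comp_swap : b ∘ Equiv.swap i j = updateTriple b o i j (b o) (b j) (b i) := by
    conv_lhs => rw [← updateTriple_eq_self b (o := o) (i := i) (j := j)]
    exact updateTriple_comp_swap b hij _ _ _
  rw [comp_swap]
  conv_lhs => rw [← updateTriple_eq_self b (o := o) (i := i) (j := j)]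
  rw [apply_updateTriple, apply_updateTriple]
  exact act₁₃_act₁₂_swap hq x y antisymm vanish _ _ _

end

theorem exists_finRange_eq_append_left_right (k : AdjIdx r) : ∃ L L' : List (Fin r),
    List.finRange r = L ++ k.left :: k.right :: L' ∧
      (∀ l ∈ L, l ≠ k.left ∧ l ≠ k.right) ∧ ∀ l ∈ L', l ≠ k.left ∧ l ≠ k.right := by
  have hk := k.2
  have split : List.finRange r = (List.finRange r).take k.1 ++ k.left :: k.right ::
      (List.finRange r).drop (k.1 + 2) := by
    conv_lhs => rw [← List.take_append_drop k.1 (List.finRange r)]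
    rw [List.drop_eq_getElem_cons (by rw [List.length_finRange]; omega),
      List.drop_eq_getElem_cons (by rw [List.length_finRange]; omega)]
    simp [AdjIdx.left, AdjIdx.right]
  refine ⟨_, _, split, ?_⟩
  have nodup := List.nodup_finRange r
  rw [split] at nodup
  grind

theorem QAntisymmAt.vecMul_list_prod {i j : Fin r} (hij : i ≠ j)
    (L : List (Matrix (Fin r → Fin N) (Fin r → Fin N) A))
    (hL : ∀ B ∈ L, Commute B (twoSite (base A (permMat N q)) i j))
    {f : (Fin r → Fin N) → A} (hf : QAntisymmAt q i j f) : QAntisymmAt q i j (f ᵥ* L.prod) :=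
  hf.vecMul_of_commute hij (Commute.list_prod_left _ _ hL)

theorem QAntisymmAt.vecMul_finRange_prod {m : ℕ} {i j : Fin m} (hij : i ≠ j) (k : AdjIdx r)
    (B : Fin r → Matrix (Fin m → Fin N) (Fin m → Fin N) A)
    (hc : ∀ l, l ≠ k.left → l ≠ k.right → Commute (B l) (twoSite (base A (permMat N q)) i j))
    (hp : ∀ f : (Fin m → Fin N) → A, QAntisymmAt q i j f →
      QAntisymmAt q i j (f ᵥ* (B k.left * B k.right)))
    {f : (Fin m → Fin N) → A} (hf : QAntisymmAt q i j f) :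
    QAntisymmAt q i j (f ᵥ* ((List.finRange r).map B).prod) := by
  obtain ⟨L, L', h, hL, hL'⟩ := exists_finRange_eq_append_left_right k
  rw [h]
  simp only [List.map_append, List.map_cons, List.prod_append, List.prod_cons]
  rw [← mul_assoc (B k.left), ← vecMul_vecMul, ← vecMul_vecMul]
  refine (hp _ (hf.vecMul_list_prod hij _ ?_)).vecMul_list_prod hij _ ?_
  · exact List.forall_mem_map.2 fun l hl => hc l (hL l hl).1 (hL l hl).2
  · exact List.forall_mem_map.2 fun l hl => hc l (hL' l hl).1 (hL' l hl).2

end YangBaxter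

/-! ### Solutions of the `RTT` relations at the points `u_k = q^{-2k} u` -/

/-- Matrices `X_k = T(u_k)` and `Y_k = T̄(u_k⁻¹)ᵗ` subject to the relations of the quantum affine
algebra, with the spectral parameters `x_k = u_k⁻¹` and `y_k = u_k`. -/
structure RTTData (N : ℕ) {K : Type*} [Field K] (q : K) (A : Type*) [Ring A] [Algebra K A] where
  x : ℕ → K
  y : ℕ → K
  X : ℕ → Matrix (Fin N) (Fin N) A
  Y : ℕ → Matrix (Fin N) (Fin N) A
  y_succ : ∀ k, y (k + 1) = q⁻¹ ^ 2 * y k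
  ne_zero : ∀ k, q⁻¹ * x k - q * y k ≠ 0
  rXX : ∀ k, (1 - base A (permMat N q)) * (X k ⊗ₖ 1) * (1 ⊗ₖ X (k + 1)) =
    (1 ⊗ₖ X (k + 1)) * (X k ⊗ₖ 1) * (1 - base A (permMat N q))
  rYY : ∀ k, (1 - base A (permMat N q)) * (Y k ⊗ₖ 1) * (1 ⊗ₖ Y (k + 1)) =
    (1 ⊗ₖ Y (k + 1)) * (Y k ⊗ₖ 1) * (1 - base A (permMat N q))
  rYX : ∀ k l, (Y k ⊗ₖ 1) * base A (rtMat N q (x k) (y l)) * (1 ⊗ₖ X l) =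
    (1 ⊗ₖ X l) * base A (rtMat N q (x k) (y l)) * (Y k ⊗ₖ 1)
  cancelX : ∀ k (g : Fin N → A), g ᵥ* X k = 0 → g = 0
  cancelY : ∀ k (g : Fin N → A), g ᵥ* Y k = 0 → g = 0

section RtMatEntries

variable {N : ℕ} {K A : Type*} [Field K] [Ring A] [Algebra K A] (q x y : K)

theorem sum_rtMat_smul (F : Fin N → Fin N → A) (i j : Fin N) :
    ∑ m, ∑ n, rtMat N q x y (m, j) (i, n) • F m n =
      (if i = j then 0 else (x - y) • F i j) + rho q x y j i • F j i := by
  have entry : ∀ m n, rtMat N q x y (m, j) (i, n) =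
      (if m = i then if n = j then if i = j then 0 else x - y else 0 else 0) +
        if m = j then if n = i then rho q x y j i else 0 else 0 := by
    intro m n
    simp only [rtMat, of_apply, Prod.mk.injEq]
    grind
  simp [entry, add_smul, Finset.sum_add_distrib, ite_smul]

theorem rtMat_swap (a b m n : Fin N) :
    rtMat N q x y (a, n) (m, b) = rtMat N q x y (n, a) (b, m) := by
  simp only [rtMat, of_apply, Prod.mk.injEq]
  grind

variable (X Y : Matrix (Fin N) (Fin N) A) (i j a b : Fin N)

theorem kronecker_one_mul_rtMat_mul_one_kronecker_apply :
    ((Y ⊗ₖ (1 : Matrix (Fin N) (Fin N) A)) * base A (rtMat N q x y) *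
      ((1 : Matrix (Fin N) (Fin N) A) ⊗ₖ X)) (a, j) (i, b) =
      (if i = j then 0 else (x - y) • (Y a i * X j b)) + rho q x y j i • (Y a j * X i b) := by
  rw [← sum_rtMat_smul q x y fun m n => Y a m * X n b, Finset.sum_comm]
  simp [Matrix.mul_apply, Fintype.sum_prod_type, kroneckerMap_apply, Matrix.one_apply,
    Finset.sum_mul, ← Algebra.commutes, ← Algebra.smul_def]

theorem one_kronecker_mul_rtMat_mul_kronecker_one_apply :
    (((1 : Matrix (Fin N) (Fin N) A) ⊗ₖ X) * base A (rtMat N q x y) *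
      (Y ⊗ₖ (1 : Matrix (Fin N) (Fin N) A))) (a, j) (i, b) =
      (if b = a then 0 else (x - y) • (X j b * Y a i)) + rho q x y a b • (X j a * Y b i) := by
  rw [← sum_rtMat_smul q x y fun n m => X j n * Y m i, Finset.sum_comm]
  simp [Matrix.mul_apply, Fintype.sum_prod_type, kroneckerMap_apply, Matrix.one_apply,
    Finset.sum_mul, ← Algebra.commutes, ← Algebra.smul_def, rtMat_swap q x y a]

end RtMatEntries

namespace RTTData

variable {N : ℕ} {K A : Type*} [Field K] [Ring A] [Algebra K A] {q : K} (d : RTTData N q A)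

/-- The matrix `S(u_k)`. -/
def S (k : ℕ) : Matrix (Fin N) (Fin N) A := d.X k * d.Y k

/-- The matrix `S̄(u_k⁻¹)ᵗ`. -/
def SbarT (k : ℕ) : Matrix (Fin N) (Fin N) A := Matrix.of fun i j => ∑ m, d.Y k m j * d.X k i m

theorem cancelS (k : ℕ) (g : Fin N → A) (h : g ᵥ* d.S k = 0) : g = 0 := by
  rw [S, ← vecMul_vecMul] at h
  exact d.cancelX k g (d.cancelY k _ h)

theorem rYX_apply (k l : ℕ) (i j a b : Fin N) :
    (if i = j then 0 else (d.x k - d.y l) • (d.Y k a i * d.X l j b)) +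
        rho q (d.x k) (d.y l) j i • (d.Y k a j * d.X l i b) =
      (if b = a then 0 else (d.x k - d.y l) • (d.X l j b * d.Y k a i)) +
        rho q (d.x k) (d.y l) a b • (d.X l j a * d.Y k b i) := by
  rw [← kronecker_one_mul_rtMat_mul_one_kronecker_apply, d.rYX,
    one_kronecker_mul_rtMat_mul_kronecker_one_apply]

theorem smul_SbarT_add_smul_SbarT (k : ℕ) (i j : Fin N) :
    (if i = j then 0 else (d.x k - d.y k) • d.SbarT k j i) +
        rho q (d.x k) (d.y k) j i • d.SbarT k i j =
      (q⁻¹ * d.x k - q * d.y k) • d.S k j i := by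
  have rho_self (t : Fin N) : rho q (d.x k) (d.y k) t t = q⁻¹ * d.x k - q * d.y k := by
    simp [rho]
  have traced := Finset.sum_congr (rfl : Finset.univ = Finset.univ)
    fun t _ => d.rYX_apply k k i j t t
  simp only [if_true, zero_add, rho_self, Finset.sum_add_distrib, ← Finset.smul_sum] at traced
  rw [S, Matrix.mul_apply, ← traced, SbarT]
  split_ifs <;> simp [Finset.smul_sum]

theorem SbarT_apply_self (k : ℕ) (i : Fin N) : d.SbarT k i i = d.S k i i := by
  refine smul_right_injective A (d.ne_zero k) ?_
  simpa [rho] using d.smul_SbarT_add_smul_SbarT k i i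

theorem smul_S_sub_rho_smul_S (hq : q ≠ 0) (k : ℕ) {e b : Fin N} (heb : e ≠ b) :
    (d.x k - d.y k) • d.S k e b - rho q (d.x k) (d.y k) e b • d.S k b e =
      (q * d.x k - q⁻¹ * d.y k) • d.SbarT k e b := by
  have smul_S_eb := d.smul_SbarT_add_smul_SbarT k b e
  have smul_S_be := d.smul_SbarT_add_smul_SbarT k e b
  rw [if_neg heb.symm] at smul_S_eb
  rw [if_neg heb] at smul_S_be
  have determinant : (q⁻¹ * d.x k - q * d.y k) * (q * d.x k - q⁻¹ * d.y k) =
      (d.x k - d.y k) * (d.x k - d.y k) -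
        rho q (d.x k) (d.y k) e b * rho q (d.x k) (d.y k) b e := by
    rcases heb.lt_or_gt with h | h <;>
    · simp only [rho, h, h.not_gt, if_true, if_false]
      field_simp
      ring
  refine smul_right_injective A (d.ne_zero k) ?_
  dsimp only
  rw [smul_sub, smul_comm _ (d.x k - d.y k), smul_comm _ (rho _ _ _ _ _), ← smul_S_eb,
    ← smul_S_be, smul_smul, determinant]
  module

theorem rho_smul_S_sub_smul_S (hq : q ≠ 0) (k : ℕ) {e b : Fin N} (heb : e ≠ b) :
    rho q (d.x k) (d.y (k + 1)) b b • d.S k e b -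
        (pq q e b * rho q (d.x k) (d.y (k + 1)) e b) • d.S k b e =
      (d.x k - d.y (k + 1)) • d.SbarT k e b := by
  have coeff_diag : rho q (d.x k) (d.y (k + 1)) b b = q⁻¹ * (d.x k - d.y k) := by
    simp only [d.y_succ, rho, lt_irrefl, if_false]
    field_simp
  have coeff_off : pq q e b * rho q (d.x k) (d.y (k + 1)) e b =
      q⁻¹ * rho q (d.x k) (d.y k) e b := by
    rcases heb.lt_or_gt with h | h
    · simp only [rho, pq, h, h.not_gt, if_true, if_false]
    · simp only [d.y_succ, rho, pq, h, h.not_gt, if_true, if_false]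
      field_simp
  have coeff_bar : d.x k - d.y (k + 1) = q⁻¹ * (q * d.x k - q⁻¹ * d.y k) := by
    rw [d.y_succ]
    field_simp
  rw [coeff_diag, coeff_off, coeff_bar, mul_smul, mul_smul, mul_smul, ← smul_sub,
    d.smul_S_sub_rho_smul_S hq k heb]

end RTTData

/-! ### The ordered products -/

theorem mul_prod_mul_prod {M ι : Type*} [Monoid M] (y : M) (a x : ι → M) (L : List ι)
    (hL : L.Nodup) (hc : ∀ i j, i ≠ j → Commute (x i) (a j))
    (h : ∀ i, y * a i * x i = x i * a i * y) :
    y * (L.map a).prod * (L.map x).prod = (L.map x).prod * (L.map a).prod * y := by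
  induction L with
  | nil => simp
  | cons i L ih =>
    obtain ⟨hi, hL⟩ := List.nodup_cons.1 hL
    have commute_x : Commute (x i) (L.map a).prod := Commute.list_prod_right _ _ <|
      List.forall_mem_map.2 fun j hj => hc i j fun e => hi (e ▸ hj)
    have commute_a : Commute (a i) (L.map x).prod := Commute.list_prod_right _ _ <|
      List.forall_mem_map.2 fun j hj => (hc j i fun e => hi (e ▸ hj)).symm
    simp only [List.map_cons, List.prod_cons]
    calc y * (a i * (L.map a).prod) * (x i * (L.map x).prod)
        = y * a i * ((L.map a).prod * x i) * (L.map x).prod := by simp only [mul_assoc]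
      _ = y * a i * x i * ((L.map a).prod * (L.map x).prod) := by
          rw [← commute_x.eq]
          simp only [mul_assoc]
      _ = x i * a i * (y * (L.map a).prod * (L.map x).prod) := by
          rw [h]
          simp only [mul_assoc]
      _ = x i * (a i * (L.map x).prod) * (L.map a).prod * y := by
          rw [ih hL]
          simp only [mul_assoc]
      _ = x i * (L.map x).prod * (a i * (L.map a).prod) * y := by
          rw [commute_a.eq]
          simp only [mul_assoc]

/-- All entries of the matrix are central. -/
def CentralEntries {ι κ A : Type*} [Semiring A] (M : Matrix ι κ A) : Prop :=
  ∀ (a : A) i j, Commute a (M i j)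

namespace CentralEntries

variable {ι A : Type*} [Semiring A]

theorem mul [Fintype ι] {M M' : Matrix ι ι A} (h : CentralEntries M) (h' : CentralEntries M') :
    CentralEntries (M * M') := by
  intro a i j
  rw [Matrix.mul_apply]
  exact Commute.sum_right _ _ _ fun k _ => (h a _ _).mul_right (h' a _ _)

theorem one [DecidableEq ι] : CentralEntries (1 : Matrix ι ι A) := by
  intro a i j
  rw [Matrix.one_apply]
  split_ifs
  exacts [Commute.one_right _, Commute.zero_right _]

theorem list_prod [Fintype ι] [DecidableEq ι] {L : List (Matrix ι ι A)}
    (h : ∀ M ∈ L, CentralEntries M) : CentralEntries L.prod := by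
  induction L with
  | nil => exact one
  | cons M L ih =>
    rw [List.prod_cons]
    exact (h M (by simp)).mul (ih fun M' hM' => h M' (by simp [hM']))

variable {N r : ℕ}

theorem liftCons {M : Matrix (Fin r → Fin N) (Fin r → Fin N) A} (h : CentralEntries M) :
    CentralEntries (liftCons M) := by
  intro a i j
  simp only [TwistedQYangian.liftCons, of_apply]
  split_ifs
  exacts [h _ _ _, Commute.zero_right _]

theorem twoSite {M : Matrix (Fin N × Fin N) (Fin N × Fin N) A} (h : CentralEntries M)
    (k l : Fin r) : CentralEntries (twoSite M k l) := by
  intro a i j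
  simp only [TwistedQYangian.twoSite, of_apply]
  split_ifs
  exacts [h _ _ _, Commute.zero_right _]

end CentralEntries

section ProdSites

variable {N : ℕ} {A : Type*} [Semiring A] (Z : ℕ → Matrix (Fin N) (Fin N) A) (r s : ℕ)

/-- The product in which `Z_{s+k}` acts in the `k`-th tensor factor, for `k = 0, …, r - 1`. -/
def prodSites : Matrix (Fin r → Fin N) (Fin r → Fin N) A :=
  ((List.finRange r).map fun k : Fin r => oneSite (Z (s + k)) k).prod

theorem liftCons_prodSites :
    liftCons (prodSites Z r (s + 1)) =
      ((List.finRange r).map fun k : Fin r => oneSite (Z (s + 1 + k)) k.succ).prod := by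
  rw [prodSites, liftCons_prod, List.map_map]
  congr 1
  exact List.map_congr_left fun k _ => liftCons_oneSite _ _

theorem prodSites_succ :
    prodSites Z (r + 1) s = oneSite (Z s) 0 * liftCons (prodSites Z r (s + 1)) := by
  rw [liftCons_prodSites, prodSites, List.finRange_succ, List.map_cons, List.prod_cons,
    List.map_map]
  congr 2
  refine List.map_congr_left fun k _ => ?_
  simp [add_comm, add_left_comm]

end ProdSites

theorem oneSite_mul_oneSite {N r : ℕ} {A : Type*} [Semiring A] (X Y : Matrix (Fin N) (Fin N) A)
    {k l : Fin r} (hkl : k ≠ l) :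
    oneSite X k * oneSite Y l = twoSite ((X ⊗ₖ 1) * (1 ⊗ₖ Y)) k l := by
  rw [twoSite_mul _ _ hkl, twoSite_kronecker_one _ hkl, twoSite_one_kronecker _ hkl]

theorem twoSite_one_sub {N r : ℕ} {A : Type*} [Ring A]
    (M : Matrix (Fin N × Fin N) (Fin N × Fin N) A) {k l : Fin r} (hkl : k ≠ l) :
    twoSite (1 - M) k l = 1 - twoSite M k l := by
  rw [← twoSite_one hkl]
  ext a b
  simp only [twoSite, of_apply, Matrix.sub_apply]
  split_ifs <;> simp

theorem QAntisymm.vecMul_prodSites {N : ℕ} {K A : Type*} [Field K] [Ring A] [Algebra K A] {q : K}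
    [NeZero (2 : K)] (hq : q ≠ 0) {Z : ℕ → Matrix (Fin N) (Fin N) A}
    (hZ : ∀ k, (1 - base A (permMat N q)) * (Z k ⊗ₖ 1) * (1 ⊗ₖ Z (k + 1)) =
      (1 ⊗ₖ Z (k + 1)) * (Z k ⊗ₖ 1) * (1 - base A (permMat N q)))
    {r : ℕ} (s : ℕ) {f : (Fin r → Fin N) → A} (hf : QAntisymm q f) :
    QAntisymm q (f ᵥ* prodSites Z r s) := by
  intro k
  have hk := k.left_ne_right
  refine QAntisymmAt.vecMul_finRange_prod hk k _ (fun l hl hr => ?_) (fun g hg => ?_) (hf k)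
  · exact commute_oneSite_twoSite hk hl hr fun a b c e => base_commute _ _ _ _
  · have intertwine : (1 - twoSite (base A (permMat N q)) k.left k.right) *
        (oneSite (Z (s + k.1)) k.left * oneSite (Z (s + k.1 + 1)) k.right) =
        twoSite ((1 ⊗ₖ Z (s + k.1 + 1)) * (Z (s + k.1) ⊗ₖ 1)) k.left k.right *
          (1 - twoSite (base A (permMat N q)) k.left k.right) := by
      rw [oneSite_mul_oneSite _ _ hk, ← twoSite_one_sub _ hk, ← twoSite_mul _ _ hk,
        ← twoSite_mul _ _ hk, ← mul_assoc, hZ]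
    exact hg.vecMul_of_intertwine hk hq intertwine

namespace RTTData

variable {N : ℕ} {K A : Type*} [Field K] [Ring A] [Algebra K A] {q : K} (d : RTTData N q A)

/-- The product `R^t_{12} ⋯ R^t_{1,r+1}`. -/
def head (r s : ℕ) : Matrix (Fin (r + 1) → Fin N) (Fin (r + 1) → Fin N) A :=
  ((List.finRange r).map fun l : Fin r =>
    twoSite (base A (rtMat N q (d.x s) (d.y (s + 1 + l)))) 0 l.succ).prod

/-- The product `S_1 R^t_{12} ⋯ R^t_{1r} S_2 R^t_{23} ⋯ R^t_{r-1,r} S_r`. -/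
def skl : (r s : ℕ) → Matrix (Fin r → Fin N) (Fin r → Fin N) A
  | 0, _ => 1
  | r + 1, s => oneSite (d.S s) 0 * d.head r s * liftCons (skl r (s + 1))

/-- The product `(R^t_{12} ⋯ R^t_{1r}) (R^t_{23} ⋯ R^t_{2r}) ⋯ R^t_{r-1,r}`. -/
def allR : (r s : ℕ) → Matrix (Fin r → Fin N) (Fin r → Fin N) A
  | 0, _ => 1
  | r + 1, s => d.head r s * liftCons (allR r (s + 1))

/-- The product `S_1 R^t_{12} ⋯ R^t_{1,r+1} S_2 R^t_{23} ⋯ S_r R^t_{r,r+1}` on `r + 1` tensor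
factors, which lacks the last factor `S_{r+1}` of `skl (r + 1)`. -/
def sklInit : (r s : ℕ) → Matrix (Fin (r + 1) → Fin N) (Fin (r + 1) → Fin N) A
  | 0, _ => 1
  | r + 1, s => oneSite (d.S s) 0 * d.head (r + 1) s * liftCons (sklInit r (s + 1))

theorem centralEntries_head (r s : ℕ) : CentralEntries (d.head r s) :=
  CentralEntries.list_prod <| List.forall_mem_map.2 fun _ _ =>
    CentralEntries.twoSite (fun _ _ _ => base_commute _ _ _ _) _ _

theorem centralEntries_allR (r s : ℕ) : CentralEntries (d.allR r s) := by
  induction r generalizing s with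
  | zero => exact CentralEntries.one
  | succ r ih => exact (d.centralEntries_head r s).mul (ih (s + 1)).liftCons

theorem head_exchange (r s : ℕ) :
    oneSite (d.Y s) 0 * d.head r s * liftCons (prodSites d.X r (s + 1)) =
      liftCons (prodSites d.X r (s + 1)) * d.head r s * oneSite (d.Y s) 0 := by
  rw [liftCons_prodSites, head]
  refine mul_prod_mul_prod _ _ _ _ (List.nodup_finRange r) (fun i j hij => ?_) fun i => ?_
  · exact commute_oneSite_twoSite (Fin.succ_ne_zero j).symm (Fin.succ_ne_zero i)
      (by simpa using hij) fun a b c e => base_commute _ _ _ _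
  · have h0 : (0 : Fin (r + 1)) ≠ i.succ := (Fin.succ_ne_zero i).symm
    rw [← twoSite_kronecker_one (d.Y s) h0, ← twoSite_one_kronecker (d.X _) h0,
      ← twoSite_mul _ _ h0, ← twoSite_mul _ _ h0, ← twoSite_mul _ _ h0, ← twoSite_mul _ _ h0,
      d.rYX]

theorem skl_eq (r s : ℕ) :
    d.skl r s = prodSites d.X r s * d.allR r s * prodSites d.Y r s := by
  induction r generalizing s with
  | zero => simp [skl, allR, prodSites]
  | succ r ih =>
    have commute_Y : Commute (oneSite (d.Y s) 0) (liftCons (d.allR r (s + 1))) :=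
      commute_oneSite_liftCons fun a b c e => d.centralEntries_allR r (s + 1) _ _ _
    rw [skl, ih, allR, prodSites_succ, prodSites_succ, liftCons_mul, liftCons_mul, S, oneSite_mul]
    calc _ = oneSite (d.X s) 0 *
          (oneSite (d.Y s) 0 * d.head r s * liftCons (prodSites d.X r (s + 1))) *
          liftCons (d.allR r (s + 1)) * liftCons (prodSites d.Y r (s + 1)) := by
          simp only [mul_assoc]
      _ = oneSite (d.X s) 0 * liftCons (prodSites d.X r (s + 1)) * d.head r s *
          (oneSite (d.Y s) 0 * liftCons (d.allR r (s + 1))) *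
          liftCons (prodSites d.Y r (s + 1)) := by
          rw [head_exchange]
          simp only [mul_assoc]
      _ = _ := by
          rw [commute_Y.eq]
          simp only [mul_assoc]

theorem skl_succ (r s : ℕ) :
    d.skl (r + 1) s = d.sklInit r s * oneSite (d.S (s + r)) (Fin.last r) := by
  induction r generalizing s with
  | zero => simp [skl, sklInit, head, liftCons_one]
  | succ r ih =>
    rw [skl, ih, sklInit, liftCons_mul, liftCons_oneSite, Fin.succ_last, mul_assoc, mul_assoc,
      mul_assoc, add_right_comm s 1 r]
    rfl

variable [NeZero (2 : K)]

theorem vecMul_head_of_qAntisymm (hq : q ≠ 0) (r s : ℕ) {f : (Fin (r + 1) → Fin N) → A}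
    (hf : QAntisymm q f) : f ᵥ* d.head r s = (∏ l : Fin r, (d.x s - d.y (s + 1 + l))) • f := by
  rw [head, ← List.prod_ofFn, List.ofFn_eq_map]
  induction List.finRange r with
  | nil => simp
  | cons l L ih =>
    simp only [List.map_cons, List.prod_cons]
    rw [← vecMul_vecMul, hf.vecMul_rtMat hq _ _ (Fin.succ_ne_zero l).symm, smul_vecMul, ih,
      smul_smul]

theorem exists_vecMul_allR_eq_smul (hq : q ≠ 0) (r s : ℕ) :
    ∃ c : K, ∀ f : (Fin r → Fin N) → A, QAntisymm q f → f ᵥ* d.allR r s = c • f := by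
  induction r generalizing s with
  | zero => exact ⟨1, fun f _ => by simp [allR]⟩
  | succ r ih =>
    obtain ⟨c, hc⟩ := ih (s + 1)
    refine ⟨(∏ l : Fin r, (d.x s - d.y (s + 1 + l))) * c, fun f hf => ?_⟩
    rw [allR, ← vecMul_vecMul, d.vecMul_head_of_qAntisymm hq r s hf, smul_vecMul, mul_smul]
    congr 1
    ext b
    rw [← Fin.cons_self_tail b, vecMul_liftCons, hc _ (hf.cons _)]
    rfl

theorem qAntisymm_vecMul_skl (hq : q ≠ 0) (r s : ℕ) {f : (Fin r → Fin N) → A}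
    (hf : QAntisymm q f) : QAntisymm q (f ᵥ* d.skl r s) := by
  obtain ⟨c, hc⟩ := d.exists_vecMul_allR_eq_smul hq r s
  have after_X : QAntisymm q (f ᵥ* prodSites d.X r s) := hf.vecMul_prodSites hq d.rXX s
  rw [skl_eq, ← vecMul_vecMul, ← vecMul_vecMul, hc _ after_X]
  exact (after_X.smul c).vecMul_prodSites hq d.rYY s

theorem qAntisymm_vecMul_head (hq : q ≠ 0) (r s : ℕ) {f : (Fin (r + 1) → Fin N) → A}
    (hf : ∀ c, QAntisymm q fun a => f (Fin.cons c a)) (c : Fin N) :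
    QAntisymm q fun a => (f ᵥ* d.head r s) (Fin.cons c a) := by
  intro k
  have hk : k.left.succ ≠ k.right.succ := by simpa using k.left_ne_right
  refine QAntisymmAt.cons_iff.1 ?_ c
  refine QAntisymmAt.vecMul_finRange_prod hk k _ (fun l hl hr => ?_) (fun g hg => ?_)
    (QAntisymmAt.cons_iff.2 fun c => hf c k)
  · exact commute_twoSite_twoSite (Fin.succ_ne_zero _).symm hk (Fin.succ_ne_zero _).symm
      (Fin.succ_ne_zero _).symm (by simpa using hl) (by simpa using hr)
      fun a b c e => base_commute _ _ _ _
  · have y_right : d.y (s + 1 + k.right) = q⁻¹ ^ 2 * d.y (s + 1 + k.left) := d.y_succ (s + 1 + k.1)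
    rw [y_right]
    exact hg.vecMul_rtMat_mul_rtMat hq _ _ (Fin.succ_ne_zero _).symm (Fin.succ_ne_zero _).symm hk

theorem qAntisymm_vecMul_sklInit (hq : q ≠ 0) (r s : ℕ) {f : (Fin (r + 1) → Fin N) → A}
    (hf : QAntisymm q f) (c : Fin N) :
    QAntisymm q fun b => (f ᵥ* d.sklInit r s) (Fin.snoc b c) := by
  intro k b
  set g := f ᵥ* d.sklInit r s
  let deviation : Fin N → A := fun c => g (Fin.snoc b c) +
    pq q (b k.right) (b k.left) • g (Fin.snoc (b ∘ Equiv.swap k.left k.right) c)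
  have deviation_vecMul_S : deviation ᵥ* d.S (s + r) = 0 := by
    ext e
    have antisymm := (d.qAntisymm_vecMul_skl hq (r + 1) s hf).snoc e k b
    simp only [skl_succ, ← vecMul_vecMul, vecMul_oneSite_last] at antisymm
    simp only [vecMul, dotProduct, deviation, add_mul, Finset.sum_add_distrib, smul_mul_assoc,
      ← Finset.smul_sum]
    exact eq_neg_iff_add_eq_zero.1 antisymm
  exact eq_neg_of_add_eq_zero_left (congrFun (d.cancelS _ deviation deviation_vecMul_S) c)

end RTTData

/-! ### Evaluation of the ordered products -/

section ScalarRows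

variable {N r : ℕ} {K A : Type*} [Field K] [Ring A] [Algebra K A] {q : K}

theorem QAntisymm.apply_cons_cons {f : (Fin (r + 2) → Fin N) → A} (hf : QAntisymm q f)
    (c d : Fin N) (a : Fin r → Fin N) :
    f (Fin.cons c (Fin.cons d a)) = -(pq q d c • f (Fin.cons d (Fin.cons c a))) := by
  have comp_swap : (Fin.cons c (Fin.cons d a) : Fin (r + 2) → Fin N) ∘ Equiv.swap 0 (Fin.succ 0) =
      Fin.cons d (Fin.cons c a) := by
    rw [Equiv.comp_swap_eq_update, ← Fin.cons_update, Fin.update_cons_zero, Fin.update_cons_zero]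
    rfl
  have antisymm := hf ⟨0, by omega⟩ (Fin.cons c (Fin.cons d a))
  change _ = -(pq q d c • f (_ ∘ Equiv.swap 0 (Fin.succ 0))) at antisymm
  rwa [comp_swap] at antisymm

/-- A scalar row vector, with coefficients in the algebra `A`. -/
abbrev toAlg (A : Type*) [Ring A] [Algebra K A] {ι : Type*} (f : ι → K) : ι → A :=
  fun b => algebraMap K A (f b)

theorem QAntisymm.toAlg {f : (Fin r → Fin N) → K} (hf : QAntisymm q f) :
    QAntisymm q (toAlg A f) := by
  intro k b
  simp only [TwistedQYangian.toAlg]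
  rw [hf k b, map_neg, smul_eq_mul, map_mul, Algebra.smul_def]

theorem QAntisymm.sum_cons_smul {f : (Fin (r + 1) → Fin N) → K} (hf : QAntisymm q f)
    (Z : Fin N → A) : QAntisymm q fun a => ∑ e, f (Fin.cons e a) • Z e := by
  intro k b
  simp only [Finset.smul_sum, ← Finset.sum_neg_distrib]
  refine Finset.sum_congr rfl fun e _ => ?_
  have antisymm : f (Fin.cons e b) = _ := hf.cons e k b
  rw [antisymm, neg_smul, smul_eq_mul, mul_smul]

end ScalarRows

namespace RTTData

variable {N : ℕ} {K A : Type*} [Field K] [Ring A] [Algebra K A] {q : K} (d : RTTData N q A)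

theorem vecMul_list_rtMat {r : ℕ} (x : K) (y : Fin r → K) (L : List (Fin r))
    (g : (Fin (r + 1) → Fin N) → A) {b : Fin (r + 1) → Fin N} (h : ∀ l ∈ L, b 0 ≠ b l.succ) :
    (g ᵥ* (L.map fun l => twoSite (base A (rtMat N q x (y l))) 0 l.succ).prod) b =
      (L.map fun l => x - y l).prod • g b := by
  induction L generalizing g with
  | nil => simp
  | cons l L ih =>
    simp only [List.map_cons, List.prod_cons]
    rw [← vecMul_vecMul, ih _ (fun m hm => h m (by simp [hm])),
      vecMul_rtMat _ _ _ (Fin.succ_ne_zero l).symm, if_neg (h l (by simp)), smul_smul, mul_comm]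

theorem vecMul_head_of_ne (r s : ℕ) (g : (Fin (r + 1) → Fin N) → A) {c : Fin N}
    {a : Fin r → Fin N} (h : ∀ l, c ≠ a l) :
    (g ᵥ* d.head r s) (Fin.cons c a) =
      (∏ l : Fin r, (d.x s - d.y (s + 1 + l))) • g (Fin.cons c a) := by
  rw [head, vecMul_list_rtMat _ (fun l : Fin r => d.y (s + 1 + l)) _ _ (by simpa using h),
    ← List.prod_ofFn, List.ofFn_eq_map]

theorem vecMul_head_cons_self (r s : ℕ) (g : (Fin (r + 2) → Fin N) → A) {c : Fin N}
    {a : Fin r → Fin N} (h : ∀ l, c ≠ a l) :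
    (g ᵥ* d.head (r + 1) s) (Fin.cons c (Fin.cons c a)) =
      (∏ l : Fin r, (d.x s - d.y (s + 1 + l.succ))) •
        ∑ e, rho q (d.x s) (d.y (s + 1)) e c • g (Fin.cons e (Fin.cons e a)) := by
  have head_eq : d.head (r + 1) s = twoSite (base A (rtMat N q (d.x s) (d.y (s + 1)))) 0 1 *
      (((List.finRange r).map Fin.succ).map fun l : Fin (r + 1) =>
        twoSite (base A (rtMat N q (d.x s) (d.y (s + 1 + l)))) 0 l.succ).prod := by
    rw [head, List.finRange_succ, List.map_cons, List.prod_cons]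
    rfl
  have ne_of_mem : ∀ l ∈ (List.finRange r).map Fin.succ,
      (Fin.cons c (Fin.cons c a) : Fin (r + 2) → Fin N) 0 ≠
        (Fin.cons c (Fin.cons c a) : Fin (r + 2) → Fin N) l.succ :=
    List.forall_mem_map.2 fun m _ => by simpa using h m
  rw [head_eq, ← vecMul_vecMul,
    vecMul_list_rtMat _ (fun l : Fin (r + 1) => d.y (s + 1 + l)) _ _ ne_of_mem,
    vecMul_rtMat _ _ _ (by simp), ← List.prod_ofFn, List.ofFn_eq_map, List.map_map]
  congr 1
  refine (if_pos rfl).trans (Finset.sum_congr rfl fun t _ => ?_)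
  congr 2
  rw [Fin.update_cons_zero, ← Fin.succ_zero_eq_one, ← Fin.cons_update, Fin.update_cons_zero]

theorem head_succ (r s : ℕ) : d.head (r + 1) s = liftSnoc (d.head r s) *
    twoSite (base A (rtMat N q (d.x s) (d.y (s + 1 + r)))) 0 (Fin.last (r + 1)) := by
  rw [head, List.finRange_succ_last, List.map_append, List.prod_append, head, liftSnoc_prod,
    List.map_map, List.map_map]
  congr 1
  · congr 1
    refine List.map_congr_left fun l _ => ?_
    rw [Function.comp_apply, Function.comp_apply, liftSnoc_twoSite]
    rfl
  · simp

theorem vecMul_S_head_snoc (r s : ℕ) (g : (Fin (r + 2) → Fin N) → A) {c k : Fin N} (hck : c ≠ k)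
    (a : Fin r → Fin N) :
    (g ᵥ* (oneSite (d.S s) 0 * d.head (r + 1) s)) (Fin.cons c (Fin.snoc a k)) =
      (d.x s - d.y (s + 1 + r)) •
        ((fun a => g (Fin.snoc a k)) ᵥ* (oneSite (d.S s) 0 * d.head r s)) (Fin.cons c a) := by
  have first_ne_last : (Fin.snoc (Fin.cons c a) k : Fin (r + 2) → Fin N) 0 ≠
      (Fin.snoc (Fin.cons c a) k : Fin (r + 2) → Fin N) (Fin.last (r + 1)) := by
    rw [← Fin.castSucc_zero, Fin.snoc_castSucc, Fin.snoc_last]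
    simpa using hck
  have oneSite_eq : oneSite (d.S s) 0 = liftSnoc (oneSite (d.S s) (0 : Fin (r + 1))) := by
    rw [liftSnoc_oneSite]
    rfl
  rw [head_succ, ← mul_assoc, ← vecMul_vecMul, vecMul_rtMat _ _ _ (Fin.last_pos).ne,
    Fin.cons_snoc_eq_snoc_cons, if_neg first_ne_last, oneSite_eq, ← liftSnoc_mul, vecMul_liftSnoc]

theorem vecMul_sklInit_of_ne (r s : ℕ) (g : (Fin (r + 1) → Fin N) → A) {k : Fin N}
    {b : Fin r → Fin N} (h : ∀ l, b l ≠ k) :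
    (g ᵥ* d.sklInit r s) (Fin.snoc b k) =
      (∏ i : Fin r, (d.x (s + i) - d.y (s + r))) •
        ((fun a => g (Fin.snoc a k)) ᵥ* d.skl r s) b := by
  induction r generalizing s with
  | zero => simp [sklInit, skl]
  | succ r ih =>
    have first_factor : (fun a => (g ᵥ* (oneSite (d.S s) 0 * d.head (r + 1) s))
        (Fin.cons (b 0) (Fin.snoc a k))) = (d.x s - d.y (s + 1 + r)) • fun a =>
          ((fun a => g (Fin.snoc a k)) ᵥ* (oneSite (d.S s) 0 * d.head r s)) (Fin.cons (b 0) a) :=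
      funext (d.vecMul_S_head_snoc r s g (h 0))
    rw [← Fin.cons_self_tail b, ← Fin.cons_snoc_eq_snoc_cons, sklInit, ← vecMul_vecMul,
      vecMul_liftCons, ih (b := Fin.tail b) _ _ (fun l => h l.succ), skl,
      ← vecMul_vecMul _ _ (liftCons (d.skl r (s + 1))), vecMul_liftCons, first_factor, smul_vecMul,
      Pi.smul_apply, smul_smul, Fin.prod_univ_succ, mul_comm]
    simp [add_comm, add_left_comm]

theorem vecMul_oneSite_toAlg {r s : ℕ} (f : (Fin (r + 1) → Fin N) → K) (c : Fin N)
    (a : Fin r → Fin N) : (toAlg A f ᵥ* oneSite (d.S s) 0) (Fin.cons c a) =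
      ∑ e, f (Fin.cons e a) • d.S s e c := by
  simp [vecMul_oneSite_zero, toAlg, Algebra.smul_def]

theorem vecMul_S_head_of_ne {r : ℕ} (s : ℕ) {f : (Fin (r + 1) → Fin N) → K} {c : Fin N}
    (hc : ∀ b, f b ≠ 0 → c ∈ Set.range b) {a : Fin r → Fin N} (ha : c ∉ Set.range a) :
    (toAlg A f ᵥ* (oneSite (d.S s) 0 * d.head r s)) (Fin.cons c a) =
      (∏ l : Fin r, (d.x s - d.y (s + 1 + l))) • ∑ e, f (Fin.cons e a) • d.SbarT s e c := by
  rw [← vecMul_vecMul, d.vecMul_head_of_ne r s _ fun l h => ha ⟨l, h.symm⟩, vecMul_oneSite_toAlg]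
  congr 1
  refine Finset.sum_congr rfl fun e _ => ?_
  by_cases h : f (Fin.cons e a) = 0
  · simp [h]
  · have c_mem := hc _ h
    rw [Fin.range_cons] at c_mem
    rw [c_mem.resolve_right ha, d.SbarT_apply_self]

theorem rho_smul_sum_smul_S {r : ℕ} (s : ℕ) {f : (Fin (r + 2) → Fin N) → K}
    (hf : QAntisymm q f) {c : Fin N} (hc : ∀ b, f b ≠ 0 → c ∈ Set.range b) {a : Fin r → Fin N}
    (ha : c ∉ Set.range a) {t : Fin N} (htc : t ≠ c) :
    rho q (d.x s) (d.y (s + 1)) t c • ∑ e, f (Fin.cons e (Fin.cons t a)) • d.S s e t =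
      -(f (Fin.cons t (Fin.cons c a)) •
        (pq q t c * rho q (d.x s) (d.y (s + 1)) t c) • d.S s c t) := by
  have only_first : ∀ e, e ≠ c → f (Fin.cons e (Fin.cons t a)) = 0 := by
    intro e hec
    by_contra hne
    have := hc _ hne
    rw [Fin.range_cons, Fin.range_cons] at this
    simp_all [eq_comm]
  rw [Finset.sum_eq_single c (fun e _ hec => by rw [only_first e hec, zero_smul]) (by simp),
    hf.apply_cons_cons, smul_smul, smul_smul, smul_eq_mul, ← neg_smul]
  congr 1
  ring

section ContainsValue

variable [NeZero (2 : K)]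

theorem sum_rho_smul (hq : q ≠ 0) {r : ℕ} (s : ℕ) {f : (Fin (r + 2) → Fin N) → K}
    (hf : QAntisymm q f) {c : Fin N} (hc : ∀ b, f b ≠ 0 → c ∈ Set.range b) {a : Fin r → Fin N}
    (ha : c ∉ Set.range a) :
    ∑ t, rho q (d.x s) (d.y (s + 1)) t c •
        ∑ e, f (Fin.cons e (Fin.cons t a)) • d.S s e t =
      (d.x s - d.y (s + 1)) • ∑ e, f (Fin.cons e (Fin.cons c a)) • d.SbarT s e c := by
  have apply_repeat : f (Fin.cons c (Fin.cons c a)) = 0 :=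
    hf.apply_eq_zero hq (i := 0) (j := Fin.succ 0) (Fin.succ_ne_zero 0).symm (by simp)
  have summand : ∀ t, rho q (d.x s) (d.y (s + 1)) t c •
        ∑ e, f (Fin.cons e (Fin.cons t a)) • d.S s e t =
      (if t = c then rho q (d.x s) (d.y (s + 1)) c c •
        ∑ e, f (Fin.cons e (Fin.cons c a)) • d.S s e c else 0) -
      f (Fin.cons t (Fin.cons c a)) •
        (pq q t c * rho q (d.x s) (d.y (s + 1)) t c) • d.S s c t := by
    intro t
    rcases eq_or_ne t c with rfl | htc
    · simp [apply_repeat]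
    · rw [if_neg htc, zero_sub, d.rho_smul_sum_smul_S s hf hc ha htc]
  rw [Finset.sum_congr rfl fun t _ => summand t, Finset.sum_sub_distrib, Finset.sum_ite_eq',
    if_pos (Finset.mem_univ _), Finset.smul_sum, Finset.smul_sum, ← Finset.sum_sub_distrib]
  refine Finset.sum_congr rfl fun e _ => ?_
  rcases eq_or_ne e c with rfl | hec
  · simp [apply_repeat]
  · rw [smul_comm, ← smul_sub, d.rho_smul_S_sub_smul_S hq s hec, smul_comm]

theorem vecMul_S_head_cons_self (hq : q ≠ 0) {r : ℕ} (s : ℕ) {f : (Fin (r + 2) → Fin N) → K}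
    (hf : QAntisymm q f) {c : Fin N} (hc : ∀ b, f b ≠ 0 → c ∈ Set.range b) {a : Fin r → Fin N}
    (ha : c ∉ Set.range a) :
    (toAlg A f ᵥ* (oneSite (d.S s) 0 * d.head (r + 1) s)) (Fin.cons c (Fin.cons c a)) =
      (∏ l : Fin (r + 1), (d.x s - d.y (s + 1 + l))) •
        ∑ e, f (Fin.cons e (Fin.cons c a)) • d.SbarT s e c := by
  rw [← vecMul_vecMul, d.vecMul_head_cons_self r s _ fun l h => ha ⟨l, h.symm⟩]
  simp only [vecMul_oneSite_toAlg]
  rw [d.sum_rho_smul hq s hf hc ha, smul_smul, Fin.prod_univ_succ, mul_comm]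
  simp

theorem vecMul_S_head (hq : q ≠ 0) {r : ℕ} (s : ℕ) {f : (Fin (r + 1) → Fin N) → K}
    (hf : QAntisymm q f) {c : Fin N} (hc : ∀ b, f b ≠ 0 → c ∈ Set.range b) (a : Fin r → Fin N) :
    (toAlg A f ᵥ* (oneSite (d.S s) 0 * d.head r s)) (Fin.cons c a) =
      (∏ l : Fin r, (d.x s - d.y (s + 1 + l))) • ∑ e, f (Fin.cons e a) • d.SbarT s e c := by
  have antisymm_lhs : QAntisymm q fun a =>
      (toAlg A f ᵥ* (oneSite (d.S s) 0 * d.head r s)) (Fin.cons c a) := by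
    rw [← vecMul_vecMul]
    refine d.qAntisymm_vecMul_head hq r s (fun c => ?_) c
    simpa only [vecMul_oneSite_toAlg] using hf.sum_cons_smul _
  have antisymm_rhs : QAntisymm q fun a => (∏ l : Fin r, (d.x s - d.y (s + 1 + l))) •
      ∑ e, f (Fin.cons e a) • d.SbarT s e c := (hf.sum_cons_smul _).smul _
  by_cases hinj : Injective a
  swap
  · rw [antisymm_lhs.apply_eq_zero_of_not_injective hq hinj,
      antisymm_rhs.apply_eq_zero_of_not_injective hq hinj]
  by_cases hca : c ∈ Set.range a
  · obtain ⟨i, hi⟩ := hca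
    rcases r with _ | r
    · exact i.elim0
    -- By antisymmetry in `a`, the entry `c` may be moved to the first position.
    refine antisymm_lhs.apply_eq_apply hq antisymm_rhs (Equiv.swap 0 i) ?_
    have hinj' : Injective (a ∘ Equiv.swap 0 i) := hinj.comp (Equiv.injective _)
    have first_eq : (a ∘ Equiv.swap 0 i) 0 = c := by simp [hi]
    generalize a ∘ Equiv.swap 0 i = b at hinj' first_eq
    rw [← Fin.cons_self_tail b, first_eq] at hinj' ⊢
    exact d.vecMul_S_head_cons_self hq s hf hc (Fin.cons_injective_iff.1 hinj').1
  · exact d.vecMul_S_head_of_ne s hc hca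

theorem vecMul_sklInit_snoc_cons (hq : q ≠ 0) {r : ℕ} (s : ℕ) {f : (Fin (r + 2) → Fin N) → K}
    (hf : QAntisymm q f) {c k : Fin N} (hc : ∀ b, f b ≠ 0 → c ∈ Set.range b) {b : Fin r → Fin N}
    (hb : ∀ l, b l ≠ k) :
    (toAlg A f ᵥ* d.sklInit (r + 1) s) (Fin.snoc (Fin.cons c b) k) =
      ((∏ l : Fin (r + 1), (d.x s - d.y (s + 1 + l))) *
        ∏ i : Fin r, (d.x (s + 1 + i) - d.y (s + 1 + r))) •
      ∑ e, d.SbarT s e c *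
        (toAlg A (fun a => f (Fin.cons e (Fin.snoc a k))) ᵥ* d.skl r (s + 1)) b := by
  have first_factor : (fun a => (toAlg A f ᵥ* (oneSite (d.S s) 0 * d.head (r + 1) s))
      (Fin.cons c (Fin.snoc a k))) = (∏ l : Fin (r + 1), (d.x s - d.y (s + 1 + l))) • fun a =>
        ∑ e, f (Fin.cons e (Fin.snoc a k)) • d.SbarT s e c :=
    funext fun a => d.vecMul_S_head hq s hf hc _
  rw [← Fin.cons_snoc_eq_snoc_cons, sklInit, ← vecMul_vecMul, vecMul_liftCons,
    d.vecMul_sklInit_of_ne _ _ _ hb, first_factor, smul_vecMul, Pi.smul_apply, smul_smul, mul_comm]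
  congr 1
  simp only [vecMul, dotProduct, toAlg, Finset.sum_mul, Finset.mul_sum]
  rw [Finset.sum_comm]
  refine Finset.sum_congr rfl fun t _ => Finset.sum_congr rfl fun a _ => ?_
  rw [Algebra.smul_def, ← mul_assoc, Algebra.commutes]

end ContainsValue

end RTTData

/-! ### The map `π` on sequences -/

section PiFun

variable {α : Type*} {r : ℕ} {I : Finset α}

/-- The sequence `b` lists the elements of `I`, each exactly once. -/
structure Enumerates (b : Fin r → α) (I : Finset α) : Prop where
  injective : Injective b
  range_eq : Set.range b = I

theorem Enumerates.mem_range {b : Fin r → α} (hb : Enumerates b I) {c : α} (hc : c ∈ I) :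
    c ∈ Set.range b := by
  rwa [hb.range_eq]

theorem Enumerates.apply_mem {b : Fin r → α} (hb : Enumerates b I) (i : Fin r) : b i ∈ I := by
  rw [← Finset.mem_coe, ← hb.range_eq]
  exact Set.mem_range_self i

variable [LinearOrder α]

theorem enumerates_cons {b : Fin r → α} {c : α} :
    Enumerates (Fin.cons c b) I ↔ c ∈ I ∧ Enumerates b (I.erase c) := by
  constructor
  · rintro ⟨hinj, hI⟩
    rw [Fin.cons_injective_iff] at hinj
    rw [Fin.range_cons] at hI
    exact ⟨by simp [← Finset.mem_coe, ← hI], hinj.2,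
      by rw [Finset.coe_erase, ← hI, Set.insert_sdiff_self_of_notMem hinj.1]⟩
  · rintro ⟨hc, hinj, hI⟩
    exact ⟨Fin.cons_injective_iff.2 ⟨by simp [hI], hinj⟩,
      by rw [Fin.range_cons, hI, ← Finset.coe_insert, Finset.insert_erase hc]⟩

theorem enumerates_snoc {b : Fin r → α} {c : α} :
    Enumerates (Fin.snoc b c : Fin (r + 1) → α) I ↔ c ∈ I ∧ Enumerates b (I.erase c) := by
  rw [← enumerates_cons]
  constructor <;> rintro ⟨hinj, hI⟩
  · rw [Fin.snoc_injective_iff] at hinj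
    exact ⟨Fin.cons_injective_iff.2 hinj.symm, by rw [Fin.range_cons, ← hI, Fin.range_snoc]⟩
  · rw [Fin.cons_injective_iff] at hinj
    exact ⟨Fin.snoc_injective_iff.2 hinj.symm, by rw [Fin.range_snoc, ← hI, Fin.range_cons]⟩

namespace Enumerates

theorem of_card_eq (h : I.card = r) : Enumerates (I.orderEmbOfFin h) I :=
  ⟨(I.orderEmbOfFin h).injective, I.range_orderEmbOfFin h⟩

variable {b : Fin r → α}

theorem image_eq (hb : Enumerates b I) : Finset.univ.image b = I := by
  rw [← Finset.coe_inj, Finset.coe_image, Finset.coe_univ, Set.image_univ, hb.range_eq]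

theorem card_eq (hb : Enumerates b I) : I.card = r := by
  rw [← hb.image_eq, Finset.card_image_of_injective _ hb.injective, Finset.card_fin]

theorem sum_eq {M : Type*} [AddCommMonoid M] (hb : Enumerates b I) (g : α → M) :
    ∑ i, g (b i) = ∑ x ∈ I, g x := by
  rw [← hb.image_eq, Finset.sum_image hb.injective.injOn]

theorem invNum_cons (hb : Enumerates b I) (c : α) :
    invNum (Fin.cons c b : Fin (r + 1) → α) = invNum b + ∑ x ∈ I, if x < c then 1 else 0 := by
  rw [TwistedQYangian.invNum_cons, hb.sum_eq fun x => if x < c then 1 else 0]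

theorem invNum_snoc (hb : Enumerates b I) (c : α) :
    invNum (Fin.snoc b c : Fin (r + 1) → α) = invNum b + ∑ x ∈ I, if c < x then 1 else 0 := by
  rw [TwistedQYangian.invNum_snoc, hb.sum_eq fun x => if c < x then 1 else 0]

theorem insertionSort_ofFn (hb : Enumerates b I) :
    (List.ofFn b).insertionSort (· ≥ ·) = I.sort (· ≥ ·) := by
  refine List.Perm.eq_of_pairwise' (r := (· ≥ ·)) (List.pairwise_insertionSort _ _)
    (Finset.pairwise_sort _ _) ((List.perm_insertionSort _ _).trans ?_)
  rw [List.perm_ext_iff_of_nodup (List.nodup_ofFn.2 hb.injective) (Finset.sort_nodup _ _)]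
  intro z
  rw [List.mem_ofFn', hb.range_eq, Finset.mem_sort, Finset.mem_coe]

end Enumerates

theorem sort_eq_cons_of_isGreatest {w : α} (hw : IsGreatest (I : Set α) w) :
    I.sort (· ≥ ·) = w :: (I.erase w).sort (· ≥ ·) := by
  conv_lhs => rw [← Finset.insert_erase hw.1]
  exact Finset.sort_insert _ (fun z hz => hw.2 (Finset.mem_of_mem_erase hz))
    (Finset.notMem_erase _ _)

/-- The map `π` on sequences; it is meaningful for sequences of distinct elements. -/
def piFun (p : Fin r → α) : Fin r → α :=
  fun i => (piList (List.ofFn p)).getD i (p i)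

theorem piMap_eq_piFun {N : ℕ} (p : Equiv.Perm (Fin N)) :
    (piMap p : Fin N → Fin N) = piFun p := by
  ext i
  simp [piMap, piFun, length_piList_ofFn]

theorem ofFn_piFun {p : Fin r → α} (hp : Injective p) :
    List.ofFn (piFun p) = piList (List.ofFn p) := by
  have length_eq := (piList_perm _ _ rfl (List.nodup_ofFn.2 hp)).1.length_eq
  rw [List.length_ofFn] at length_eq
  refine List.ext_getElem (by simp [length_eq]) fun i _ hi => ?_
  simp [piFun, hi]

theorem Enumerates.enumerates_piFun {p : Fin r → α} (hp : Enumerates p I) :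
    Enumerates (piFun p) I := by
  have perm := (piList_perm _ _ rfl (List.nodup_ofFn.2 hp.injective)).1
  rw [← ofFn_piFun hp.injective] at perm
  refine ⟨List.nodup_ofFn.1 (perm.nodup_iff.2 (List.nodup_ofFn.2 hp.injective)), ?_⟩
  rw [← hp.range_eq]
  ext z
  rw [← List.mem_ofFn', perm.mem_iff, List.mem_ofFn']

theorem Enumerates.piFun_last {p : Fin (r + 1) → α} (hp : Enumerates p I) {w : α}
    (hw : IsGreatest (I : Set α) w) : piFun p (Fin.last r) = w := by
  obtain ⟨front, W, eq_append, le_W⟩ :=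
    (piList_perm _ _ rfl (List.nodup_ofFn.2 hp.injective)).2 (by simp)
  rw [← ofFn_piFun hp.injective, List.ofFn_succ', List.concat_eq_append] at eq_append
  have last_eq := List.head_eq_of_cons_eq (List.append_inj_right' eq_append rfl)
  refine le_antisymm (hw.2 (hp.enumerates_piFun.apply_mem _)) ?_
  obtain ⟨i, rfl⟩ := hp.mem_range hw.1
  rw [last_eq]
  exact le_W _ (List.mem_ofFn.2 ⟨i, rfl⟩)

theorem Enumerates.enumerates_init_piFun {p : Fin (r + 1) → α} (hp : Enumerates p I) {w : α}
    (hw : IsGreatest (I : Set α) w) :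
    Enumerates (Fin.init (piFun p)) (I.erase w) := by
  have split_last := hp.enumerates_piFun
  rw [← Fin.snoc_init_self (piFun p), hp.piFun_last hw] at split_last
  exact (enumerates_snoc.1 split_last).2

/-- The sequence `(e, a_1, …, a_r, k)`. -/
def consSnoc {β : Type*} (e : β) (a : Fin r → β) (k : β) : Fin (r + 2) → β :=
  Fin.cons e (Fin.snoc a k)

theorem sum_consSnoc {β M : Type*} [Fintype β] [AddCommMonoid M] (g : (Fin (r + 2) → β) → M) :
    ∑ p, g p = ∑ k, ∑ e, ∑ a, g (consSnoc e a k) := by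
  rw [Finset.sum_comm, ← (Fin.consEquiv fun _ => β).sum_comp, Fintype.sum_prod_type]
  refine Finset.sum_congr rfl fun e _ => ?_
  rw [← (Fin.snocEquiv fun _ => β).sum_comp, Fintype.sum_prod_type]
  rfl

theorem enumerates_consSnoc {a : Fin r → α} {e k : α} :
    Enumerates (consSnoc e a k) I ↔ e ∈ I ∧ k ∈ I.erase e ∧ Enumerates a ((I.erase e).erase k) := by
  rw [consSnoc, enumerates_cons, enumerates_snoc]

theorem ofFn_consSnoc {β : Type*} (e : β) (a : Fin r → β) (k : β) :
    List.ofFn (consSnoc e a k) = e :: (List.ofFn a ++ [k]) := by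
  rw [consSnoc, List.ofFn_cons, List.ofFn_succ']
  simp

theorem piList_cons_append_singleton (e k : α) {l : List α} (hl : l ≠ []) :
    piList (e :: (l ++ [k])) =
      piStep ((e :: (l ++ [k])).insertionSort (· ≥ ·)) e k (piList l) := by
  obtain ⟨x, l, rfl⟩ := List.exists_cons_of_ne_nil hl
  rcases l with _ | ⟨y, l⟩
  · simp [piList]
  · simp [piList, List.dropLast_cons_of_ne_nil]

theorem Enumerates.init_piFun_consSnoc {a : Fin (r + 1) → α} {e k : α}
    (hp : Enumerates (consSnoc e a k) I) {w₁ w₂ w₃ : α} (hw₁ : IsGreatest (I : Set α) w₁)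
    (hw₂ : IsGreatest (I.erase w₁ : Set α) w₂)
    (hw₃ : IsGreatest ((I.erase w₁).erase w₂ : Set α) w₃) :
    Fin.init (piFun (consSnoc e a k)) = consSnoc (pairMap w₁ w₂ w₃ (e, k)).1
      (Fin.init (piFun a)) (pairMap w₁ w₂ w₃ (e, k)).2 := by
  have ha := (enumerates_consSnoc.1 hp).2.2
  have piFun_eq : piFun (consSnoc e a k) =
      Fin.snoc (consSnoc (pairMap w₁ w₂ w₃ (e, k)).1
        (Fin.init (piFun a)) (pairMap w₁ w₂ w₃ (e, k)).2) w₁ := by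
    apply List.ofFn_injective
    have sorted := hp.insertionSort_ofFn
    rw [sort_eq_cons_of_isGreatest hw₁, sort_eq_cons_of_isGreatest hw₂,
      sort_eq_cons_of_isGreatest hw₃, ofFn_consSnoc] at sorted
    rw [ofFn_piFun hp.injective, ofFn_consSnoc, piList_cons_append_singleton _ _ (by simp), sorted,
      consSnoc, ← Fin.cons_snoc_eq_snoc_cons, ← consSnoc, ofFn_consSnoc,
      ← ofFn_piFun ha.injective, List.ofFn_succ', List.ofFn_succ']
    simp [piStep, Fin.init]
  rw [piFun_eq, Fin.init_snoc]

theorem pairMap_fst (w₁ w₂ w₃ e k : α) :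
    (pairMap w₁ w₂ w₃ (e, k)).1 = if k = w₁ then w₂ else k := by
  simp only [pairMap]
  split_ifs <;> simp_all

theorem Enumerates.exists_init_piFun_consSnoc {a : Fin (r + 1) → α} {e k : α}
    (hp : Enumerates (consSnoc e a k) I) {w w₂ : α} (hw : IsGreatest (I : Set α) w)
    (hw₂ : IsGreatest (I.erase w : Set α) w₂) :
    ∃ k', ∀ a' : Fin (r + 1) → α, Enumerates (consSnoc e a' k) I →
      Fin.init (piFun (consSnoc e a' k)) =
        consSnoc (if k = w then w₂ else k) (Fin.init (piFun a')) k' := by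
  have nonempty : ((I.erase w).erase w₂).Nonempty := by
    rw [← Finset.card_pos, Finset.card_erase_of_mem hw₂.1, Finset.card_erase_of_mem hw.1,
      hp.card_eq]
    omega
  refine ⟨(pairMap w w₂ (((I.erase w).erase w₂).max' nonempty) (e, k)).2, fun a' ha' => ?_⟩
  rw [ha'.init_piFun_consSnoc hw hw₂ (Finset.isGreatest_max' _ nonempty), pairMap_fst]

theorem Enumerates.exists_invNum_snoc_init_piFun {a₀ : Fin (r + 1) → α} {e k : α}
    (hp : Enumerates (consSnoc e a₀ k) I) {w w₂ c : α} (hw : IsGreatest (I : Set α) w)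
    (hw₂ : IsGreatest (I.erase w : Set α) w₂) (hc : c = if k = w then w₂ else k) :
    ∃ k' m, ∀ a : Fin (r + 1) → α, Enumerates (consSnoc e a k) I →
      Fin.init (piFun (consSnoc e a k)) = consSnoc c (Fin.init (piFun a)) k' ∧
      Enumerates (Fin.snoc (Fin.init (piFun a)) k' : Fin (r + 1) → α) ((I.erase w).erase c) ∧
      invNum (Fin.snoc (Fin.init (piFun a)) k' : Fin (r + 1) → α) =
        invNum (Fin.init (piFun a)) + m := by
  obtain ⟨k', init_eq⟩ := hp.exists_init_piFun_consSnoc hw hw₂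
  rw [← hc] at init_eq
  have image_enumerates : ∀ a : Fin (r + 1) → α, Enumerates (consSnoc e a k) I →
      Enumerates (Fin.snoc (Fin.init (piFun a)) k' : Fin (r + 1) → α) ((I.erase w).erase c) := by
    intro a ha
    have cons_enumerates := ha.enumerates_init_piFun hw
    rw [init_eq a ha, consSnoc, enumerates_cons] at cons_enumerates
    exact cons_enumerates.2
  exact ⟨k', _, fun a ha => ⟨init_eq a ha, image_enumerates a ha,
    (enumerates_snoc.1 (image_enumerates a ha)).2.invNum_snoc k'⟩⟩

theorem Enumerates.init_piFun_consSnoc_zero {a : Fin r → α} {e k : α}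
    (hp : Enumerates (consSnoc e a k) I) {w w₂ : α} (hw : IsGreatest (I : Set α) w)
    (hw₂ : IsGreatest (I.erase w : Set α) w₂) :
    Fin.init (piFun (consSnoc e a k)) 0 = if k = w then w₂ else k := by
  rcases r with _ | r
  · have card_le_one : (I.erase w).card ≤ 1 := by
      rw [Finset.card_erase_of_mem hw.1, hp.card_eq]
    refine Finset.card_le_one.1 card_le_one _ ((hp.enumerates_init_piFun hw).apply_mem 0) _ ?_
    split_ifs with hk
    · exact hw₂.1
    · exact Finset.mem_erase.2
        ⟨hk, Finset.mem_of_mem_erase (enumerates_consSnoc.1 hp).2.1⟩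
  · obtain ⟨k', hk'⟩ := hp.exists_init_piFun_consSnoc hw hw₂
    rw [hk' a hp, consSnoc, Fin.cons_zero]

end PiFun

namespace RTTData

variable {N : ℕ} {K A : Type*} [Field K] [Ring A] [Algebra K A] {q : K} (d : RTTData N q A)

/-- The product of `x_i - y_j` over `s ≤ i < j < s + r`. -/
def gam (r s : ℕ) : K :=
  ∏ i : Fin r, ∏ j : Fin r, if i < j then d.x (s + i) - d.y (s + j) else 1

theorem gam_succ (r s : ℕ) : d.gam (r + 1) s =
    (∏ l : Fin r, (d.x s - d.y (s + 1 + l))) * d.gam r (s + 1) := by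
  rw [gam, Fin.prod_univ_succ, Fin.prod_univ_succ]
  simp only [lt_self_iff_false, if_false, one_mul, Fin.succ_pos, if_true, gam]
  congr 1
  · simp [add_comm, add_left_comm]
  · refine Finset.prod_congr rfl fun i _ => ?_
    rw [Fin.prod_univ_succ]
    simp [add_comm, add_left_comm]

theorem gam_succ_last (r s : ℕ) : d.gam (r + 1) s =
    (∏ i : Fin r, (d.x (s + i) - d.y (s + r))) * d.gam r s := by
  have last_row : (∏ j : Fin (r + 1), if Fin.last r < j then
      d.x (s + Fin.last r) - d.y (s + j) else 1) = 1 :=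
    Finset.prod_eq_one fun j _ => if_neg (Fin.le_last j).not_gt
  rw [gam, Fin.prod_univ_castSucc, last_row, mul_one, gam, ← Finset.prod_mul_distrib]
  refine Finset.prod_congr rfl fun i _ => ?_
  rw [Fin.prod_univ_castSucc, mul_comm]
  simp [Fin.castSucc_lt_last]

/-- The product of the entries of `S̄ᵗ` (in the first half) and `S` (in the second half) at the
positions given by two sequences. -/
def entryProd (r s : ℕ) (p p' : Fin r → Fin N) : A :=
  ((List.finRange r).map fun i : Fin r => if (i : ℕ) < r / 2 then d.SbarT (s + i) (p i) (p' i)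
    else d.S (s + i) (p i) (p' i)).prod

theorem entryProd_consSnoc (r s : ℕ) (a : Fin r → Fin N) (e k : Fin N) (β : Fin (r + 1) → Fin N)
    (k' : Fin N) :
    d.entryProd (r + 2) s (consSnoc e a k) (Fin.snoc β k') =
      d.SbarT s e (β 0) * d.entryProd r (s + 1) a (Fin.tail β) * d.S (s + (r + 1)) k k' := by
  obtain ⟨e', a', rfl⟩ : ∃ e' a', β = Fin.cons e' a' := ⟨_, _, (Fin.cons_self_tail β).symm⟩
  rw [entryProd, List.finRange_succ, ← Fin.cons_snoc_eq_snoc_cons, List.map_cons, List.prod_cons,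
    List.map_map, List.finRange_succ_last, List.map_append, List.prod_append, List.map_map,
    ← mul_assoc]
  have inner : ∀ i : Fin r, s + (i.castSucc.succ : Fin (r + 2)) = s + 1 + i ∧
      ((i.castSucc.succ : Fin (r + 2)) < (r + 2) / 2 ↔ (i : ℕ) < r / 2) := by
    intro i
    simp only [Fin.val_succ, Fin.val_castSucc]
    omega
  have last_not_lt : ¬ r + 1 < (r + 2) / 2 := by omega
  congr 1
  · congr 1
    · simp [consSnoc]
    · rw [entryProd]
      congr 1
      refine List.map_congr_left fun i _ => ?_
      simp only [Function.comp_apply, (inner i).1, (inner i).2, consSnoc, Fin.cons_succ,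
        Fin.snoc_castSucc, Fin.tail_cons]
  · simp only [List.map_cons, List.map_nil, List.prod_singleton, Function.comp_apply, consSnoc,
      Fin.cons_succ, Fin.snoc_last, Fin.val_succ, Fin.val_last, if_neg last_not_lt]

/-- The expansion of the entries of `f S₁ R ⋯ R S₂ R ⋯ S_{r+1}`, for a row vector `f` supported on
the sequences enumerating `I`. -/
def Expansion (r : ℕ) : Prop :=
  ∀ (s : ℕ) (f : (Fin (r + 1) → Fin N) → K) (I : Finset (Fin N)) (w : Fin N) (b : Fin r → Fin N)
    (k' : Fin N), QAntisymm q f → (∀ p, f p ≠ 0 → Enumerates p I) → IsGreatest (I : Set (Fin N)) w →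
    Enumerates b (I.erase w) →
    (-q) ^ invNum b • (toAlg A f ᵥ* d.skl (r + 1) s) (Fin.snoc b k') =
      d.gam (r + 1) s • ∑ p : Fin (r + 1) → Fin N, (f p * (-q) ^ invNum (Fin.init (piFun p))) •
        d.entryProd (r + 1) s p (Fin.snoc (Fin.init (piFun p)) k')

/-- The part of the expansion of `f S₁ R ⋯ R S₂ R ⋯ S_{r+2}` which comes from the rows `(e, ⋯, k)`
with fixed outer entries, without the outer factors `S₁` and `S_{r+2}`. -/
def InnerExpansion (r : ℕ) : Prop :=
  ∀ (s : ℕ) (f : (Fin (r + 2) → Fin N) → K) (I : Finset (Fin N)) (w w₂ : Fin N)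
    (b : Fin r → Fin N) (e k : Fin N), QAntisymm q f → (∀ p, f p ≠ 0 → Enumerates p I) →
    IsGreatest (I : Set (Fin N)) w → IsGreatest (I.erase w : Set (Fin N)) w₂ →
    Enumerates b ((I.erase w).erase (if k = w then w₂ else k)) →
    (-q) ^ invNum (Fin.cons (if k = w then w₂ else k) b : Fin (r + 1) → Fin N) •
        (toAlg A (fun a => f (consSnoc e a k)) ᵥ* d.skl r (s + 1)) b =
      d.gam r (s + 1) • ∑ a : Fin r → Fin N,
        (f (consSnoc e a k) * (-q) ^ invNum (Fin.init (piFun (consSnoc e a k)))) •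
          d.entryProd r (s + 1) a (Fin.tail (Fin.init (piFun (consSnoc e a k))))

theorem expansion_zero : d.Expansion 0 := by
  intro s f I w b k' _ _ _ _
  have invNum_eq : ∀ b : Fin 0 → Fin N, invNum b = 0 := fun b => by simp [invNum]
  have snoc_zero : ∀ (b : Fin 0 → Fin N) (c : Fin N), (Fin.snoc b c : Fin 1 → Fin N) 0 = c :=
    fun b c => Fin.snoc_last (α := fun _ => Fin N) c b
  have entryProd_eq : ∀ p p' : Fin 1 → Fin N, d.entryProd 1 s p p' = d.S s (p 0) (p' 0) :=
    fun p p' => by simp [entryProd, List.finRange_succ]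
  have gam_eq : d.gam 1 s = 1 := by simp [gam]
  simp only [zero_add, invNum_eq, pow_zero, one_smul, mul_one, gam_eq, entryProd_eq, snoc_zero]
  rw [skl_succ, ← vecMul_vecMul, vecMul_oneSite_last, sklInit, vecMul_one,
    ← (Equiv.funUnique (Fin 1) (Fin N)).symm.sum_comp]
  refine Finset.sum_congr rfl fun e _ => ?_
  have snoc_eq : Fin.snoc b e = (Equiv.funUnique (Fin 1) (Fin N)).symm e := by
    ext i
    rw [Subsingleton.elim (α := Fin 1) i (Fin.last 0), Fin.snoc_last]
    rfl
  rw [toAlg, ← Algebra.smul_def, snoc_eq]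
  rfl

theorem innerExpansion_zero : d.InnerExpansion 0 := by
  intro s f I w w₂ b e k _ _ _ _ _
  have invNum_eq : ∀ b : Fin 1 → Fin N, invNum b = 0 := fun b => by simp [invNum]
  have entryProd_eq : ∀ p p' : Fin 0 → Fin N, d.entryProd 0 (s + 1) p p' = 1 := by simp [entryProd]
  have gam_eq : d.gam 0 (s + 1) = 1 := by simp [gam]
  simp only [invNum_eq, pow_zero, one_smul, mul_one, gam_eq, entryProd_eq]
  rw [Fintype.sum_unique, skl, vecMul_one, toAlg, Algebra.algebraMap_eq_smul_one,
    Subsingleton.elim b default]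

theorem InnerExpansion.SbarT_mul {r : ℕ} (h : d.InnerExpansion r) (s : ℕ)
    {f : (Fin (r + 2) → Fin N) → K} {I : Finset (Fin N)} {w w₂ c : Fin N} {b : Fin r → Fin N}
    (hf : QAntisymm q f) (hs : ∀ p, f p ≠ 0 → Enumerates p I)
    (hw : IsGreatest (I : Set (Fin N)) w) (hw₂ : IsGreatest (I.erase w : Set (Fin N)) w₂)
    (e k : Fin N) (hc : c = if k = w then w₂ else k) (hb : Enumerates b ((I.erase w).erase c)) :
    (-q) ^ invNum (Fin.cons c b : Fin (r + 1) → Fin N) •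
        (d.SbarT s e c * (toAlg A (fun a => f (consSnoc e a k)) ᵥ* d.skl r (s + 1)) b) =
      d.gam r (s + 1) • ∑ a : Fin r → Fin N,
        (f (consSnoc e a k) * (-q) ^ invNum (Fin.init (piFun (consSnoc e a k)))) •
          (d.SbarT s e (Fin.init (piFun (consSnoc e a k)) 0) *
            d.entryProd r (s + 1) a (Fin.tail (Fin.init (piFun (consSnoc e a k))))) := by
  subst hc
  rw [← mul_smul_comm, h s f I w w₂ b e k hf hs hw hw₂ hb, mul_smul_comm, Finset.mul_sum]
  congr 1
  refine Finset.sum_congr rfl fun a _ => ?_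
  by_cases ha : f (consSnoc e a k) = 0
  · rw [ha, zero_mul, zero_smul, zero_smul, mul_zero]
  · rw [(hs _ ha).init_piFun_consSnoc_zero hw hw₂, mul_smul_comm]

variable [NeZero (2 : K)]

theorem vecMul_sklInit_of_notMem (hq : q ≠ 0) {r : ℕ} (s : ℕ)
    {f : (Fin (r + 2) → Fin N) → K} {I : Finset (Fin N)} {b : Fin (r + 1) → Fin N}
    (hf : QAntisymm q f) (hs : ∀ p, f p ≠ 0 → Enumerates p I) (hb : ∀ i, b i ∈ I) {k : Fin N}
    (hk : k ∉ I) : (toAlg A f ᵥ* d.sklInit (r + 1) s) (Fin.snoc b k) = 0 := by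
  have apply_eq_zero : ∀ e (a : Fin r → Fin N), f (consSnoc e a k) = 0 := fun e a => by
    by_contra hne
    exact hk (Finset.mem_of_mem_erase (enumerates_consSnoc.1 (hs _ hne)).2.1)
  have entry := d.vecMul_sklInit_snoc_cons hq s hf (fun p hp => (hs p hp).mem_range (hb 0))
    (b := Fin.tail b) (k := k) fun l hl => hk (hl ▸ hb l.succ)
  simp only [← consSnoc.eq_1, apply_eq_zero] at entry
  rw [Fin.cons_self_tail] at entry
  rw [entry]
  simp [vecMul, dotProduct, toAlg]

theorem InnerExpansion.vecMul_sklInit (hq : q ≠ 0) {r : ℕ} (h : d.InnerExpansion r) (s : ℕ)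
    {f : (Fin (r + 2) → Fin N) → K} {I : Finset (Fin N)} {w : Fin N} {b : Fin (r + 1) → Fin N}
    (hf : QAntisymm q f) (hs : ∀ p, f p ≠ 0 → Enumerates p I)
    (hw : IsGreatest (I : Set (Fin N)) w) (hb : Enumerates b (I.erase w)) {k : Fin N}
    (hk : k ∈ I) :
    (-q) ^ invNum b • (toAlg A f ᵥ* d.sklInit (r + 1) s) (Fin.snoc b k) =
      d.gam (r + 2) s • ∑ e, ∑ a : Fin r → Fin N,
        (f (consSnoc e a k) * (-q) ^ invNum (Fin.init (piFun (consSnoc e a k)))) •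
          (d.SbarT s e (Fin.init (piFun (consSnoc e a k)) 0) *
            d.entryProd r (s + 1) a (Fin.tail (Fin.init (piFun (consSnoc e a k))))) := by
  have card_eq := hb.card_eq
  obtain ⟨w₂, hw₂⟩ : ∃ w₂, IsGreatest (I.erase w : Set (Fin N)) w₂ :=
    ⟨_, Finset.isGreatest_max' _ (Finset.card_pos.1 (by omega))⟩
  obtain ⟨c, c_eq⟩ : ∃ c, c = if k = w then w₂ else k := ⟨_, rfl⟩
  have hc : c ∈ I.erase w := by
    rw [c_eq]
    split_ifs with hkw
    · exact hw₂.1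
    · exact Finset.mem_erase.2 ⟨hkw, hk⟩
  obtain ⟨b', hb'⟩ : ∃ b' : Fin r → Fin N, Enumerates b' ((I.erase w).erase c) :=
    ⟨_, Enumerates.of_card_eq (by rw [Finset.card_erase_of_mem hc, card_eq, Nat.add_sub_cancel])⟩
  have hcb' : Enumerates (Fin.cons c b') (I.erase w) := enumerates_cons.2 ⟨hc, hb'⟩
  have ne_k : ∀ l, b' l ≠ k := by
    intro l hl
    have k_mem := hl ▸ hb'.apply_mem l
    rw [Finset.mem_erase, Finset.mem_erase] at k_mem
    exact k_mem.1 (by rw [c_eq, if_neg k_mem.2.1])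
  rw [(d.qAntisymm_vecMul_sklInit hq (r + 1) s hf.toAlg k).weight_eq hb.injective hcb'.injective
      (hcb'.range_eq.trans hb.range_eq.symm),
    d.vecMul_sklInit_snoc_cons hq s hf
      (fun p hp => (hs p hp).mem_range (Finset.mem_of_mem_erase hc)) ne_k,
    d.gam_succ, d.gam_succ_last, ← mul_assoc, mul_smul _ (d.gam r (s + 1)), smul_comm ((-q) ^ _)]
  congr 1
  rw [Finset.smul_sum, Finset.smul_sum]
  exact Finset.sum_congr rfl fun e _ => h.SbarT_mul d s hf hs hw hw₂ e k c_eq hb'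

theorem InnerExpansion.expansion (hq : q ≠ 0) {r : ℕ} (h : d.InnerExpansion r) :
    d.Expansion (r + 1) := by
  intro s f I w b k' hf hs hw hb
  rw [skl_succ, ← vecMul_vecMul, vecMul_oneSite_last, sum_consSnoc, Finset.smul_sum,
    Finset.smul_sum]
  refine Finset.sum_congr rfl fun k _ => ?_
  by_cases hk : k ∈ I
  · rw [← smul_mul_assoc, h.vecMul_sklInit d hq s hf hs hw hb hk, smul_mul_assoc, Finset.sum_mul]
    simp only [Finset.sum_mul, smul_mul_assoc, entryProd_consSnoc]
  · have apply_eq_zero : ∀ e (a : Fin r → Fin N), f (consSnoc e a k) = 0 := fun e a => by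
      by_contra hne
      exact hk (Finset.mem_of_mem_erase (enumerates_consSnoc.1 (hs _ hne)).2.1)
    rw [d.vecMul_sklInit_of_notMem hq s hf hs
      (fun i => Finset.mem_of_mem_erase (hb.apply_mem i)) hk]
    simp [apply_eq_zero]

theorem Expansion.innerExpansion (hq : q ≠ 0) {r : ℕ} (h : d.Expansion r) :
    d.InnerExpansion (r + 1) := by
  intro s f I w w₂ b e k hf hs hw hw₂ hb
  by_cases h0 : ∀ a, f (consSnoc e a k) = 0
  · simp [h0, vecMul, dotProduct, toAlg]
  push Not at h0
  obtain ⟨a₀, ha₀⟩ := h0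
  obtain ⟨c, hc⟩ : ∃ c, c = if k = w then w₂ else k := ⟨_, rfl⟩
  obtain ⟨k₁, m, init_piFun⟩ := (hs _ ha₀).exists_invNum_snoc_init_piFun hw hw₂ hc
  obtain ⟨-, image_enumerates, invNum_eq⟩ := init_piFun a₀ (hs _ ha₀)
  rw [← hc] at hb ⊢
  have inner_enumerates : ∀ a, f (consSnoc e a k) ≠ 0 → Enumerates a ((I.erase e).erase k) :=
    fun a ha => (enumerates_consSnoc.1 (hs _ ha)).2.2
  have card_eq := (inner_enumerates a₀ ha₀).card_eq
  obtain ⟨w', hw'⟩ : ∃ w', IsGreatest ((I.erase e).erase k : Set (Fin N)) w' :=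
    ⟨_, Finset.isGreatest_max' _ (Finset.card_pos.1 (by omega))⟩
  have hfe : QAntisymm q fun a : Fin (r + 1) → Fin N => f (consSnoc e a k) := (hf.cons e).snoc k
  have expand := h (s + 1) _ _ w' _ k₁ hfe inner_enumerates hw'
    ((inner_enumerates a₀ ha₀).enumerates_init_piFun hw')
  have reorder := (d.qAntisymm_vecMul_skl hq (r + 1) (s + 1) (hfe.toAlg (A := A))).weight_eq
    hb.injective image_enumerates.injective (image_enumerates.range_eq.trans hb.range_eq.symm)
  rw [hb.invNum_cons, add_comm, pow_add, mul_smul, reorder, invNum_eq, add_comm (invNum _),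
    pow_add, mul_smul, expand, smul_smul, smul_comm, Finset.smul_sum]
  congr 1
  refine Finset.sum_congr rfl fun a _ => ?_
  by_cases ha : f (consSnoc e a k) = 0
  · rw [ha, zero_mul, zero_mul, zero_smul, zero_smul, smul_zero]
  · obtain ⟨init_eq, enumerates_a, invNum_a⟩ := init_piFun a (hs _ ha)
    rw [init_eq, consSnoc.eq_1 c, enumerates_a.invNum_cons, invNum_a, Fin.tail_cons, smul_smul]
    congr 1
    rw [pow_add, pow_add]
    ring

theorem expansion (hq : q ≠ 0) (r : ℕ) : d.Expansion r := by
  induction r using Nat.twoStepInduction with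
  | zero => exact d.expansion_zero
  | one => exact d.innerExpansion_zero.expansion d hq
  | more r ih _ => exact (ih.innerExpansion d hq).expansion d hq

end RTTData

section MatrixUnits

variable {N : ℕ} {B : Type*} [Ring B]

theorem sum_smul_E_kronecker_E_diag_apply (z : Fin N → Fin N → B) (i j k l : Fin N) :
    (∑ m, ∑ n, z m n • (E B m m ⊗ₖ E B n n)) (i, j) (k, l) =
      if i = k ∧ j = l then z i j else 0 := by
  simp only [E, single_kronecker_single, mul_one, smul_single, Matrix.sum_apply, single_apply,
    Prod.mk.injEq, smul_eq_mul]
  by_cases h : i = k ∧ j = l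
  · obtain ⟨rfl, rfl⟩ := h
    simp [ite_and, Finset.sum_ite_irrel]
  · rw [if_neg h]
    exact Finset.sum_eq_zero fun m _ => Finset.sum_eq_zero fun n _ => if_neg (by grind)

theorem sum_smul_E_kronecker_E_swap_apply (z : Fin N → Fin N → B) (i j k l : Fin N) :
    (∑ m, ∑ n, z m n • (E B m n ⊗ₖ E B n m)) (i, j) (k, l) =
      if i = l ∧ j = k then z i j else 0 := by
  simp only [E, single_kronecker_single, mul_one, smul_single, Matrix.sum_apply, single_apply,
    Prod.mk.injEq, smul_eq_mul]
  by_cases h : i = l ∧ j = k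
  · obtain ⟨rfl, rfl⟩ := h
    rw [Finset.sum_eq_single i (fun m _ hm => Finset.sum_eq_zero fun n _ => if_neg (by grind))
      (by simp), Finset.sum_eq_single j (fun n _ hn => if_neg (by grind)) (by simp)]
    simp
  · rw [if_neg h]
    exact Finset.sum_eq_zero fun m _ => Finset.sum_eq_zero fun n _ => if_neg (by grind)

theorem Pq_eq_permMat (N : ℕ) (q : ℂ) : Pq N q = permMat N q := by
  have Pq_eq : Pq N q = ∑ i, ∑ j, pq q i j • (E ℂ i j ⊗ₖ E ℂ j i) := by
    have diag : ∑ i : Fin N, E ℂ i i ⊗ₖ E ℂ i i =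
        ∑ i : Fin N, ∑ j, if i = j then E ℂ i j ⊗ₖ E ℂ j i else 0 := by
      simp
    rw [Pq, diag]
    simp only [← Finset.sum_add_distrib]
    refine Finset.sum_congr rfl fun i _ => Finset.sum_congr rfl fun j _ => ?_
    rcases lt_trichotomy i j with h | h | h
    · simp [pq, h, h.ne, h.not_gt]
    · simp [pq, h]
    · simp [pq, h, h.ne', h.not_gt]
  ext ⟨i, j⟩ ⟨k, l⟩
  rw [Pq_eq, sum_smul_E_kronecker_E_swap_apply, permMat, of_apply]

end MatrixUnits

section Antisymmetrizer

variable {N r : ℕ} {q : ℂ}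

theorem comp_swap_comp_swap {ι β : Type*} [DecidableEq ι] (b : ι → β) (i j : ι) :
    (b ∘ Equiv.swap i j) ∘ Equiv.swap i j = b := by
  ext m
  simp

theorem pq_eq_zpow (b : Fin r → Fin N) (k : AdjIdx r) :
    pq q (b k.right) (b k.left) =
      q ^ ((invNum (b ∘ Equiv.swap k.left k.right) : ℤ) - invNum b) := by
  rcases lt_trichotomy (b k.left) (b k.right) with h | h | h
  · rw [invNum_comp_swap b k h]
    simp [pq, h]
  · rw [comp_swap_of_apply_eq h, h, sub_self, zpow_zero, pq_self]
  · have invNum_eq := invNum_comp_swap (b ∘ Equiv.swap k.left k.right) k (by simpa using h)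
    rw [comp_swap_comp_swap] at invNum_eq
    rw [invNum_eq]
    simp [pq, h, h.not_gt]

theorem vecMul_Pq (f : (Fin r → Fin N) → ℂ) (k : AdjIdx r) (b : Fin r → Fin N) :
    (f ᵥ* twoSite (Pq N q) k.left k.right) b =
      q ^ ((invNum (b ∘ Equiv.swap k.left k.right) : ℤ) - invNum b) *
        f (b ∘ Equiv.swap k.left k.right) := by
  have Pq_eq : Pq N q = base ℂ (permMat N q) := by
    rw [Pq_eq_permMat, base, Algebra.algebraMap_self, RingHom.coe_id, Matrix.map_id]
  rw [Pq_eq, vecMul_permMat _ k.left_ne_right, pq_eq_zpow, smul_eq_mul]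

theorem vecMul_prod_Pq (hq : q ≠ 0) (w : List (AdjIdx r)) (f : (Fin r → Fin N) → ℂ)
    (b : Fin r → Fin N) :
    (f ᵥ* (w.map fun k => twoSite (Pq N q) k.left k.right).prod) b =
      q ^ ((invNum (b ∘ ⇑(wordPerm w)⁻¹) : ℤ) - invNum b) * f (b ∘ ⇑(wordPerm w)⁻¹) := by
  induction w generalizing f with
  | nil => simp [wordPerm]
  | cons k w ih =>
    have comp_eq : b ∘ ⇑(wordPerm (k :: w))⁻¹ =
        (b ∘ ⇑(wordPerm w)⁻¹) ∘ Equiv.swap k.left k.right := by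
      ext m
      simp [wordPerm, _root_.mul_inv_rev]
    rw [List.map_cons, List.prod_cons, ← vecMul_vecMul, ih, vecMul_Pq, comp_eq, ← mul_assoc,
      ← zpow_add₀ hq]
    congr 2
    ring

theorem vecMul_qPerm (hq : q ≠ 0) (f : (Fin r → Fin N) → ℂ) (σ : Equiv.Perm (Fin r))
    (b : Fin r → Fin N) :
    (f ᵥ* qPerm N q σ) b = q ^ ((invNum (b ∘ ⇑σ⁻¹) : ℤ) - invNum b) * f (b ∘ ⇑σ⁻¹) := by
  rw [qPerm, vecMul_prod_Pq hq, (exists_isReducedWord σ).choose_spec.1]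

theorem vecMul_qAntisym (hq : q ≠ 0) (f : (Fin r → Fin N) → ℂ) (b : Fin r → Fin N) :
    (f ᵥ* qAntisym N r q) b = ∑ σ : Equiv.Perm (Fin r), ((Equiv.Perm.sign σ : ℤ) : ℂ) *
      (q ^ ((invNum (b ∘ ⇑σ⁻¹) : ℤ) - invNum b) * f (b ∘ ⇑σ⁻¹)) := by
  simp only [qAntisym, ← vecMul_qPerm hq, vecMul_sum, vecMul_smul, Finset.sum_apply,
    Pi.smul_apply, smul_eq_mul]

theorem qAntisymm_vecMul_qAntisym (hq : q ≠ 0) (f : (Fin r → Fin N) → ℂ) :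
    QAntisymm q (f ᵥ* qAntisym N r q) := by
  intro k b
  rw [pq_eq_zpow, vecMul_qAntisym hq, vecMul_qAntisym hq, smul_eq_mul, Finset.mul_sum,
    ← Finset.sum_neg_distrib, ← Equiv.sum_comp (Equiv.mulRight (Equiv.swap k.left k.right))]
  refine Finset.sum_congr rfl fun σ _ => ?_
  have comp_eq : (b ∘ Equiv.swap k.left k.right) ∘ ⇑σ⁻¹ =
      b ∘ ⇑(σ * Equiv.swap k.left k.right)⁻¹ := by
    ext m
    simp [_root_.mul_inv_rev]
  rw [Equiv.coe_mulRight, comp_eq, Equiv.Perm.sign_mul, Equiv.Perm.sign_swap k.left_ne_right,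
    ← sub_add_sub_cancel _ (invNum (b ∘ Equiv.swap k.left k.right) : ℤ), zpow_add₀ hq]
  push_cast
  ring

theorem qAntisym_id (hq : q ≠ 0) : qAntisym N N q id id = 1 := by
  have row_eq := vecMul_qAntisym hq (Pi.single (id : Fin N → Fin N) 1) id
  rw [single_one_vecMul, row_apply] at row_eq
  rw [row_eq, Finset.sum_eq_single 1]
  · simp
  · intro σ _ hσ
    have comp_ne : (id ∘ ⇑σ⁻¹ : Fin N → Fin N) ≠ id := fun h =>
      hσ (inv_eq_one.1 (Equiv.coe_fn_injective h))
    rw [Pi.single_eq_of_ne comp_ne, mul_zero, mul_zero]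
  · simp

end Antisymmetrizer

section Weight

variable {N r : ℕ} {K A : Type*} [Field K] [Ring A] [Algebra K A] {q : K}

/-- The `q`-antisymmetric row vector with the entry `(-q)^{-l(b)}` at a permutation `b`. -/
noncomputable def weight (N : ℕ) (q : K) (b : Fin N → Fin N) : K :=
  open Classical in if Injective b then ((-q) ^ invNum b)⁻¹ else 0

theorem weight_of_injective {b : Fin N → Fin N} (hb : Injective b) :
    weight N q b = ((-q) ^ invNum b)⁻¹ :=
  if_pos hb

theorem weight_of_not_injective {b : Fin N → Fin N} (hb : ¬ Injective b) : weight N q b = 0 :=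
  if_neg hb

theorem invNum_of_monotone {α : Type*} [LinearOrder α] {b : Fin r → α} (hb : Monotone b) :
    invNum b = 0 :=
  Finset.sum_eq_zero fun _ _ => Finset.sum_eq_zero fun _ _ =>
    if_neg fun h => (hb h.1.le).not_gt h.2

theorem enumerates_univ_of_injective {b : Fin N → Fin N} (hb : Injective b) :
    Enumerates b Finset.univ :=
  ⟨hb, by rw [Finset.coe_univ, (Finite.surjective_of_injective hb).range_eq]⟩

theorem QAntisymm.eq_weight [NeZero (2 : K)] (hq : q ≠ 0) {f : (Fin N → Fin N) → A}
    (hf : QAntisymm q f) (b : Fin N → Fin N) : f b = weight N q b • f id := by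
  by_cases hb : Injective b
  · have apply_id := hf.weight_eq hb injective_id
      (by rw [Set.range_id, (Finite.surjective_of_injective hb).range_eq])
    rw [invNum_of_monotone monotone_id, pow_zero, one_smul] at apply_id
    rw [weight_of_injective hb, ← apply_id, inv_smul_smul₀ (pow_ne_zero _ (neg_ne_zero.2 hq))]
  · rw [weight_of_not_injective hb, hf.apply_eq_zero_of_not_injective hq hb, zero_smul]

theorem weight_comp_swap {k : AdjIdx N} {b : Fin N → Fin N} (h : b k.left < b k.right) :
    weight N q (b ∘ Equiv.swap k.left k.right) = -(q⁻¹ * weight N q b) := by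
  have injective_iff : Injective (b ∘ Equiv.swap k.left k.right) ↔ Injective b :=
    Equiv.injective_comp _ _
  by_cases hb : Injective b
  · rw [weight_of_injective hb, weight_of_injective (injective_iff.2 hb), invNum_comp_swap b k h,
      pow_succ, mul_inv, inv_neg]
    ring
  · rw [weight_of_not_injective hb, weight_of_not_injective (injective_iff.not.2 hb), mul_zero,
      neg_zero]

theorem qAntisymm_weight (hq : q ≠ 0) : QAntisymm q (weight N q) := by
  intro k b
  rcases lt_trichotomy (b k.left) (b k.right) with h | h | h
  · rw [weight_comp_swap h]
    simp [pq, h, hq]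
  · rw [comp_swap_of_apply_eq h, weight_of_not_injective fun hb => k.left_ne_right (hb h),
      smul_zero, neg_zero]
  · have weight_eq := weight_comp_swap (q := q) (b := b ∘ Equiv.swap k.left k.right) (k := k)
      (by simpa using h)
    rw [comp_swap_comp_swap] at weight_eq
    rw [weight_eq]
    simp [pq, h, h.not_gt]

end Weight

namespace RTTData

variable {N : ℕ} {K A : Type*} [Field K] [NeZero (2 : K)] [Ring A] [Algebra K A] {q : K}
  (d : RTTData N q A)

/-- The Sklyanin determinant, as the entry at the identity of the image of `weight`. -/
noncomputable def det : A := (toAlg A (weight N q) ᵥ* d.skl N 0) id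

theorem vecMul_skl_eq_smul_det (hq : q ≠ 0) {f : (Fin N → Fin N) → K} (hf : QAntisymm q f)
    (b : Fin N → Fin N) : (toAlg A f ᵥ* d.skl N 0) b = f b • d.det := by
  have weight_eq := (d.qAntisymm_vecMul_skl hq N 0
    (qAntisymm_weight (N := N) hq).toAlg).eq_weight hq b
  have toAlg_eq : toAlg A f = f id • toAlg A (weight N q) := by
    ext a
    rw [Pi.smul_apply, toAlg, toAlg, hf.eq_weight hq a, smul_eq_mul, map_mul, Algebra.smul_def,
      Algebra.commutes]
  rw [toAlg_eq, smul_vecMul, Pi.smul_apply, weight_eq, smul_smul, hf.eq_weight hq b, smul_eq_mul,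
    mul_comm, det]

theorem det_eq_sum_fun (hq : q ≠ 0) : d.det = d.gam N 0 • ∑ p : Fin N → Fin N,
    (weight N q p * (-q) ^ invNum (piFun p)) • d.entryProd N 0 p (piFun p) := by
  rcases N with _ | n
  · have det_eq_one : d.det = 1 := by
      rw [det, skl, vecMul_one, toAlg, weight_of_injective injective_id,
        invNum_of_monotone monotone_id, pow_zero, inv_one, map_one]
    rw [det_eq_one, Fintype.sum_unique, weight_of_injective (injective_of_subsingleton _)]
    simp [gam, entryProd, invNum]
  have isGreatest : IsGreatest ((Finset.univ : Finset (Fin (n + 1))) : Set (Fin (n + 1)))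
      (Fin.last n) := ⟨Finset.mem_univ _, fun z _ => Fin.le_last z⟩
  have snoc_castSucc : (Fin.snoc Fin.castSucc (Fin.last n) : Fin (n + 1) → Fin (n + 1)) = id := by
    ext m
    refine Fin.lastCases ?_ (fun m => ?_) m <;> simp
  have castSucc_enumerates : Enumerates Fin.castSucc (Finset.univ.erase (Fin.last n)) :=
    (enumerates_snoc.1 (snoc_castSucc ▸ enumerates_univ_of_injective injective_id)).2
  have weight_support : ∀ p, weight (n + 1) q p ≠ 0 → Enumerates p Finset.univ := fun p hp =>
    enumerates_univ_of_injective (by_contra fun h => hp (weight_of_not_injective h))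
  have expand := d.expansion hq n 0 _ _ _ _ (Fin.last n) (qAntisymm_weight hq) weight_support
    isGreatest castSucc_enumerates
  rw [invNum_of_monotone Fin.strictMono_castSucc.monotone, snoc_castSucc, pow_zero,
    one_smul] at expand
  rw [det, expand]
  congr 1
  refine Finset.sum_congr rfl fun p _ => ?_
  by_cases hp : weight (n + 1) q p = 0
  · rw [hp, zero_mul, zero_mul, zero_smul, zero_smul]
  · have snoc_init : Fin.snoc (Fin.init (piFun p)) (Fin.last n) = piFun p := by
      rw [← (weight_support p hp).piFun_last isGreatest, Fin.snoc_init_self]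
    have invNum_eq : invNum (piFun p) = invNum (Fin.init (piFun p)) := by
      rw [← snoc_init, invNum_snoc, Fin.init_snoc]
      simp [Fin.le_last]
    rw [snoc_init, invNum_eq]

theorem det_eq (hq : q ≠ 0) : d.det = d.gam N 0 • ∑ p : Equiv.Perm (Fin N),
    (-q) ^ (-(length p : ℤ) + (length (piMap p) : ℤ)) • d.entryProd N 0 p (piMap p) := by
  rw [d.det_eq_sum_fun hq]
  congr 1
  symm
  refine Fintype.sum_of_injective (fun p : Equiv.Perm (Fin N) => (p : Fin N → Fin N))
    DFunLike.coe_injective _ _ (fun p hp => ?_) fun p => ?_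
  · have not_injective : ¬ Injective p := fun h =>
      hp ⟨Equiv.ofBijective p (Finite.injective_iff_bijective.1 h), rfl⟩
    rw [weight_of_not_injective not_injective, zero_mul, zero_smul]
  · rw [weight_of_injective p.injective, length_eq_invNum, length_eq_invNum, piMap_eq_piFun,
      zpow_add₀ (neg_ne_zero.2 hq), _root_.zpow_neg, zpow_natCast, zpow_natCast]

end RTTData

/-! ### Laurent series -/

section Lowest

theorem coeff_mul_of_lowest {B : Type*} [NonUnitalNonAssocSemiring B] {g p : LaurentSeries B}
    {m n : ℤ} (hg : ∀ k < m, g.coeff k = 0) (hp : ∀ k < n, p.coeff k = 0) :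
    (g * p).coeff (m + n) = g.coeff m * p.coeff n := by
  have eq_of_mem : ∀ a ∈ Finset.antidiagonal g.isPWO_support p.isPWO_support (m + n),
      a = (m, n) := by
    intro a ha
    rw [Finset.mem_antidiagonal, HahnSeries.mem_support, HahnSeries.mem_support] at ha
    have le_fst : m ≤ a.1 := not_lt.1 fun h => ha.1 (hg _ h)
    have le_snd : n ≤ a.2 := not_lt.1 fun h => ha.2.1 (hp _ h)
    exact Prod.ext (by omega) (by omega)
  rw [HahnSeries.coeff_mul]
  by_cases h : g.coeff m = 0 ∨ p.coeff n = 0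
  · have mul_eq_zero : g.coeff m * p.coeff n = 0 := by rcases h with h | h <;> simp [h]
    rw [mul_eq_zero]
    exact Finset.sum_eq_zero fun a ha => by rw [eq_of_mem a ha, mul_eq_zero]
  · rw [not_or] at h
    exact Finset.sum_eq_single (m, n) (fun a ha hne => absurd (eq_of_mem a ha) hne)
      fun hn => absurd (by simp [h]) hn

variable {N : ℕ} {B : Type*} [Ring B] {M : Matrix (Fin N) (Fin N) (LaurentSeries B)}

theorem coeff_eq_zero_of_vecMul_eq_zero (hneg : ∀ i j, ∀ k < 0, (M i j).coeff k = 0)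
    (hlow : ∀ i j, i < j → (M i j).coeff 0 = 0) (hdiag : ∀ i, ∃ b, (M i i).coeff 0 * b = 1)
    {g : Fin N → LaurentSeries B} (h : g ᵥ* M = 0) {m : ℤ} (hm : ∀ i, ∀ k < m, (g i).coeff k = 0)
    (j : Fin N) : (g j).coeff m = 0 := by
  induction j using WellFoundedGT.induction with
  | _ j ih =>
    have sum_eq_zero : ∑ i, (g i).coeff m * (M i j).coeff 0 = 0 := by
      have coeff_h := congrArg (fun f => HahnSeries.coeff f m) (congrFun h j)
      simp only [vecMul, dotProduct, HahnSeries.coeff_sum, Pi.zero_apply,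
        HahnSeries.coeff_zero] at coeff_h
      rw [← coeff_h]
      refine Finset.sum_congr rfl fun i _ => ?_
      rw [← coeff_mul_of_lowest (hm i) (hneg i j), add_zero]
    rw [Finset.sum_eq_single j] at sum_eq_zero
    · obtain ⟨b, hb⟩ := hdiag j
      rw [← mul_one ((g j).coeff m), ← hb, ← mul_assoc, sum_eq_zero, zero_mul]
    · intro i _ hij
      rcases lt_or_gt_of_ne hij with hij | hij
      · rw [hlow i j hij, mul_zero]
      · rw [ih i hij, zero_mul]
    · exact fun hj => absurd (Finset.mem_univ j) hj

theorem eq_zero_of_vecMul_eq_zero (hneg : ∀ i j, ∀ k < 0, (M i j).coeff k = 0)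
    (hlow : ∀ i j, i < j → (M i j).coeff 0 = 0) (hdiag : ∀ i, ∃ b, (M i i).coeff 0 * b = 1)
    {g : Fin N → LaurentSeries B} (h : g ᵥ* M = 0) : g = 0 := by
  obtain ⟨n, hn⟩ : ∃ n : ℤ, ∀ i, ∀ k < n, (g i).coeff k = 0 := by
    obtain ⟨n, hn⟩ := (Set.finite_range fun i => (g i).order).bddBelow
    exact ⟨n, fun i k hk => HahnSeries.coeff_eq_zero_of_lt_order (hk.trans_le (hn ⟨i, rfl⟩))⟩
  have coeff_eq_zero : ∀ m, n ≤ m → ∀ i, ∀ k < m, (g i).coeff k = 0 := by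
    intro m hm
    induction m, hm using Int.leInduction with
    | base => exact hn
    | succ m _ ih =>
      intro i k hk
      rcases (Int.lt_add_one_iff.1 hk).lt_or_eq with hk | rfl
      · exact ih i k hk
      · exact coeff_eq_zero_of_vecMul_eq_zero hneg hlow hdiag h ih i
  ext i m
  exact coeff_eq_zero _ (le_max_left n (m + 1)) i m
    (Int.lt_of_lt_of_le (by omega) (le_max_right _ _))

end Lowest

section Laurent

variable {K : Type*} [CommRing K] (B : Type*) [Ring B] [Algebra K B]

/-- The inclusion `K((z)) → B((z))` for a `K`-algebra `B`. -/
noncomputable def laurentMap : LaurentSeries K →+* LaurentSeries B where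
  toFun x := x.map (algebraMap K B)
  map_one' := by
    ext n
    by_cases h : n = 0 <;> simp [HahnSeries.coeff_one, h]
  map_mul' x y := HahnSeries.map_mul (algebraMap K B : K →ₙ+* B)
  map_zero' := by ext n; simp
  map_add' x y := by ext n; simp

variable {B}

theorem coeff_laurentMap (x : LaurentSeries K) (n : ℤ) :
    (laurentMap B x).coeff n = algebraMap K B (x.coeff n) := rfl

theorem laurentMap_mul_comm (x : LaurentSeries K) (y : LaurentSeries B) :
    laurentMap B x * y = y * laurentMap B x := by
  have swap_mem : ∀ {s t : Set ℤ} (hs : s.IsPWO) (ht : t.IsPWO) (n : ℤ),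
      ∀ a ∈ Finset.antidiagonal hs ht n, a.swap ∈ Finset.antidiagonal ht hs n := by
    intro s t hs ht n a ha
    rw [Finset.mem_antidiagonal] at ha ⊢
    exact ⟨ha.2.1, ha.1, (add_comm _ _).trans ha.2.2⟩
  ext n
  rw [HahnSeries.coeff_mul, HahnSeries.coeff_mul]
  exact Finset.sum_nbij' Prod.swap Prod.swap (swap_mem _ _ n) (swap_mem _ _ n) (fun _ _ => rfl)
    (fun _ _ => rfl) fun a _ => Algebra.commutes _ _

theorem laurentMap_single (n : ℤ) (z : K) :
    laurentMap B (HahnSeries.single n z) = HahnSeries.single n (algebraMap K B z) := by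
  ext m
  rw [coeff_laurentMap, HahnSeries.coeff_single, HahnSeries.coeff_single]
  split_ifs <;> simp

theorem laurentMap_C (z : K) :
    laurentMap B (HahnSeries.C z) = algebraMap K (LaurentSeries B) z := by
  rw [HahnSeries.algebraMap_apply, HahnSeries.C_apply, laurentMap_single, HahnSeries.C_apply]

end Laurent

theorem laurentMap_cu {B : Type*} [Ring B] [Algebra ℂ B] (z : ℂ) :
    laurentMap B (cu ℂ z) = cu B z :=
  laurentMap_single _ _

theorem laurentMap_cuInv {B : Type*} [Ring B] [Algebra ℂ B] (z : ℂ) :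
    laurentMap B (cuInv ℂ z) = cuInv B z :=
  laurentMap_single _ _

/-! ### The exchange relations of the generating series -/

section Exchange

variable {N : ℕ} {K B : Type*} [Field K] [Ring B] [Algebra K B]

/-- The diagonal part of `R(1, 0)`. -/
def dU (q : K) (i j : Fin N) : K := if i = j then q⁻¹ else 1

/-- The diagonal part of `R(0, 1)`. -/
def dV (q : K) (i j : Fin N) : K := if i = j then -q else -1

/-- The off-diagonal part of `R(1, 0)`. -/
def oU (q : K) (i j : Fin N) : K := if j < i then q⁻¹ - q else 0

/-- The off-diagonal part of `R(0, 1)`. -/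
def oV (q : K) (i j : Fin N) : K := if i < j then q⁻¹ - q else 0

/-- An entry of `R X₁ Y₂ - Y₂ X₁ R`, where `R` has the diagonal part `d` and the off-diagonal
part `o`. -/
def exch (d o : Fin N → Fin N → K) (X Y : Matrix (Fin N) (Fin N) B) (i j k l : Fin N) : B :=
  d i j • (X i k * Y j l) + o i j • (X j k * Y i l) - d k l • (Y j l * X i k) -
    o l k • (Y j k * X i l)

theorem exch_map {B' : Type*} [Ring B'] [Algebra K B'] (φ : B →ₐ[K] B') (d o : Fin N → Fin N → K)
    (X Y : Matrix (Fin N) (Fin N) B) (i j k l : Fin N) :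
    φ (exch d o X Y i j k l) = exch d o (X.map φ) (Y.map φ) i j k l := by
  simp [exch]

@[simp]
theorem exch_zero_left (d o : Fin N → Fin N → K) (Y : Matrix (Fin N) (Fin N) B)
    (i j k l : Fin N) : exch d o 0 Y i j k l = 0 := by
  simp [exch]

@[simp]
theorem exch_zero_right (d o : Fin N → Fin N → K) (X : Matrix (Fin N) (Fin N) B)
    (i j k l : Fin N) : exch d o X 0 i j k l = 0 := by
  simp [exch]

theorem kronecker_one_mul_one_kronecker (X Y : Matrix (Fin N) (Fin N) B) :
    (X ⊗ₖ (1 : Matrix (Fin N) (Fin N) B)) * ((1 : Matrix (Fin N) (Fin N) B) ⊗ₖ Y) =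
      of fun a b => X a.1 b.1 * Y a.2 b.2 := by
  ext ⟨a, b⟩ ⟨a', b'⟩
  simp [Matrix.mul_apply, Fintype.sum_prod_type, kroneckerMap_apply, Matrix.one_apply]

theorem one_kronecker_mul_kronecker_one (X Y : Matrix (Fin N) (Fin N) B) :
    ((1 : Matrix (Fin N) (Fin N) B) ⊗ₖ Y) * (X ⊗ₖ (1 : Matrix (Fin N) (Fin N) B)) =
      of fun a b => Y a.2 b.2 * X a.1 b.1 := by
  ext ⟨a, b⟩ ⟨a', b'⟩
  simp [Matrix.mul_apply, Fintype.sum_prod_type, kroneckerMap_apply, Matrix.one_apply]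

variable [Algebra ℂ B]

theorem trigR_eq_sum (q : ℂ) (u v : B) : trigR N q u v =
    ∑ i, ∑ j, (dU q i j • u + dV q i j • v) • (E B i i ⊗ₖ E B j j) +
      ∑ i, ∑ j, (oU q i j • u + oV q i j • v) • (E B i j ⊗ₖ E B j i) := by
  have diag : ∑ i : Fin N, (q⁻¹ • u - q • v) • (E B i i ⊗ₖ E B i i) =
      ∑ i : Fin N, ∑ j, if i = j then (q⁻¹ • u - q • v) • (E B i i ⊗ₖ E B j j) else 0 := by
    simp
  rw [trigR, diag, add_assoc]
  congr 1
  · simp only [← Finset.sum_add_distrib]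
    refine Finset.sum_congr rfl fun i _ => Finset.sum_congr rfl fun j _ => ?_
    by_cases h : i = j
    · simp [dU, dV, h, sub_eq_add_neg]
    · simp [dU, dV, h, sub_eq_add_neg]
  · simp only [← Finset.sum_add_distrib]
    refine Finset.sum_congr rfl fun i _ => Finset.sum_congr rfl fun j _ => ?_
    rcases lt_trichotomy i j with h | h | h
    · simp [oU, oV, h, h.not_gt]
    · simp [oU, oV, h]
    · simp [oU, oV, h, h.not_gt]

theorem trigR_apply (q : ℂ) (u v : B) (i j k l : Fin N) :
    trigR N q u v (i, j) (k, l) =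
      (if i = k ∧ j = l then dU q i j • u + dV q i j • v else 0) +
        (if i = l ∧ j = k then oU q i j • u + oV q i j • v else 0) := by
  rw [trigR_eq_sum, Matrix.add_apply, sum_smul_E_kronecker_E_diag_apply,
    sum_smul_E_kronecker_E_swap_apply]

theorem trigR_mul_apply (q : ℂ) (u v : B) (X Y : Matrix (Fin N) (Fin N) B) (i j k l : Fin N) :
    (trigR N q u v * (X ⊗ₖ (1 : Matrix (Fin N) (Fin N) B)) *
      ((1 : Matrix (Fin N) (Fin N) B) ⊗ₖ Y)) (i, j) (k, l) =
      (dU q i j • u + dV q i j • v) * (X i k * Y j l) +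
        (oU q i j • u + oV q i j • v) * (X j k * Y i l) := by
  rw [Matrix.mul_assoc, kronecker_one_mul_one_kronecker]
  simp only [Matrix.mul_apply, Fintype.sum_prod_type, trigR_apply, of_apply, add_mul,
    Finset.sum_add_distrib, ite_and, ite_mul, zero_mul, Finset.sum_ite_eq, Finset.mem_univ, if_true]
  simp [Finset.sum_ite_irrel]

theorem mul_trigR_apply (q : ℂ) (u v : B) (X Y : Matrix (Fin N) (Fin N) B) (i j k l : Fin N) :
    (((1 : Matrix (Fin N) (Fin N) B) ⊗ₖ Y) * (X ⊗ₖ (1 : Matrix (Fin N) (Fin N) B)) *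
      trigR N q u v) (i, j) (k, l) =
      Y j l * X i k * (dU q k l • u + dV q k l • v) +
        Y j k * X i l * (oU q l k • u + oV q l k • v) := by
  rw [one_kronecker_mul_kronecker_one]
  simp only [Matrix.mul_apply, Fintype.sum_prod_type, trigR_apply, of_apply, mul_add,
    Finset.sum_add_distrib, ite_and, mul_ite, mul_zero]
  congr 1
  · simp [Finset.sum_ite_irrel]
  · simp [Finset.sum_ite_irrel]

theorem coeffRXY_sub_coeffYXR (q : ℂ) (X Y : ℤ → Matrix (Fin N) (Fin N) B) (a b : ℤ)
    (i j k l : Fin N) :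
    coeffRXY q X Y a b (i, j) (k, l) - coeffYXR q X Y a b (i, j) (k, l) =
      exch (dU q) (oU q) (X (a - 1)) (Y b) i j k l +
        exch (dV q) (oV q) (X a) (Y (b - 1)) i j k l := by
  simp only [coeffRXY, coeffYXR, Matrix.add_apply, trigR_mul_apply, mul_trigR_apply, exch,
    smul_zero, add_zero, zero_add, smul_mul_assoc, one_mul, mul_smul_comm, mul_one]
  abel

end Exchange

section Series

variable {N : ℕ} {B : Type*} [Ring B] [Algebra ℂ B]

/-- The matrix of power series `∑ x_r c^r z^r`. -/
noncomputable def seriesMat (c : ℂ) (x : ℕ → Matrix (Fin N) (Fin N) B) :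
    Matrix (Fin N) (Fin N) (PowerSeries B) :=
  of fun i j => PowerSeries.mk fun r => c ^ r • x r i j

theorem coeff_seriesMat_mul_seriesMat (c e : ℂ) (x y : ℕ → Matrix (Fin N) (Fin N) B)
    (i j k l : Fin N) (n : ℕ) :
    PowerSeries.coeff n (seriesMat c x i k * seriesMat e y j l) =
      ∑ a ∈ Finset.HasAntidiagonal.antidiagonal n,
        (c ^ a.1 * e ^ a.2) • (x a.1 i k * y a.2 j l) := by
  rw [PowerSeries.coeff_mul]
  refine Finset.sum_congr rfl fun a _ => ?_
  simp only [seriesMat, of_apply, PowerSeries.coeff_mk]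
  exact smul_mul_smul_comm _ _ _ _

theorem coeff_exch_seriesMat (d o : Fin N → Fin N → ℂ) (c e : ℂ)
    (x y : ℕ → Matrix (Fin N) (Fin N) B) (i j k l : Fin N) (n : ℕ) :
    PowerSeries.coeff n (exch d o (seriesMat c x) (seriesMat e y) i j k l) =
      ∑ a ∈ Finset.HasAntidiagonal.antidiagonal n,
        (c ^ a.1 * e ^ a.2) • exch d o (x a.1) (y a.2) i j k l := by
  have coeff_swap (i j k l : Fin N) :
      PowerSeries.coeff n (seriesMat e y j l * seriesMat c x i k) =
        ∑ a ∈ Finset.HasAntidiagonal.antidiagonal n,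
          (c ^ a.1 * e ^ a.2) • (y a.2 j l * x a.1 i k) := by
    rw [coeff_seriesMat_mul_seriesMat, ← Finset.Nat.sum_antidiagonal_swap]
    simp only [Prod.fst_swap, Prod.snd_swap, mul_comm]
  simp only [exch, map_sub, map_add, LinearMap.map_smul_of_tower, coeff_seriesMat_mul_seriesMat,
    coeff_swap, Finset.smul_sum, ← Finset.sum_add_distrib, ← Finset.sum_sub_distrib]
  refine Finset.sum_congr rfl fun a _ => ?_
  module

theorem smul_sum_antidiagonal_add_smul_sum_antidiagonal_eq_zero {R V : Type*} [CommRing R]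
    [AddCommGroup V] [Module R V] {P Q : ℕ → ℕ → V} (hP : ∀ b, P 0 b = 0) (hQ : ∀ a, Q a 0 = 0)
    (h : ∀ a b, P (a + 1) b + Q a (b + 1) = 0) (c e : R) (n : ℕ) :
    e • (∑ a ∈ Finset.HasAntidiagonal.antidiagonal n, (c ^ a.1 * e ^ a.2) • P a.1 a.2) +
      c • (∑ a ∈ Finset.HasAntidiagonal.antidiagonal n, (c ^ a.1 * e ^ a.2) • Q a.1 a.2) = 0 := by
  cases n with
  | zero => simp [hP, hQ]
  | succ n =>
    rw [Finset.Nat.sum_antidiagonal_succ (f := fun a : ℕ × ℕ => (c ^ a.1 * e ^ a.2) • P a.1 a.2),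
      Finset.Nat.sum_antidiagonal_succ' (f := fun a : ℕ × ℕ => (c ^ a.1 * e ^ a.2) • Q a.1 a.2)]
    simp only [hP, hQ, smul_zero, zero_add, Finset.smul_sum, ← Finset.sum_add_distrib]
    refine Finset.sum_eq_zero fun a _ => ?_
    rw [eq_neg_of_add_eq_zero_left (h a.1 a.2)]
    module

theorem exch_seriesMat_add_exch_seriesMat_eq_zero {d o d' o' : Fin N → Fin N → ℂ}
    {i j k l : Fin N} {x y : ℕ → Matrix (Fin N) (Fin N) B}
    (hx : ∀ b, exch d o (x 0) (y b) i j k l = 0) (hy : ∀ a, exch d' o' (x a) (y 0) i j k l = 0)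
    (h : ∀ a b, exch d o (x (a + 1)) (y b) i j k l + exch d' o' (x a) (y (b + 1)) i j k l = 0)
    (c e : ℂ) :
    e • exch d o (seriesMat c x) (seriesMat e y) i j k l +
      c • exch d' o' (seriesMat c x) (seriesMat e y) i j k l = 0 := by
  ext n
  rw [map_add, LinearMap.map_smul_of_tower, LinearMap.map_smul_of_tower, coeff_exch_seriesMat,
    coeff_exch_seriesMat, map_zero]
  exact smul_sum_antidiagonal_add_smul_sum_antidiagonal_eq_zero
    (P := fun a b => exch d o (x a) (y b) i j k l)
    (Q := fun a b => exch d' o' (x a) (y b) i j k l) hx hy h c e n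

theorem exch_seriesMat_eq_zero {d o : Fin N → Fin N → ℂ} {i j k l : Fin N}
    {x y : ℕ → Matrix (Fin N) (Fin N) B} (hx : ∀ b, exch d o (x 0) (y b) i j k l = 0)
    (h : ∀ a b, exch d o (x (a + 1)) (y b) i j k l = exch d o (x a) (y (b + 1)) i j k l)
    (c e : ℂ) : exch d o (seriesMat c x) (seriesMat e y) i j k l = 0 := by
  have exch_eq_zero (a : ℕ) : ∀ b, exch d o (x a) (y b) i j k l = 0 := by
    induction a with
    | zero => exact hx
    | succ a ih => exact fun b => (h a b).trans (ih (b + 1))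
  ext n
  simp [coeff_exch_seriesMat, exch_eq_zero]

theorem X_sq_mul_exch_seriesMat_add_exch_seriesMat_eq_zero {d o d' o' : Fin N → Fin N → ℂ}
    {i j k l : Fin N} {x y : ℕ → Matrix (Fin N) (Fin N) B}
    (hx : ∀ b, exch d' o' (x 0) (y b) i j k l = 0) (hy : ∀ a, exch d' o' (x a) (y 0) i j k l = 0)
    (h : ∀ a b, exch d o (x a) (y b) i j k l + exch d' o' (x (a + 1)) (y (b + 1)) i j k l = 0)
    (c e : ℂ) :
    (c * e) • (PowerSeries.X ^ 2 * exch d o (seriesMat c x) (seriesMat e y) i j k l) +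
      exch d' o' (seriesMat c x) (seriesMat e y) i j k l = 0 := by
  ext n
  rw [map_add, LinearMap.map_smul_of_tower, PowerSeries.coeff_X_pow_mul', coeff_exch_seriesMat,
    coeff_exch_seriesMat, map_zero]
  match n with
  | 0 => simp [hx]
  | 1 => simp [Finset.Nat.antidiagonal_succ, hx, hy]
  | n + 2 =>
    rw [if_pos (by omega), Nat.add_sub_cancel, Finset.Nat.antidiagonal_succ_succ']
    simp only [Finset.sum_cons, Finset.sum_map, hx, hy, smul_zero, zero_add,
      Embedding.coe_prodMap, Prod.map_fst, Prod.map_snd, Embedding.coeFn_mk, Finset.smul_sum,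
      ← Finset.sum_add_distrib, Nat.succ_eq_add_one]
    refine Finset.sum_eq_zero fun a _ => ?_
    rw [eq_neg_of_add_eq_zero_left (h a.1 a.2)]
    module

theorem ofPowerSeriesAlg_exch (d o : Fin N → Fin N → ℂ)
    (X Y : Matrix (Fin N) (Fin N) (PowerSeries B)) (i j k l : Fin N) :
    HahnSeries.ofPowerSeriesAlg ℤ ℂ (exch d o X Y i j k l) =
      exch d o (X.map (HahnSeries.ofPowerSeriesAlg ℤ ℂ)) (Y.map (HahnSeries.ofPowerSeriesAlg ℤ ℂ))
        i j k l :=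
  exch_map _ d o X Y i j k l

end Series

/-! ### The defining relations as relations between generating series -/

section Relations

variable {N : ℕ} (q : ℂ)

/-- The matrix of the generators `t_{ij}^{(r)}`. -/
noncomputable def tMat (N : ℕ) (r : ℕ) : Matrix (Fin N) (Fin N) (UqAff q N) :=
  of fun i j => t q i j r

/-- The matrix of the generators `t̄_{ij}^{(r)}`. -/
noncomputable def tbarMat (N : ℕ) (r : ℕ) : Matrix (Fin N) (Fin N) (UqAff q N) :=
  of fun i j => tbar q i j r

/-- The coefficient of `u^a` in `T(u)`. -/
noncomputable def tCoeff (N : ℕ) (a : ℤ) : Matrix (Fin N) (Fin N) (UqAff q N) :=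
  if a ≤ 0 then tMat q N (-a).toNat else 0

/-- The coefficient of `u^a` in `T̄(u)`. -/
noncomputable def tbarCoeff (N : ℕ) (a : ℤ) : Matrix (Fin N) (Fin N) (UqAff q N) :=
  if 0 ≤ a then tbarMat q N a.toNat else 0

theorem map_freeT (a : ℤ) : (freeT N a).map (RingQuot.mkAlgHom ℂ (Rel q N)) = tCoeff q N a := by
  ext i j
  rw [tCoeff, map_apply, freeT, of_apply]
  split_ifs <;> simp [tMat, t]

theorem map_freeTbar (a : ℤ) :
    (freeTbar N a).map (RingQuot.mkAlgHom ℂ (Rel q N)) = tbarCoeff q N a := by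
  ext i j
  rw [tbarCoeff, map_apply, freeTbar, of_apply]
  split_ifs <;> simp [tbarMat, tbar]

theorem tCoeff_neg (r : ℕ) : tCoeff q N (-(r : ℤ)) = tMat q N r := by
  simp [tCoeff]

theorem tCoeff_one : tCoeff q N 1 = 0 := by
  simp [tCoeff]

theorem tbarCoeff_natCast (r : ℕ) : tbarCoeff q N (r : ℤ) = tbarMat q N r := by
  simp [tbarCoeff]

theorem tbarCoeff_neg_one : tbarCoeff q N (-1) = 0 := by
  simp [tbarCoeff]

theorem exch_add_exch_eq_zero_of_rel {X Y : ℤ → Matrix (Fin N) (Fin N) (FreeAlgebra ℂ (Gen N))}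
    {a b : ℤ} {i j k l : Fin N}
    (h : Rel q N (coeffRXY q X Y a b (i, j) (k, l)) (coeffYXR q X Y a b (i, j) (k, l))) :
    exch (dU q) (oU q) ((X (a - 1)).map (RingQuot.mkAlgHom ℂ (Rel q N)))
        ((Y b).map (RingQuot.mkAlgHom ℂ (Rel q N))) i j k l +
      exch (dV q) (oV q) ((X a).map (RingQuot.mkAlgHom ℂ (Rel q N)))
        ((Y (b - 1)).map (RingQuot.mkAlgHom ℂ (Rel q N))) i j k l = 0 := by
  rw [← exch_map, ← exch_map, ← map_add, ← coeffRXY_sub_coeffYXR, map_sub,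
    RingQuot.mkAlgHom_rel ℂ h, sub_self]

theorem exch_tCoeff_add_exch_tCoeff (a b : ℤ) (i j k l : Fin N) :
    exch (dU q) (oU q) (tCoeff q N (a - 1)) (tCoeff q N b) i j k l +
      exch (dV q) (oV q) (tCoeff q N a) (tCoeff q N (b - 1)) i j k l = 0 := by
  simpa only [map_freeT] using exch_add_exch_eq_zero_of_rel q (Rel.rtt a b (i, j) (k, l))

theorem exch_tbarCoeff_add_exch_tbarCoeff (a b : ℤ) (i j k l : Fin N) :
    exch (dU q) (oU q) (tbarCoeff q N (a - 1)) (tbarCoeff q N b) i j k l +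
      exch (dV q) (oV q) (tbarCoeff q N a) (tbarCoeff q N (b - 1)) i j k l = 0 := by
  simpa only [map_freeTbar] using exch_add_exch_eq_zero_of_rel q (Rel.rtbartbar a b (i, j) (k, l))

theorem exch_tbarCoeff_tCoeff_add (a b : ℤ) (i j k l : Fin N) :
    exch (dU q) (oU q) (tbarCoeff q N (a - 1)) (tCoeff q N b) i j k l +
      exch (dV q) (oV q) (tbarCoeff q N a) (tCoeff q N (b - 1)) i j k l = 0 := by
  simpa only [map_freeT, map_freeTbar] using
    exch_add_exch_eq_zero_of_rel q (Rel.rtbart a b (i, j) (k, l))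

theorem exch_tMat_zero_left (s : ℕ) (i j k l : Fin N) :
    exch (dU q) (oU q) (tMat q N 0) (tMat q N s) i j k l = 0 := by
  have h := exch_tCoeff_add_exch_tCoeff q 1 (-(s : ℤ)) i j k l
  rw [tCoeff_one, exch_zero_left, add_zero, tCoeff_neg] at h
  rw [← tCoeff_neg q 0]
  simpa using h

theorem exch_tMat_zero_right (r : ℕ) (i j k l : Fin N) :
    exch (dV q) (oV q) (tMat q N r) (tMat q N 0) i j k l = 0 := by
  have h := exch_tCoeff_add_exch_tCoeff q (-(r : ℤ)) 1 i j k l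
  rw [tCoeff_one, exch_zero_right, zero_add, tCoeff_neg] at h
  rw [← tCoeff_neg q 0]
  simpa using h

theorem exch_tMat_succ_add_exch_tMat_succ (r s : ℕ) (i j k l : Fin N) :
    exch (dU q) (oU q) (tMat q N (r + 1)) (tMat q N s) i j k l +
      exch (dV q) (oV q) (tMat q N r) (tMat q N (s + 1)) i j k l = 0 := by
  have h := exch_tCoeff_add_exch_tCoeff q (-(r : ℤ)) (-(s : ℤ)) i j k l
  rw [← neg_add', ← neg_add'] at h
  exact_mod_cast (by simpa only [← tCoeff_neg, Nat.cast_add, Nat.cast_one] using h)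

theorem exch_tbarMat_zero_left (s : ℕ) (i j k l : Fin N) :
    exch (dV q) (oV q) (tbarMat q N 0) (tbarMat q N s) i j k l = 0 := by
  have h := exch_tbarCoeff_add_exch_tbarCoeff q 0 (s + 1 : ℤ) i j k l
  rw [zero_sub, tbarCoeff_neg_one, exch_zero_left, zero_add, add_sub_cancel_right,
    tbarCoeff_natCast] at h
  rw [← tbarCoeff_natCast q 0]
  simpa using h

theorem exch_tbarMat_zero_right (r : ℕ) (i j k l : Fin N) :
    exch (dU q) (oU q) (tbarMat q N r) (tbarMat q N 0) i j k l = 0 := by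
  have h := exch_tbarCoeff_add_exch_tbarCoeff q (r + 1 : ℤ) 0 i j k l
  rw [zero_sub, tbarCoeff_neg_one, exch_zero_right, add_zero, add_sub_cancel_right,
    tbarCoeff_natCast] at h
  rw [← tbarCoeff_natCast q 0]
  simpa using h

theorem exch_tbarMat_succ_add_exch_tbarMat_succ (r s : ℕ) (i j k l : Fin N) :
    exch (dV q) (oV q) (tbarMat q N (r + 1)) (tbarMat q N s) i j k l +
      exch (dU q) (oU q) (tbarMat q N r) (tbarMat q N (s + 1)) i j k l = 0 := by
  have h := exch_tbarCoeff_add_exch_tbarCoeff q (r + 1 : ℤ) (s + 1 : ℤ) i j k l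
  rw [add_sub_cancel_right, add_sub_cancel_right] at h
  rw [add_comm]
  simpa only [← tbarCoeff_natCast, Nat.cast_add, Nat.cast_one] using h

theorem exch_tbarMat_zero_tMat (s : ℕ) (i j k l : Fin N) :
    exch (dV q) (oV q) (tbarMat q N 0) (tMat q N s) i j k l = 0 := by
  have h := exch_tbarCoeff_tCoeff_add q 0 (-(s : ℤ) + 1) i j k l
  rw [zero_sub, tbarCoeff_neg_one, exch_zero_left, zero_add, add_sub_cancel_right,
    tCoeff_neg] at h
  rw [← tbarCoeff_natCast q 0]
  simpa using h

theorem exch_tbarMat_tMat_zero (r : ℕ) (i j k l : Fin N) :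
    exch (dV q) (oV q) (tbarMat q N r) (tMat q N 0) i j k l = 0 := by
  have h := exch_tbarCoeff_tCoeff_add q (r : ℤ) 1 i j k l
  rw [tCoeff_one, exch_zero_right, zero_add, tbarCoeff_natCast] at h
  rw [← tCoeff_neg q 0]
  simpa using h

theorem exch_tbarMat_tMat_add_exch_succ (r s : ℕ) (i j k l : Fin N) :
    exch (dU q) (oU q) (tbarMat q N r) (tMat q N s) i j k l +
      exch (dV q) (oV q) (tbarMat q N (r + 1)) (tMat q N (s + 1)) i j k l = 0 := by
  have h := exch_tbarCoeff_tCoeff_add q (r + 1 : ℤ) (-(s : ℤ)) i j k l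
  rw [add_sub_cancel_right, ← neg_add'] at h
  simpa only [← tbarCoeff_natCast, ← tCoeff_neg, Nat.cast_add, Nat.cast_one] using h

theorem T_eq_map_seriesMat (c : ℂ) : T q N c =
    (seriesMat c⁻¹ (tMat q N)).map (HahnSeries.ofPowerSeriesAlg ℤ ℂ) := rfl

theorem Tbar_eq_map_seriesMat (c : ℂ) : Tbar q N c =
    (seriesMat c (tbarMat q N)).map (HahnSeries.ofPowerSeriesAlg ℤ ℂ) := rfl

variable {q}

theorem exch_T {c e : ℂ} (hc : c ≠ 0) (he : e ≠ 0) (i j k l : Fin N) :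
    c • exch (dU q) (oU q) (T q N c) (T q N e) i j k l +
      e • exch (dV q) (oV q) (T q N c) (T q N e) i j k l = 0 := by
  have h := congrArg (fun z => (c * e) • HahnSeries.ofPowerSeriesAlg ℤ ℂ z)
    (exch_seriesMat_add_exch_seriesMat_eq_zero (exch_tMat_zero_left q · i j k l)
      (exch_tMat_zero_right q · i j k l) (exch_tMat_succ_add_exch_tMat_succ q · · i j k l) c⁻¹ e⁻¹)
  simp only [map_add, map_smul, ofPowerSeriesAlg_exch, ← T_eq_map_seriesMat, map_zero, smul_zero,
    smul_add, smul_smul] at h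
  rwa [mul_assoc, mul_inv_cancel₀ he, mul_one, mul_right_comm, mul_inv_cancel₀ hc, one_mul] at h

theorem exch_Tbar (c e : ℂ) (i j k l : Fin N) :
    c • exch (dU q) (oU q) (Tbar q N c) (Tbar q N e) i j k l +
      e • exch (dV q) (oV q) (Tbar q N c) (Tbar q N e) i j k l = 0 := by
  have h := congrArg (HahnSeries.ofPowerSeriesAlg ℤ ℂ)
    (exch_seriesMat_add_exch_seriesMat_eq_zero (exch_tbarMat_zero_left q · i j k l)
      (exch_tbarMat_zero_right q · i j k l)
      (exch_tbarMat_succ_add_exch_tbarMat_succ q · · i j k l) c e)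
  simp only [map_add, map_smul, ofPowerSeriesAlg_exch, ← Tbar_eq_map_seriesMat, map_zero] at h
  rwa [add_comm]

theorem cu_mul_smul_single_two (B : Type*) [Ring B] [Algebra ℂ B] (c : ℂ) {e : ℂ} (he : e ≠ 0) :
    cu B e * ((c * e⁻¹) • HahnSeries.single 2 1) = cuInv B c := by
  have single_eq : (c * e⁻¹) • (HahnSeries.single 2 1 : LaurentSeries B) =
      HahnSeries.single 2 (algebraMap ℂ B (c * e⁻¹)) := by
    ext n
    by_cases h : n = 2 <;> simp [h, -map_mul, Algebra.algebraMap_eq_smul_one]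
  rw [single_eq, cu, cuInv, HahnSeries.single_mul_single, ← map_mul, mul_comm c,
    mul_inv_cancel_left₀ he]
  norm_num

theorem exch_Tbar_T (c : ℂ) {e : ℂ} (he : e ≠ 0) (i j k l : Fin N) :
    cuInv (UqAff q N) c * exch (dU q) (oU q) (Tbar q N c) (T q N e) i j k l +
      cu (UqAff q N) e * exch (dV q) (oV q) (Tbar q N c) (T q N e) i j k l = 0 := by
  have ofPowerSeries_X_sq : HahnSeries.ofPowerSeriesAlg ℤ ℂ
      (PowerSeries.X ^ 2 : PowerSeries (UqAff q N)) = HahnSeries.single 2 1 :=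
    mod_cast HahnSeries.ofPowerSeries_X_pow (Γ := ℤ) (R := UqAff q N) 2
  have h := congrArg (HahnSeries.ofPowerSeriesAlg ℤ ℂ)
    (X_sq_mul_exch_seriesMat_add_exch_seriesMat_eq_zero (exch_tbarMat_zero_tMat q · i j k l)
      (exch_tbarMat_tMat_zero q · i j k l) (exch_tbarMat_tMat_add_exch_succ q · · i j k l) c e⁻¹)
  simp only [map_add, map_smul, map_mul, ofPowerSeriesAlg_exch, ← Tbar_eq_map_seriesMat,
    ← T_eq_map_seriesMat, map_zero, ofPowerSeries_X_sq] at h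
  rw [← cu_mul_smul_single_two _ c he, mul_assoc, smul_mul_assoc, ← mul_add, h, mul_zero]

end Relations

/-! ### Relations at adjacent spectral parameters -/

section Adjacent

variable {N : ℕ} {K : Type*} [Field K]

theorem dU_comm (q : K) (i j : Fin N) : dU q i j = dU q j i := by
  simp only [dU, eq_comm]

theorem dV_comm (q : K) (i j : Fin N) : dV q i j = dV q j i := by
  simp only [dV, eq_comm]

theorem dU_smul_add_oU_smul {V : Type*} [AddCommGroup V] [Module K V] (q : K) {i j : Fin N}
    {a b : V} (h : i = j → a = b) :
    dU q i j • a + oU q i j • b = a - pq q i j • b + q⁻¹ • b := by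
  rcases lt_trichotomy i j with hij | hij | hij
  · simp [dU, oU, pq, hij, hij.not_gt, hij.ne]
  · simp [dU, oU, pq, hij, h hij]
  · simp only [dU, oU, pq, hij, hij.ne', if_true, if_false]
    module

theorem dV_smul_add_oV_smul {V : Type*} [AddCommGroup V] [Module K V] (q : K) {i j : Fin N}
    {a b : V} (h : i = j → a = b) :
    dV q i j • a + oV q i j • b = -(a - pq q i j • b) - q • b := by
  rcases lt_trichotomy i j with hij | hij | hij
  · simp only [dV, oV, pq, hij, hij.not_gt, hij.ne, if_true, if_false]
    module
  · simp [dV, oV, pq, hij, h hij]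
  · simp [dV, oV, pq, hij, hij.not_gt, hij.ne']

theorem ite_add_rho_smul {V : Type*} [AddCommGroup V] [Module K V] (q x y : K) {i j : Fin N}
    {a b : V} (h : i = j → a = b) :
    (if i = j then 0 else (x - y) • a) + rho q x y j i • b =
      x • (dU q i j • a + oU q i j • b) + y • (dV q i j • a + oV q i j • b) := by
  rcases lt_trichotomy i j with hij | hij | hij
  · simp only [dU, dV, oU, oV, rho, if_true, if_false, hij, hij.not_gt, hij.ne]
    module
  · simp only [dU, dV, oU, oV, rho, if_true, if_false, hij, h hij, lt_irrefl]
    module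
  · simp only [dU, dV, oU, oV, rho, if_true, if_false, hij, hij.not_gt, hij.ne']
    module

variable {A : Type*} [Ring A] [Algebra K A]

/-- An entry of `(1 - P^q) X₁ Y₂ - Y₂ X₁ (1 - P^q)`. -/
def pqExch (q : K) (X Y : Matrix (Fin N) (Fin N) A) (i j k l : Fin N) : A :=
  X i k * Y j l - pq q i j • (X j k * Y i l) - (Y j l * X i k - pq q l k • (Y j k * X i l))

theorem pqExch_transpose (q : K) (X Y : Matrix (Fin N) (Fin N) A) (i j k l : Fin N) :
    pqExch q X.transpose Y.transpose i j k l = -pqExch q Y X l k j i := by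
  simp only [pqExch, transpose_apply]
  abel

theorem exch_eq_sub (d o : Fin N → Fin N → K) (X Y : Matrix (Fin N) (Fin N) A)
    (i j k l : Fin N) : exch d o X Y i j k l =
      d i j • (X i k * Y j l) + o i j • (X j k * Y i l) -
        (d k l • (Y j l * X i k) + o l k • (Y j k * X i l)) :=
  sub_sub _ _ _

theorem exch_dU (q : K) (X Y : Matrix (Fin N) (Fin N) A) (i j k l : Fin N) :
    exch (dU q) (oU q) X Y i j k l =
      pqExch q X Y i j k l + q⁻¹ • (X j k * Y i l - Y j k * X i l) := by
  rw [exch_eq_sub, dU_comm q k l, dU_smul_add_oU_smul q (by rintro rfl; rfl),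
    dU_smul_add_oU_smul q (by rintro rfl; rfl), pqExch]
  module

theorem exch_dV (q : K) (X Y : Matrix (Fin N) (Fin N) A) (i j k l : Fin N) :
    exch (dV q) (oV q) X Y i j k l =
      -pqExch q X Y i j k l - q • (X j k * Y i l - Y j k * X i l) := by
  rw [exch_eq_sub, dV_comm q k l, dV_smul_add_oV_smul q (by rintro rfl; rfl),
    dV_smul_add_oV_smul q (by rintro rfl; rfl), pqExch]
  module

theorem pqExch_eq_zero_of_exch {q c : K} (hq : q ≠ 0) (hq2 : q ^ 2 ≠ 1) (hc : c ≠ 0)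
    {X Y : Matrix (Fin N) (Fin N) A} {i j k l : Fin N}
    (h : c • exch (dU q) (oU q) X Y i j k l +
      (q⁻¹ ^ 2 * c) • exch (dV q) (oV q) X Y i j k l = 0) : pqExch q X Y i j k l = 0 := by
  have smul_eq_zero : (c * (1 - q⁻¹ ^ 2)) • pqExch q X Y i j k l = 0 := by
    rw [← h, exch_dU, exch_dV]
    match_scalars <;> field_simp <;> ring
  refine (smul_eq_zero_iff_right (mul_ne_zero hc (sub_ne_zero.2 fun h' => hq2 ?_))).1 smul_eq_zero
  rwa [inv_pow, eq_comm, inv_eq_one] at h'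

theorem exch_dV_of_sq_eq_one {q : K} (hq2 : q ^ 2 = 1) (X Y : Matrix (Fin N) (Fin N) A)
    (i j k l : Fin N) : exch (dV q) (oV q) X Y i j k l = -exch (dU q) (oU q) X Y i j k l := by
  rw [exch_dU, exch_dV, inv_eq_of_mul_eq_one_left (sq q ▸ hq2), neg_add, sub_eq_add_neg]

theorem pqExch_self (q : K) (X : Matrix (Fin N) (Fin N) A) (i j k l : Fin N) :
    pqExch q X X i j k l = exch (dU q) (oU q) X X i j k l := by
  rw [exch_dU, sub_self, smul_zero, add_zero]

section Affine

variable {q c : ℂ}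

theorem exch_T_of_sq_eq_one (hq2 : q ^ 2 = 1) (c e : ℂ) (i j k l : Fin N) :
    exch (dU q) (oU q) (T q N c) (T q N e) i j k l = 0 := by
  have h := congrArg (HahnSeries.ofPowerSeriesAlg ℤ ℂ)
    (exch_seriesMat_eq_zero (exch_tMat_zero_left q · i j k l) (fun r s => by
      simpa only [exch_dV_of_sq_eq_one hq2, ← sub_eq_add_neg, sub_eq_zero] using
        exch_tMat_succ_add_exch_tMat_succ q r s i j k l) c⁻¹ e⁻¹)
  rwa [ofPowerSeriesAlg_exch, ← T_eq_map_seriesMat, ← T_eq_map_seriesMat, map_zero] at h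

theorem exch_Tbar_of_sq_eq_one (hq2 : q ^ 2 = 1) (c e : ℂ) (i j k l : Fin N) :
    exch (dU q) (oU q) (Tbar q N c) (Tbar q N e) i j k l = 0 := by
  have h := congrArg (HahnSeries.ofPowerSeriesAlg ℤ ℂ)
    (exch_seriesMat_eq_zero (fun s => by
      simpa only [exch_dV_of_sq_eq_one hq2, neg_eq_zero] using exch_tbarMat_zero_left q s i j k l)
      (fun r s => by
        simpa only [exch_dV_of_sq_eq_one hq2, neg_add_eq_zero] using
          exch_tbarMat_succ_add_exch_tbarMat_succ q r s i j k l) c e)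
  rwa [ofPowerSeriesAlg_exch, ← Tbar_eq_map_seriesMat, ← Tbar_eq_map_seriesMat, map_zero] at h

theorem pqExch_T (hq : q ≠ 0) (hc : c ≠ 0) (i j k l : Fin N) :
    pqExch q (T q N c) (T q N (q⁻¹ ^ 2 * c)) i j k l = 0 := by
  by_cases hq2 : q ^ 2 = 1
  · rw [inv_pow, hq2, inv_one, one_mul, pqExch_self, exch_T_of_sq_eq_one hq2]
  · exact pqExch_eq_zero_of_exch hq hq2 hc (exch_T hc (by positivity) i j k l)

theorem pqExch_Tbar (hq : q ≠ 0) (hc : c ≠ 0) (i j k l : Fin N) :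
    pqExch q (Tbar q N c) (Tbar q N (q⁻¹ ^ 2 * c)) i j k l = 0 := by
  by_cases hq2 : q ^ 2 = 1
  · rw [inv_pow, hq2, inv_one, one_mul, pqExch_self, exch_Tbar_of_sq_eq_one hq2]
  · exact pqExch_eq_zero_of_exch hq hq2 hc (exch_Tbar _ _ i j k l)

end Affine

end Adjacent

section MatrixRelations

variable {N : ℕ} {K A : Type*} [Field K] [Ring A] [Algebra K A] {q : K}
  {X Y : Matrix (Fin N) (Fin N) A}

theorem one_sub_permMat_mul_apply (q : K) (X Y : Matrix (Fin N) (Fin N) A) (i j k l : Fin N) :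
    ((1 - base A (permMat N q)) * (X ⊗ₖ (1 : Matrix (Fin N) (Fin N) A)) *
      ((1 : Matrix (Fin N) (Fin N) A) ⊗ₖ Y)) (i, j) (k, l) =
      X i k * Y j l - pq q i j • (X j k * Y i l) := by
  rw [Matrix.mul_assoc, kronecker_one_mul_one_kronecker, Matrix.sub_mul, Matrix.one_mul,
    Matrix.sub_apply, of_apply]
  congr 1
  simp only [Matrix.mul_apply, Fintype.sum_prod_type, permMat, map_apply, of_apply, ite_and,
    apply_ite (algebraMap K A), map_zero, ite_mul, zero_mul, Finset.sum_ite_eq,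
    Finset.mem_univ, if_true, Algebra.smul_def]

theorem mul_one_sub_permMat_apply (q : K) (X Y : Matrix (Fin N) (Fin N) A) (i j k l : Fin N) :
    (((1 : Matrix (Fin N) (Fin N) A) ⊗ₖ Y) * (X ⊗ₖ (1 : Matrix (Fin N) (Fin N) A)) *
      (1 - base A (permMat N q))) (i, j) (k, l) =
      Y j l * X i k - pq q l k • (Y j k * X i l) := by
  rw [one_kronecker_mul_kronecker_one, Matrix.mul_sub, Matrix.mul_one, Matrix.sub_apply, of_apply]
  congr 1
  simp only [Matrix.mul_apply, Fintype.sum_prod_type, permMat, map_apply, of_apply, ite_and,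
    apply_ite (algebraMap K A), map_zero, mul_ite, mul_zero, Finset.sum_ite_irrel,
    Finset.sum_ite_eq', Finset.mem_univ, if_true, Finset.sum_const_zero, Algebra.smul_def,
    Algebra.commutes]

theorem one_sub_permMat_mul_eq_of_pqExch (h : ∀ i j k l, pqExch q X Y i j k l = 0) :
    (1 - base A (permMat N q)) * (X ⊗ₖ (1 : Matrix (Fin N) (Fin N) A)) *
        ((1 : Matrix (Fin N) (Fin N) A) ⊗ₖ Y) =
      ((1 : Matrix (Fin N) (Fin N) A) ⊗ₖ Y) * (X ⊗ₖ (1 : Matrix (Fin N) (Fin N) A)) *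
        (1 - base A (permMat N q)) := by
  ext ⟨i, j⟩ ⟨k, l⟩
  rw [one_sub_permMat_mul_apply, mul_one_sub_permMat_apply]
  exact sub_eq_zero.1 (h i j k l)

theorem transpose_mul_rtMat_mul_eq_of_exch {x y : K} (h : ∀ i j k l,
    x • exch (dU q) (oU q) X Y i j k l + y • exch (dV q) (oV q) X Y i j k l = 0) :
    (X.transpose ⊗ₖ (1 : Matrix (Fin N) (Fin N) A)) * base A (rtMat N q x y) *
        ((1 : Matrix (Fin N) (Fin N) A) ⊗ₖ Y) =
      ((1 : Matrix (Fin N) (Fin N) A) ⊗ₖ Y) * base A (rtMat N q x y) *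
        (X.transpose ⊗ₖ (1 : Matrix (Fin N) (Fin N) A)) := by
  ext ⟨a, j⟩ ⟨i, b⟩
  rw [kronecker_one_mul_rtMat_mul_one_kronecker_apply,
    one_kronecker_mul_rtMat_mul_kronecker_one_apply,
    ite_add_rho_smul q x y (by rintro rfl; rfl), ite_add_rho_smul q x y (by rintro rfl; rfl),
    ← sub_eq_zero, ← h i j a b, exch_eq_sub, exch_eq_sub, dU_comm q b a, dV_comm q b a]
  simp only [transpose_apply]
  module

end MatrixRelations

/-! ### The generator matrices of the quantum affine algebra -/

section Affine

variable {N : ℕ} {q : ℂ}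

noncomputable instance : Algebra (LaurentSeries ℂ) (USeries q N) :=
  (laurentMap (UqAff q N)).toAlgebra' laurentMap_mul_comm

theorem algebraMap_eq_laurentMap (x : LaurentSeries ℂ) :
    algebraMap (LaurentSeries ℂ) (USeries q N) x = laurentMap (UqAff q N) x := rfl

theorem C_smul (z : ℂ) (a : USeries q N) : (HahnSeries.C z : LaurentSeries ℂ) • a = z • a := by
  rw [Algebra.smul_def, algebraMap_eq_laurentMap, laurentMap_C, ← Algebra.smul_def]

theorem pq_C (i j : Fin N) :
    pq (HahnSeries.C q : LaurentSeries ℂ) i j = HahnSeries.C (pq q i j) := by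
  simp only [pq, apply_ite (HahnSeries.C : ℂ →+* LaurentSeries ℂ), map_inv₀, map_one]

theorem dU_C (i j : Fin N) :
    dU (HahnSeries.C q : LaurentSeries ℂ) i j = HahnSeries.C (dU q i j) := by
  simp only [dU, apply_ite (HahnSeries.C : ℂ →+* LaurentSeries ℂ), map_inv₀, map_one]

theorem dV_C (i j : Fin N) :
    dV (HahnSeries.C q : LaurentSeries ℂ) i j = HahnSeries.C (dV q i j) := by
  simp only [dV, apply_ite (HahnSeries.C : ℂ →+* LaurentSeries ℂ), map_neg, map_one]

theorem oU_C (i j : Fin N) :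
    oU (HahnSeries.C q : LaurentSeries ℂ) i j = HahnSeries.C (oU q i j) := by
  simp only [oU, apply_ite (HahnSeries.C : ℂ →+* LaurentSeries ℂ), map_sub, map_inv₀, map_zero]

theorem oV_C (i j : Fin N) :
    oV (HahnSeries.C q : LaurentSeries ℂ) i j = HahnSeries.C (oV q i j) := by
  simp only [oV, apply_ite (HahnSeries.C : ℂ →+* LaurentSeries ℂ), map_sub, map_inv₀, map_zero]

theorem pqExch_C (X Y : Matrix (Fin N) (Fin N) (USeries q N)) (i j k l : Fin N) :
    pqExch (HahnSeries.C q : LaurentSeries ℂ) X Y i j k l = pqExch q X Y i j k l := by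
  simp only [pqExch, pq_C, C_smul]

theorem C_mul_cuInv (z c : ℂ) : HahnSeries.C z * cuInv ℂ c = cuInv ℂ (z * c) := by
  simp [cuInv, HahnSeries.C_apply]

theorem C_mul_cu (z c : ℂ) : HahnSeries.C z * cu ℂ c = cu ℂ (z * c) := by
  simp [cu, HahnSeries.C_apply]

theorem cuInv_sub_cu_ne_zero (c : ℂ) {e : ℂ} (he : e ≠ 0) : cuInv ℂ c - cu ℂ e ≠ 0 := by
  have coeff_eq : (cuInv ℂ c - cu ℂ e).coeff (-1) = -e := by simp [cuInv, cu]
  intro h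
  rw [h, HahnSeries.coeff_zero] at coeff_eq
  exact neg_ne_zero.2 he coeff_eq.symm

theorem coeff_ofPowerSeries_of_neg {B : Type*} [Semiring B] (p : PowerSeries B) {k : ℤ}
    (hk : k < 0) : (HahnSeries.ofPowerSeries ℤ B p).coeff k = 0 := by
  rw [HahnSeries.ofPowerSeries_apply]
  refine HahnSeries.embDomain_of_notMem_range ?_
  rintro ⟨n, rfl⟩
  exact (Int.natCast_nonneg n).not_gt hk

theorem coeff_T_zero (c : ℂ) (i j : Fin N) : (T q N c i j).coeff 0 = t q i j 0 := by
  have := HahnSeries.ofPowerSeries_apply_coeff (Γ := ℤ)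
    (PowerSeries.mk fun r => (c⁻¹) ^ r • t q i j r) 0
  simpa [T] using this

theorem coeff_Tbar_zero (c : ℂ) (i j : Fin N) : (Tbar q N c i j).coeff 0 = tbar q i j 0 := by
  have := HahnSeries.ofPowerSeries_apply_coeff (Γ := ℤ)
    (PowerSeries.mk fun r => c ^ r • tbar q i j r) 0
  simpa [Tbar] using this

theorem t_zero_of_lt {i j : Fin N} (h : i < j) : t q i j 0 = 0 := by
  rw [t, RingQuot.mkAlgHom_rel ℂ (Rel.t_zero i j h), map_zero]

theorem tbar_zero_of_lt {i j : Fin N} (h : i < j) : tbar q j i 0 = 0 := by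
  rw [tbar, RingQuot.mkAlgHom_rel ℂ (Rel.tbar_zero i j h), map_zero]

theorem t_mul_tbar (i : Fin N) : t q i i 0 * tbar q i i 0 = 1 := by
  rw [t, tbar, ← map_mul, RingQuot.mkAlgHom_rel ℂ (Rel.t_tbar i), map_one]

theorem tbar_mul_t (i : Fin N) : tbar q i i 0 * t q i i 0 = 1 := by
  rw [t, tbar, ← map_mul, RingQuot.mkAlgHom_rel ℂ (Rel.tbar_t i), map_one]

theorem eq_zero_of_vecMul_T {c : ℂ} {g : Fin N → USeries q N} (h : g ᵥ* T q N c = 0) :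
    g = 0 := by
  refine eq_zero_of_vecMul_eq_zero (fun i j k hk => ?_) (fun i j hij => ?_)
    (fun i => ⟨tbar q i i 0, ?_⟩) h
  · exact coeff_ofPowerSeries_of_neg _ hk
  · rw [coeff_T_zero, t_zero_of_lt hij]
  · rw [coeff_T_zero, t_mul_tbar]

theorem eq_zero_of_vecMul_transpose_Tbar {c : ℂ} {g : Fin N → USeries q N}
    (h : g ᵥ* (Tbar q N c).transpose = 0) : g = 0 := by
  refine eq_zero_of_vecMul_eq_zero (fun i j k hk => ?_) (fun i j hij => ?_)
    (fun i => ⟨t q i i 0, ?_⟩) h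
  · exact coeff_ofPowerSeries_of_neg _ hk
  · rw [transpose_apply, coeff_Tbar_zero, tbar_zero_of_lt hij]
  · rw [transpose_apply, coeff_Tbar_zero, tbar_mul_t]

theorem smul_exch_Tbar_T (c : ℂ) {e : ℂ} (he : e ≠ 0) (i j k l : Fin N) :
    letI Q : LaurentSeries ℂ := HahnSeries.C q
    cuInv ℂ c • exch (dU Q) (oU Q) (Tbar q N c) (T q N e) i j k l +
      cu ℂ e • exch (dV Q) (oV Q) (Tbar q N c) (T q N e) i j k l = 0 := by
  have h := exch_Tbar_T (q := q) c he i j k l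
  rw [← laurentMap_cuInv, ← laurentMap_cu, ← algebraMap_eq_laurentMap, ← algebraMap_eq_laurentMap,
    ← Algebra.smul_def, ← Algebra.smul_def] at h
  simpa only [exch, dU_C, dV_C, oU_C, oV_C, C_smul] using h

theorem inv_sq_mul_zpow (hq : q ≠ 0) (k : ℤ) : q⁻¹ ^ 2 * q ^ k = q ^ (k - 2) := by
  rw [zpow_sub₀ hq, inv_pow, div_eq_inv_mul]
  norm_cast

/-- The matrices `T(u_k)` and `T̄(u_k⁻¹)ᵗ` over the quantum affine algebra. -/
noncomputable def affineData (hq : q ≠ 0) (N : ℕ) :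
    RTTData N (HahnSeries.C q : LaurentSeries ℂ) (USeries q N) where
  x k := cuInv ℂ (q ^ (2 * (k : ℤ)))
  y k := cu ℂ (q ^ (-2 * (k : ℤ)))
  X k := T q N (q ^ (-2 * (k : ℤ)))
  Y k := (Tbar q N (q ^ (2 * (k : ℤ)))).transpose
  y_succ k := by
    rw [← map_inv₀, ← map_pow, C_mul_cu, inv_sq_mul_zpow hq]
    congr 2
    push_cast
    ring
  ne_zero k := by
    rw [← map_inv₀, C_mul_cu, C_mul_cuInv]
    exact cuInv_sub_cu_ne_zero _ (mul_ne_zero hq (zpow_ne_zero _ hq))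
  rXX k := one_sub_permMat_mul_eq_of_pqExch fun i j k' l => by
    have exponent : -2 * ((k + 1 : ℕ) : ℤ) = -2 * k - 2 := by push_cast; ring
    rw [pqExch_C, exponent, ← inv_sq_mul_zpow hq]
    exact pqExch_T hq (zpow_ne_zero _ hq) i j k' l
  rYY k := one_sub_permMat_mul_eq_of_pqExch fun i j k' l => by
    have exponent : 2 * (k : ℤ) = 2 * ((k + 1 : ℕ) : ℤ) - 2 := by push_cast; ring
    rw [pqExch_C, pqExch_transpose, exponent, ← inv_sq_mul_zpow hq, neg_eq_zero]
    exact pqExch_Tbar hq (zpow_ne_zero _ hq) l k' j i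
  rYX k l := transpose_mul_rtMat_mul_eq_of_exch fun i j a b =>
    smul_exch_Tbar_T _ (zpow_ne_zero _ hq) i j a b
  cancelX _ _ h := eq_zero_of_vecMul_T h
  cancelY _ _ h := eq_zero_of_vecMul_transpose_Tbar h

end Affine

/-! ### The Sklyanin determinant -/

namespace RTTData

variable {N : ℕ} {K A : Type*} [Field K] [Ring A] [Algebra K A] {q : K} (d : RTTData N q A)

theorem skl_eq_prod (r s : ℕ) : d.skl r s = ((List.finRange r).map fun k : Fin r =>
    oneSite (d.S (s + k)) k * (((List.finRange r).filter fun l => k < l).map fun l : Fin r =>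
      twoSite (base A (rtMat N q (d.x (s + k)) (d.y (s + l)))) k l).prod).prod := by
  induction r generalizing s with
  | zero => simp [skl]
  | succ r ih =>
    have index_succ (m : ℕ) : s + 1 + m = s + (m + 1) := by omega
    simp only [skl, ih, head, List.finRange_succ, List.map_cons, List.prod_cons, liftCons_prod,
      List.map_map, decide_false, decide_true, Bool.false_eq_true, not_false_eq_true,
      List.filter_cons_of_neg, List.filter_map, Fin.succ_pos, Fin.succ_lt_succ_iff,
      List.filter_true, Function.comp_def, liftCons_mul, liftCons_oneSite, liftCons_twoSite,
      Fin.val_succ, Fin.val_zero, add_zero, index_succ, Fin.not_lt_zero]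

end RTTData

section Main

variable {N : ℕ} {q : ℂ}

theorem affineData_S (hq : q ≠ 0) (k : ℕ) : (affineData hq N).S k = S q N (q ^ (-2 * (k : ℤ))) := by
  rw [RTTData.S, S, ← _root_.zpow_neg, ← neg_mul, neg_neg]
  rfl

theorem affineData_SbarT (hq : q ≠ 0) (k : ℕ) :
    (affineData hq N).SbarT k = (Sbar q N (q ^ (2 * (k : ℤ)))).transpose := by
  ext1 i j
  rw [RTTData.SbarT, Sbar, transpose_apply, Matrix.mul_apply, of_apply]
  simp only [affineData, transpose_apply, ← _root_.zpow_neg, neg_mul]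

theorem transpose₁_trigR (x y : LaurentSeries ℂ) :
    transpose₁ (trigR N q (laurentMap (UqAff q N) x) (laurentMap (UqAff q N) y)) =
      base (USeries q N) (rtMat N (HahnSeries.C q) x y) := by
  ext1 ⟨a, j⟩ ⟨i, b⟩
  have entry : rtMat N (HahnSeries.C q : LaurentSeries ℂ) x y (a, j) (i, b) =
      (if i = a ∧ j = b then dU (HahnSeries.C q : LaurentSeries ℂ) i j * x +
        dV (HahnSeries.C q : LaurentSeries ℂ) i j * y else 0) +
      if i = b ∧ j = a then oU (HahnSeries.C q : LaurentSeries ℂ) i j * x +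
        oV (HahnSeries.C q : LaurentSeries ℂ) i j * y else 0 := by
    simp only [rtMat, of_apply, Prod.mk.injEq, rho, dU, dV, oU, oV]
    grind
  rw [base, map_apply, entry, algebraMap_eq_laurentMap, transpose₁, of_apply, trigR_apply, map_add]
  simp only [dU_C, dV_C, oU_C, oV_C, apply_ite (laurentMap (UqAff q N)), map_add, map_mul,
    map_zero, laurentMap_C, Algebra.smul_def]

theorem Rt_eq (hq : q ≠ 0) (k l : Fin N) :
    Rt q N k l = twoSite (base (USeries q N) (rtMat N (HahnSeries.C q)
      ((affineData hq N).x k) ((affineData hq N).y l))) k l := by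
  rw [Rt, ← laurentMap_cu, ← laurentMap_cuInv, transpose₁_trigR]
  rfl

theorem sklyaninProduct_eq (hq : q ≠ 0) : sklyaninProduct q N = (affineData hq N).skl N 0 := by
  simp only [RTTData.skl_eq_prod, sklyaninProduct, affineData_S, zero_add, ← Rt_eq hq]

instance : NeZero (2 : LaurentSeries ℂ) where
  out := map_ofNat (HahnSeries.C : ℂ →+* LaurentSeries ℂ) 2 ▸ HahnSeries.C_ne_zero two_ne_zero

theorem QAntisymm.map_C {r : ℕ} {f : (Fin r → Fin N) → ℂ} (hf : QAntisymm q f) :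
    QAntisymm (HahnSeries.C q : LaurentSeries ℂ) fun b =>
      (HahnSeries.C (f b) : LaurentSeries ℂ) := by
  intro k b
  simpa only [map_neg, smul_eq_mul, map_mul, pq_C] using
    congrArg (HahnSeries.C : ℂ →+* LaurentSeries ℂ) (hf k b)

theorem isSklyaninDet_det (hq : q ≠ 0) : IsSklyaninDet q N (affineData hq N).det := by
  rw [IsSklyaninDet, sklyaninProduct_eq hq]
  ext1 a b
  have row_qAntisymm : QAntisymm q (qAntisym N N q a) := by
    have := qAntisymm_vecMul_qAntisym (N := N) (r := N) hq (Pi.single a 1)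
    rwa [single_one_vecMul] at this
  have row_eq : toAlg (USeries q N)
      (fun b => (HahnSeries.C (qAntisym N N q a b) : LaurentSeries ℂ)) =
        ((qAntisym N N q).map (algebraMap ℂ (USeries q N))) a := by
    funext b
    rw [toAlg, algebraMap_eq_laurentMap, laurentMap_C, map_apply]
  have row := (affineData hq N).vecMul_skl_eq_smul_det (HahnSeries.C_ne_zero hq)
    row_qAntisymm.map_C b
  rw [row_eq, C_smul] at row
  rw [Matrix.smul_apply, map_apply, smul_eq_mul, ← Algebra.commutes, ← Algebra.smul_def, ← row]
  rfl

theorem IsSklyaninDet.unique (hq : q ≠ 0) {D D' : USeries q N} (hD : IsSklyaninDet q N D)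
    (hD' : IsSklyaninDet q N D') : D = D' := by
  have entry := congrFun (congrFun (hD.symm.trans hD') id) id
  simpa [qAntisym_id hq] using entry

theorem gamma_eq (hq : q ≠ 0) : gamma q N = (affineData hq N).gam N 0 := by
  simp [gamma, RTTData.gam, affineData]

theorem gamma_ne_zero (hq : q ≠ 0) : gamma q N ≠ 0 := by
  refine Finset.prod_ne_zero_iff.2 fun i _ => Finset.prod_ne_zero_iff.2 fun j _ => ?_
  split_ifs
  · exact cuInv_sub_cu_ne_zero _ (zpow_ne_zero _ hq)
  · exact one_ne_zero

theorem sdet_eq (hq : q ≠ 0) : sdet q N = (affineData hq N).det :=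
  IsSklyaninDet.unique hq (Classical.epsilon_spec ⟨_, isSklyaninDet_det hq⟩) (isSklyaninDet_det hq)

theorem c_eq (hq : q ≠ 0) : c q N = ∑ p : Equiv.Perm (Fin N),
    (-q) ^ (-(length p : ℤ) + (length (piMap p) : ℤ)) •
      (affineData hq N).entryProd N 0 p (piMap p) := by
  have c_eq_smul : c q N = (gamma q N)⁻¹ • sdet q N := by
    rw [Algebra.smul_def]
    rfl
  rw [c_eq_smul, sdet_eq hq, RTTData.det_eq _ (HahnSeries.C_ne_zero hq), ← gamma_eq,
    inv_smul_smul₀ (gamma_ne_zero hq)]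
  simp only [← map_neg, ← map_zpow₀, C_smul]

end Main

end TwistedQYangian

open TwistedQYangian in
theorem theorem4p7_general (q : ℂ) (hq : q ≠ 0) (N : ℕ) :
    (∃! D, TwistedQYangian.IsSklyaninDet q N D) ∧
    TwistedQYangian.c q N =
      ∑ p : Equiv.Perm (Fin N),
        (-q) ^ (-(TwistedQYangian.length p : ℤ)
            + (TwistedQYangian.length (TwistedQYangian.piMap p) : ℤ)) •
          ((List.finRange N).map fun i : Fin N =>
            if (i : ℕ) < N / 2 then
              (TwistedQYangian.Sbar q N (q ^ (2 * ((i : ℕ) : ℤ)))).transpose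
                (p i) (TwistedQYangian.piMap p i)
            else
              TwistedQYangian.S q N (q ^ (-2 * ((i : ℕ) : ℤ)))
                (p i) (TwistedQYangian.piMap p i)).prod := by
  refine ⟨⟨_, isSklyaninDet_det hq, fun D hD => hD.unique hq (isSklyaninDet_det hq)⟩, ?_⟩
  rw [c_eq hq]
  simp only [RTTData.entryProd, affineData_S, affineData_SbarT, zero_add]

theorem theorem4p7 (q : ℂ) (hq : q ≠ 0) (hroot : ∀ k : ℕ, 0 < k → q ^ k ≠ 1) (N : ℕ) :
    (∃! D, TwistedQYangian.IsSklyaninDet q N D) ∧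
    TwistedQYangian.c q N =
      ∑ p : Equiv.Perm (Fin N),
        (-q) ^ (-(TwistedQYangian.length p : ℤ)
            + (TwistedQYangian.length (TwistedQYangian.piMap p) : ℤ)) •
          ((List.finRange N).map fun i : Fin N =>
            if (i : ℕ) < N / 2 then
              (TwistedQYangian.Sbar q N (q ^ (2 * ((i : ℕ) : ℤ)))).transpose
                (p i) (TwistedQYangian.piMap p i)
            else
              TwistedQYangian.S q N (q ^ (-2 * ((i : ℕ) : ℤ)))
                (p i) (TwistedQYangian.piMap p i)).prod :=
  theorem4p7_general q hq N
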